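/- **Definitions.** A (relational) structure $\mathcal H=(V,\mathbf R)$ has a finite universe $V$ and a finite signature of relation symbols with arities, each interpreted as a relation over $V$. Its size is $\|\mathcal H\| = |\sigma| + |V| + \sum_{R\in\sigma} |R^{\mathcal H}|\cdot \mathrm{ar}(R)$. A path decomposition of a structure is a path decomposition of its Gaifman graph (two distinct elements are adjacent if they occur together in a tuple of some relation). For a fixed structure $\mathcal H$, $\#\mathrm{Hom}(\mathcal H)$ is the problem of computing, for an input structure $\mathcal G$ with the same signature, the number of homomorphisms from $\mathcal G$ to $\mathcal H$; $\#\mathrm{LHom}(\mathcal H)$ is the problem $\#\mathrm{Hom}(\mathcal H^+)$, where $\mathcal H^+$ is obtained from $\mathcal H$ by adding all non-empty unary relations over $V$. A graph $H=(V,E)$ is regarded as a structure with the single binary relation $E$. A *pathwidth-preserving reduction* from problem $A$ to problem $B$ (both taking as input a structure given along with a path decomposition) is a polynomial-time Turing reduction from $A$ to $B$ that, executed on an instance $\mathcal G$ of $A$ given with a path decomposition of width at most $t$, makes oracle calls to $B$ only on structures of size polynomial in $\|\mathcal G\|$, given with a path decomposition of width at most $t+\mathcal O(1)$. A relation $R\subseteq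 V^{p}$ is *realizable* by $\mathcal H=(V,\mathbf R)$ if there is a pathwidth-preserving reduction from $\#\mathrm{LHom}((V,\mathbf R\cup\{R\}))$ to $\#\mathrm{LHom}(\mathcal H)$. Let $H$ be a finite connected bipartite graph. A set $S\subseteq V(H)$ is *irredundant* if distinct vertices of $S$ have distinct neighborhoods, and *one-sided* if it is contained in one of the two bipartition classes of $H$; $\operatorname{irr}(H)$ is the maximum size of a one-sided irredundant set. **Lemma.** Let $H=(V,E)$ be a finite connected bipartite graph with $\operatorname{irr}(H)\ge 2$, and let $S\subseteq V$ be a one-sided irredundant set. Then for every fixed $p\ge 1$, every relation $R\subseteq S^p$ is realizable by $H$; that is, there is a pathwidth-preserving reduction from $\#\mathrm{LHom}((V,\{E,R\}))$ to $\#\mathrm{LHom}(H)$. -/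

import Mathlib

/-! ### Bipartite graphs: irredundant and one-sided sets -/

/-- A set of vertices is irredundant if distinct members have distinct neighbourhoods. -/
def Irredundant {V : Type*} (H : SimpleGraph V) (S : Set V) : Prop :=
  ∀ u ∈ S, ∀ v ∈ S, u ≠ v → H.neighborSet u ≠ H.neighborSet v

/-- A set of vertices is one-sided if it lies in one class `X` of a bipartition `(X, Xᶜ)` of `H`.
For connected `H` the bipartition is unique up to exchanging its two classes. -/
def OneSided {V : Type*} (H : SimpleGraph V) (S : Set V) : Prop :=
  ∃ X : Set V, H.IsBipartiteWith X Xᶜ ∧ S ⊆ X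

/-- `irr(H)` for a finite connected bipartite graph: the maximum size of a one-sided irredundant
set. -/
noncomputable def irr {V : Type*} [Fintype V] (H : SimpleGraph V) : ℕ :=
  sSup {k | ∃ S : Finset V, OneSided H (S : Set V) ∧ Irredundant H (S : Set V) ∧ S.card = k}

/-! ### Relational structures and homomorphisms -/

/-- A relational structure with universe `U`; the relation symbols are the elements of `σ`, and
the symbol `s` has arity `ar s`. -/
def RelStr {σ : Type*} (ar : σ → ℕ) (U : Type*) : Type _ :=
  (s : σ) → Set (Fin (ar s) → U)

namespace RelStr

variable {σ : Type*} {ar : σ → ℕ} {U V : Type*}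

/-- `h` maps every tuple of every relation of `G` to a tuple of the same relation of `H`. -/
def IsHom (G : RelStr ar U) (H : RelStr ar V) (h : U → V) : Prop :=
  ∀ s : σ, ∀ x ∈ G s, (fun i => h (x i)) ∈ H s

/-- The number of homomorphisms from `G` to `H`. -/
noncomputable def homCount (G : RelStr ar U) (H : RelStr ar V) : ℕ :=
  Nat.card {h : U → V // IsHom G H h}

/-- The size `‖G‖`: number of symbols plus number of elements plus the total length of all tuples
in all relations. -/
noncomputable def norm [Fintype σ] [Fintype U] (G : RelStr ar U) : ℕ :=
  Fintype.card σ + Fintype.card U + ∑ s : σ, (G s).ncard * ar s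

/-- The Gaifman graph: two distinct elements are adjacent if they occur in a common tuple. -/
def gaifman (G : RelStr ar U) : SimpleGraph U where
  Adj u v := u ≠ v ∧ ∃ s : σ, ∃ x ∈ G s, u ∈ Set.range x ∧ v ∈ Set.range x
  symm := ⟨fun _ _ ⟨hne, s, x, hx, hu, hv⟩ => ⟨hne.symm, s, x, hx, hv, hu⟩⟩
  loopless := ⟨fun _ h => h.1 rfl⟩

/-- Arities after adding one `p`-ary relation symbol. -/
def addArity (ar : σ → ℕ) (p : ℕ) : Option σ → ℕ
  | none => p
  | some s => ar s

/-- The structure `(V, 𝐑 ∪ {R})`. -/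
def addRel (H : RelStr ar V) {p : ℕ} (R : Set (Fin p → V)) : RelStr (addArity ar p) V
  | none => R
  | some s => H s

/-- Arities after adding one unary symbol for every non-empty subset of `V`. -/
def listArity (ar : σ → ℕ) (V : Type*) : σ ⊕ {L : Finset V // L.Nonempty} → ℕ
  | Sum.inl s => ar s
  | Sum.inr _ => 1

/-- The structure `H⁺`: `H` together with all non-empty unary relations over its universe.
Counting list homomorphisms to `H` means counting homomorphisms to `H⁺`. -/
def plus (H : RelStr ar V) : RelStr (listArity ar V) V
  | Sum.inl s => H s
  | Sum.inr L => {x : Fin 1 → V | x 0 ∈ L.1}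

/-- A graph as a structure with one (symmetric) binary relation. -/
def ofGraph (H : SimpleGraph V) : RelStr (fun _ : Unit => 2) V :=
  fun _ => {x : Fin 2 → V | H.Adj (x 0) (x 1)}

end RelStr

/-! ### Path decompositions -/

/-- A sequence of bags that covers all vertices and all edges of `Γ` and in which the bags
containing any fixed vertex are consecutive. -/
structure IsPathDecomposition {U : Type*} (Γ : SimpleGraph U) (bags : List (Finset U)) : Prop where
  vertex : ∀ v : U, ∃ B ∈ bags, v ∈ B
  edge : ∀ u v : U, Γ.Adj u v → ∃ B ∈ bags, u ∈ B ∧ v ∈ B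
  consecutive : ∀ (i j k : Fin bags.length), i ≤ j → j ≤ k →
    ∀ v : U, v ∈ bags.get i → v ∈ bags.get k → v ∈ bags.get j

/-! ### A machine model with an oracle and a step count

Programs work on binary trees whose leaves are natural numbers. Numbers are measured by their
binary length, every elementary operation is charged the size of the data it reads and writes, and
an oracle call is charged the size of the query and of the answer. Polynomial time in this model
is the same as polynomial time on multitape oracle Turing machines. -/

/-- Data: binary trees with natural numbers at the leaves. -/
inductive Val where
  | nat (n : ℕ)
  | pair (a b : Val)
deriving DecidableEq

namespace Val

/-- Size of a datum, with numbers written in binary. -/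
def size : Val → ℕ
  | nat n => Nat.size n + 1
  | pair a b => a.size + b.size + 1

/-- Lists as nested pairs, terminated by `0`. -/
def ofList : List Val → Val
  | [] => nat 0
  | a :: l => pair a (ofList l)

end Val

/-- Elementary operations. -/
inductive Op where
  | id
  | const (c : Val)
  | fst
  | snd
  | add
  | sub
  | mul
  | div
  | eq

/-- The effect of the elementary operations; on an operand of the wrong shape the result is `0`. -/
def Op.apply : Op → Val → Val
  | Op.id, v => v
  | Op.const c, _ => c
  | Op.fst, Val.pair a _ => a
  | Op.snd, Val.pair _ b => b
  | Op.add, Val.pair (Val.nat m) (Val.nat n) => Val.nat (m + n)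
  | Op.sub, Val.pair (Val.nat m) (Val.nat n) => Val.nat (m - n)
  | Op.mul, Val.pair (Val.nat m) (Val.nat n) => Val.nat (m * n)
  | Op.div, Val.pair (Val.nat m) (Val.nat n) => Val.nat (m / n)
  | Op.eq, Val.pair a b => if a = b then Val.nat 1 else Val.nat 0
  | _, _ => Val.nat 0

/-- Programs of a while language with oracle calls. -/
inductive Prog where
  | op (o : Op)
  | query
  | seq (f g : Prog)
  | pair (f g : Prog)
  | ite (c f g : Prog)
  | loop (c f : Prog)

/-- `Run O P v w t`: the program `P`, started on `v`, halts with result `w` after time `t`, where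
every oracle call made during the run, with query `q` and answer `r`, satisfies `O q r`. -/
inductive Run (O : Val → Val → Prop) : Prog → Val → Val → ℕ → Prop where
  | op (o : Op) (v : Val) : Run O (Prog.op o) v (o.apply v) (1 + v.size + (o.apply v).size)
  | query {q r : Val} : O q r → Run O Prog.query q r (1 + q.size + r.size)
  | seq {f g : Prog} {v w u : Val} {s t : ℕ} :
      Run O f v w s → Run O g w u t → Run O (Prog.seq f g) v u (s + t + 1)
  | pair {f g : Prog} {v a b : Val} {s t : ℕ} :
      Run O f v a s → Run O g v b t → Run O (Prog.pair f g) v (Val.pair a b) (s + t + 1)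
  | ite_true {c f g : Prog} {v b w : Val} {s t : ℕ} :
      Run O c v b s → b ≠ Val.nat 0 → Run O f v w t → Run O (Prog.ite c f g) v w (s + t + 1)
  | ite_false {c f g : Prog} {v w : Val} {s t : ℕ} :
      Run O c v (Val.nat 0) s → Run O g v w t → Run O (Prog.ite c f g) v w (s + t + 1)
  | loop_done {c f : Prog} {v : Val} {s : ℕ} :
      Run O c v (Val.nat 0) s → Run O (Prog.loop c f) v v (s + 1)
  | loop_step {c f : Prog} {v b w u : Val} {s t r : ℕ} :
      Run O c v b s → b ≠ Val.nat 0 → Run O f v w t → Run O (Prog.loop c f) w u r →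
      Run O (Prog.loop c f) v u (s + t + r + 1)

/-! ### Homomorphism counting problems on inputs with a path decomposition -/

/-- An instance: a finite structure with universe `{0, …, n - 1}`, given along with a path
decomposition of its Gaifman graph. -/
structure PathInstance {σ : Type*} (ar : σ → ℕ) where
  n : ℕ
  str : RelStr ar (Fin n)
  bags : List (Finset (Fin n))
  isPathDecomposition : IsPathDecomposition str.gaifman bags

namespace PathInstance

variable {σ : Type*} {ar : σ → ℕ}

/-- The given path decomposition has width at most `t`. -/
def WidthLE (I : PathInstance ar) (t : ℕ) : Prop :=
  ∀ B ∈ I.bags, B.card ≤ t + 1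

/-- Encoding of "the tuple `x` belongs to the relation `s`": the number of the symbol `s` in a
fixed enumeration of the signature, followed by the entries of `x`. -/
noncomputable def encodeFact [Fintype σ] {n : ℕ} (f : (s : σ) × (Fin (ar s) → Fin n)) : Val :=
  Val.pair (Val.nat (Fintype.equivFin σ f.1).val)
    (Val.ofList (List.ofFn fun i => Val.nat (f.2 i).val))

/-- Encoding of a bag, given as a list of its elements. -/
def encodeBag {n : ℕ} (B : List (Fin n)) : Val :=
  Val.ofList (B.map fun u => Val.nat u.val)

/-- `v` encodes `I`: it consists of the number of elements, a list of all tuples of all relations,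
and the sequence of bags, each given by a list of its elements. The lists may be in any order and
may have repetitions. -/
def Encodes [Fintype σ] (I : PathInstance ar) (v : Val) : Prop :=
  ∃ (facts : List ((s : σ) × (Fin (ar s) → Fin I.n))) (bagLists : List (List (Fin I.n))),
    (∀ (s : σ) (x : Fin (ar s) → Fin I.n), ⟨s, x⟩ ∈ facts ↔ x ∈ I.str s) ∧
    I.bags = bagLists.map List.toFinset ∧
    v = Val.pair (Val.nat I.n)
      (Val.pair (Val.ofList (facts.map encodeFact)) (Val.ofList (bagLists.map encodeBag)))

end PathInstance

/-- The oracle for counting homomorphisms to `B`, restricted to structures of size at most `m`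
given with a path decomposition of width at most `w`: queries outside this range have no answer. -/
def homOracle {τ : Type*} [Fintype τ] {arB : τ → ℕ} {V : Type*} (B : RelStr arB V) (w m : ℕ)
    (q r : Val) : Prop :=
  ∃ J : PathInstance arB, J.Encodes q ∧ J.WidthLE w ∧ J.str.norm ≤ m ∧
    r = Val.nat (J.str.homCount B)

/-- There is a pathwidth-preserving reduction from `#Hom(A)` to `#Hom(B)`: a polynomial-time oracle
program that solves `#Hom(A)` and that, on an instance `G` given with a path decomposition of width
at most `t`, calls the oracle for `#Hom(B)` only on structures of size polynomial in `‖G‖`, given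
with a path decomposition of width at most `t + O(1)`. -/
def PathwidthReduces {σ τ : Type*} [Fintype σ] [Fintype τ] {arA : σ → ℕ} {arB : τ → ℕ}
    {V W : Type*} (A : RelStr arA V) (B : RelStr arB W) : Prop :=
  ∃ (P : Prog) (time size : Polynomial ℕ) (c : ℕ),
    ∀ (I : PathInstance arA) (t : ℕ), I.WidthLE t → ∀ v : Val, I.Encodes v →
      ∃ k ≤ time.eval v.size,
        Run (homOracle B (t + c) (size.eval I.str.norm)) P v (Val.nat (I.str.homCount A)) k

/-- `R` is realizable by the structure `H = (V, 𝐑)`: there is a pathwidth-preserving reduction from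
`#LHom(V, 𝐑 ∪ {R})` to `#LHom(H)`. -/
def Realizable {σ : Type*} [Fintype σ] {ar : σ → ℕ} {V : Type*} [Fintype V] (H : RelStr ar V)
    {p : ℕ} (R : Set (Fin p → V)) : Prop :=
  PathwidthReduces (H.addRel R).plus H.plus

/-!
The reduction asks the oracle for a single number. Every tuple of `R` in the instance is replaced by
a copy of a fixed *gadget* over the signature of `H⁺`: some internal elements, facts about them and
about the entries of the tuple, and *weights*. A weight at `a` with a list `Q` of at most two
vertices consists of `K` pendant elements, each adjacent to `a` and with list `Q`; an assignment of
`z` to `a` extends to them in `c ^ K` ways, where `c ≤ 2` is the number of neighbours of `z` in `Q`.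
Modulo `2 ^ K + 1` the three possible values `0`, `1`, `2 ^ K` are `0`, `1`, `-1`, so that gadgets
count with signs. Cancellation makes it possible that the signed number of extensions of `x` is `d`
for `x ∈ R`, and `0` for `x ∉ R`, with a constant `d > 0`. If there are `m` distinct tuples, the
answer is then congruent to `d ^ m * N`, where `N` is the number sought
(`Gadget.card_expandFacts_modEq`), and for `K` linear in `n + m` it determines `N`
(`Gadget.decode_eq`).

The functions that are signed counts of a gadget (`Expressible`) are closed under products, sums
over a variable and renaming. The gadget for `R` arises in two steps.

* As `irr H ≥ 2` and `H` is connected and bipartite, `H` contains an induced path `u - w₀ - v - w`.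
  A variable with list `{u, v}` acts as a truth value: with the weight on `{w₀, w}` it has the signs
  `1` and `-1`, and walks along the path, summed with signs, give `NAND`, from which all integer
  functions of truth values are expressible (`InducedPath.all`).
* Two vertices `x`, `x'` are *linked* if some expressible function of a truth value `z` and a vertex
  has a nonsingular `2 × 2` matrix on `{u, v} × {x, x'}`; some linear combination of its rows then
  vanishes at `x'` but not at `x`. The pair `u`, `v` is linked. Links pass to pairs of neighbours
  across an edge pattern that separates them, and along even powers of the adjacency matrix, which
  are entrywise positive on one side and have nonsingular minors at vertices with distinct
  neighbourhoods. By connectedness all such pairs on one side are linked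
  (`InducedPath.linked_of_ne`). Products of these linear forms over all pairs of vertices of `S` and
  all coordinates, combined by a function of the truth values, yield `d` times the indicator
  function of `R` (`InducedPath.exists_expressible_indicator`).

The path decomposition survives: by Helly's theorem for segments each tuple lies within some bag
(`PathInstance.exists_bag`), and right after the first such bag one inserts copies of it, enlarged
by the internal elements of the gadget and by one pendant at a time. The width grows by at most the
constant `q + 1`, where `q` is the number of internal elements (`Gadget.card_le_of_mem_expandBags`).

The running time is handled by a small calculus of polynomial-time functions on encoded data
(`PolyTime`), whose core is iteration along a list (`PolyTime.foldl`). The query is first described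
over a typed universe, where its properties are proved, and then identified with the output of a
polynomial-time function on natural numbers (`Gadget.exists_encodes_rawQuery`).
-/

/-! ### Polynomial-time functions on encoded data -/

/-- A type whose elements are represented, without ambiguity, by data of the machine model. -/
class Enc (α : Type) where
  enc : α → Val
  enc_injective : Function.Injective enc

namespace Enc

theorem ofList_injective : Function.Injective Val.ofList := by
  intro l
  induction l with
  | nil => intro l' h; cases l' <;> simp_all [Val.ofList]
  | cons a l ih =>
    intro l' h
    cases l' with
    | nil => simp [Val.ofList] at h
    | cons b l' =>
      simp only [Val.ofList, Val.pair.injEq] at h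
      rw [h.1, ih h.2]

instance : Enc ℕ := ⟨Val.nat, fun _ _ h => Val.nat.inj h⟩

instance {α β : Type} [Enc α] [Enc β] : Enc (α × β) :=
  ⟨fun x => Val.pair (enc x.1) (enc x.2), fun _ _ h =>
    Prod.ext (enc_injective (Val.pair.inj h).1) (enc_injective (Val.pair.inj h).2)⟩

instance {α : Type} [Enc α] : Enc (List α) :=
  ⟨fun l => Val.ofList (l.map enc), fun _ _ h =>
    List.map_injective_iff.2 enc_injective (ofList_injective h)⟩

variable {α β : Type} [Enc α] [Enc β]

/-- The size of the representation. -/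
def sz (a : α) : ℕ := (enc a).size

theorem sz_pair (a : α) (b : β) : sz (a, b) = sz a + sz b + 1 := rfl

theorem sz_cons (a : α) (l : List α) : sz (a :: l) = sz a + sz l + 1 := rfl

theorem sz_nil : sz ([] : List α) = 1 := rfl

theorem sz_nat (n : ℕ) : sz n = Nat.size n + 1 := rfl

theorem sz_append (l l' : List α) : sz (l ++ l') + 1 = sz l + sz l' := by
  induction l with
  | nil => rw [List.nil_append, sz_nil, add_comm]
  | cons a l ih => rw [List.cons_append, sz_cons, sz_cons]; omega

theorem length_lt_sz (l : List α) : l.length < sz l := by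
  induction l with
  | nil => simp [sz_nil]
  | cons a l ih => rw [sz_cons, List.length_cons]; omega

theorem sz_lt_of_mem {a : α} {l : List α} (h : a ∈ l) : sz a < sz l := by
  induction l with
  | nil => simp at h
  | cons b l ih =>
    rw [sz_cons]
    rcases List.mem_cons.1 h with rfl | h
    · omega
    · have := ih h; omega

end Enc

open Enc in
/-- `f` is computed by a program, without oracle calls, in time polynomial in the size of the
argument. The bound on the size of the result is recorded separately. -/
def PolyTime {α β : Type} [Enc α] [Enc β] (f : α → β) : Prop :=
  ∃ (P : Prog) (b : Polynomial ℕ), ∀ a, sz (f a) ≤ b.eval (sz a) ∧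
    ∀ O, ∃ k ≤ b.eval (sz a), Run O P (enc a) (enc (f a)) k

theorem Polynomial.eval_mono_nat (b : Polynomial ℕ) {m n : ℕ} (h : m ≤ n) :
    b.eval m ≤ b.eval n := by
  rw [Polynomial.eval_eq_sum_range, Polynomial.eval_eq_sum_range]
  gcongr

theorem Nat.size_le_size_add_size_of_le_mul {k m n : ℕ} (h : k ≤ m * n) :
    Nat.size k ≤ Nat.size m + Nat.size n := by
  rw [Nat.size_le, pow_add]
  exact h.trans_lt (Nat.mul_lt_mul'' (Nat.lt_size_self m) (Nat.lt_size_self n))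

theorem Nat.size_add_le (m n : ℕ) : Nat.size (m + n) ≤ Nat.size m + Nat.size n + 1 := by
  rw [Nat.size_le, pow_succ, pow_add]
  have h₁ := Nat.lt_size_self m
  have h₂ := Nat.lt_size_self n
  have h₃ : 1 ≤ 2 ^ m.size := Nat.one_le_two_pow
  have h₄ : 1 ≤ 2 ^ n.size := Nat.one_le_two_pow
  nlinarith

namespace PolyTime

open Enc Polynomial

variable {α β γ δ : Type} [Enc α] [Enc β] [Enc γ] [Enc δ]

/-- A function effected by one elementary operation is polynomial-time as soon as its values are
polynomially bounded. -/
theorem of_op (o : Op) {f : α → β} (b : Polynomial ℕ) (h : ∀ a, o.apply (enc a) = enc (f a))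
    (hb : ∀ a, sz (f a) ≤ b.eval (sz a)) : PolyTime f := by
  refine ⟨.op o, 1 + X + b, fun a => ⟨?_, fun O => ⟨1 + sz a + sz (f a), ?_, ?_⟩⟩⟩
  · simp only [eval_add, eval_one, eval_X]; have := hb a; omega
  · simp only [eval_add, eval_one, eval_X]; have := hb a; omega
  · have := Run.op (O := O) o (enc a)
    rwa [h a] at this

theorem id : PolyTime (fun a : α => a) := of_op .id X (fun _ => rfl) (fun a => by simp)

theorem const (c : β) : PolyTime (fun _ : α => c) :=
  of_op (.const (enc c)) (C (sz c)) (fun _ => rfl) (fun a => by simp)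

theorem fst' : PolyTime (Prod.fst : α × β → α) :=
  of_op .fst X (fun _ => rfl) (fun a => by rw [eval_X, ← a.eta, sz_pair]; dsimp only; omega)

theorem snd' : PolyTime (Prod.snd : α × β → β) :=
  of_op .snd X (fun _ => rfl) (fun a => by rw [eval_X, ← a.eta, sz_pair]; dsimp only; omega)

theorem cons' : PolyTime (fun x : α × List α => x.1 :: x.2) :=
  of_op .id X (fun _ => rfl) (fun a => by rw [eval_X, ← a.eta, sz_pair, sz_cons])

theorem add' : PolyTime (fun x : ℕ × ℕ => x.1 + x.2) :=
  of_op .add X (fun _ => rfl) (fun a => by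
    have := Nat.size_add_le a.1 a.2
    rw [eval_X, ← a.eta, sz_pair, sz_nat, sz_nat, sz_nat]; dsimp only; omega)

theorem sub' : PolyTime (fun x : ℕ × ℕ => x.1 - x.2) :=
  of_op .sub X (fun _ => rfl) (fun a => by
    have := Nat.size_le_size (Nat.sub_le a.1 a.2)
    rw [eval_X, ← a.eta, sz_pair, sz_nat, sz_nat, sz_nat]; dsimp only; omega)

theorem mul' : PolyTime (fun x : ℕ × ℕ => x.1 * x.2) :=
  of_op .mul X (fun _ => rfl) (fun a => by
    have := Nat.size_le_size_add_size_of_le_mul (le_refl (a.1 * a.2))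
    rw [eval_X, ← a.eta, sz_pair, sz_nat, sz_nat, sz_nat]; dsimp only; omega)

theorem div' : PolyTime (fun x : ℕ × ℕ => x.1 / x.2) :=
  of_op .div X (fun _ => rfl) (fun a => by
    have := Nat.size_le_size (Nat.div_le_self a.1 a.2)
    rw [eval_X, ← a.eta, sz_pair, sz_nat, sz_nat, sz_nat]; dsimp only; omega)

theorem eq' [DecidableEq α] : PolyTime (fun x : α × α => if x.1 = x.2 then 1 else 0) :=
  of_op .eq 2 (fun a => by
    have : Op.eq.apply (enc a) = if enc a.1 = enc a.2 then Val.nat 1 else Val.nat 0 := rfl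
    rw [this]
    by_cases h : a.1 = a.2
    · rw [if_pos h, if_pos (congrArg enc h)]; rfl
    · rw [if_neg h, if_neg (fun h' => h (enc_injective h'))]; rfl) (fun a => by
      have : (2 : Polynomial ℕ) = C 2 := rfl
      rw [this, eval_C, sz_nat]; split_ifs <;> simp)

theorem comp {g : β → γ} {f : α → β} (hg : PolyTime g) (hf : PolyTime f) :
    PolyTime (fun a => g (f a)) := by
  obtain ⟨P, b, hP⟩ := hf
  obtain ⟨Q, c, hQ⟩ := hg
  refine ⟨.seq P Q, b + c.comp b + 1, fun a => ⟨?_, fun O => ?_⟩⟩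
  · have := ((hQ (f a)).1).trans (c.eval_mono_nat (hP a).1)
    simp only [eval_add, eval_comp, eval_one]; omega
  · obtain ⟨k, hk, hr⟩ := (hP a).2 O
    obtain ⟨l, hl, hs⟩ := (hQ (f a)).2 O
    have := hl.trans (c.eval_mono_nat (hP a).1)
    refine ⟨k + l + 1, ?_, .seq hr hs⟩
    simp only [eval_add, eval_comp, eval_one]; omega

theorem pair {f : α → β} {g : α → γ} (hf : PolyTime f) (hg : PolyTime g) :
    PolyTime (fun a => (f a, g a)) := by
  obtain ⟨P, b, hP⟩ := hf
  obtain ⟨Q, c, hQ⟩ := hg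
  refine ⟨.pair P Q, b + c + 1, fun a => ⟨?_, fun O => ?_⟩⟩
  · have := (hP a).1; have := (hQ a).1
    simp only [eval_add, eval_one, sz_pair]; omega
  · obtain ⟨k, hk, hr⟩ := (hP a).2 O
    obtain ⟨l, hl, hs⟩ := (hQ a).2 O
    refine ⟨k + l + 1, ?_, .pair hr hs⟩
    simp only [eval_add, eval_one]; omega

/-- Two programs may be chosen between by a third one; `f` takes any value other than `0` as
"true". -/
theorem ite_ne_zero {c : α → ℕ} {f g : α → β} (hc : PolyTime c) (hf : PolyTime f)
    (hg : PolyTime g) : PolyTime (fun a => if c a ≠ 0 then f a else g a) := by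
  obtain ⟨P, b, hP⟩ := hc
  obtain ⟨Q, d, hQ⟩ := hf
  obtain ⟨Q', e, hQ'⟩ := hg
  refine ⟨.ite P Q Q', b + d + e + 1, fun a => ⟨?_, fun O => ?_⟩⟩
  · have := (hQ a).1; have := (hQ' a).1
    simp only [eval_add, eval_one]; split_ifs <;> omega
  · obtain ⟨k, hk, hr⟩ := (hP a).2 O
    simp only [eval_add, eval_one]
    by_cases h : c a ≠ 0
    · obtain ⟨l, hl, hs⟩ := (hQ a).2 O
      rw [if_pos h]
      exact ⟨k + l + 1, by omega, .ite_true hr (fun h' => h (Val.nat.inj h')) hs⟩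
    · obtain ⟨l, hl, hs⟩ := (hQ' a).2 O
      rw [if_neg h]
      rw [not_not] at h
      rw [h] at hr
      exact ⟨k + l + 1, by omega, .ite_false hr hs⟩

/-- A property whose indicator function is polynomial-time. -/
def Dec (p : α → Prop) [DecidablePred p] : Prop := PolyTime (fun a => if p a then 1 else 0)

theorem ite {p : α → Prop} [DecidablePred p] {f g : α → β} (hp : Dec p) (hf : PolyTime f)
    (hg : PolyTime g) : PolyTime (fun a => if p a then f a else g a) := by
  have := ite_ne_zero hp hf hg
  convert this using 3 with a
  by_cases h : p a <;> simp [h]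

theorem fst {f : α → β × γ} (hf : PolyTime f) : PolyTime (fun a => (f a).1) := fst'.comp hf
theorem snd {f : α → β × γ} (hf : PolyTime f) : PolyTime (fun a => (f a).2) := snd'.comp hf

theorem cons {f : α → β} {g : α → List β} (hf : PolyTime f) (hg : PolyTime g) :
    PolyTime (fun a => f a :: g a) := cons'.comp (hf.pair hg)

theorem add {f g : α → ℕ} (hf : PolyTime f) (hg : PolyTime g) :
    PolyTime (fun a => f a + g a) := add'.comp (hf.pair hg)

theorem sub {f g : α → ℕ} (hf : PolyTime f) (hg : PolyTime g) :
    PolyTime (fun a => f a - g a) := sub'.comp (hf.pair hg)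

theorem mul {f g : α → ℕ} (hf : PolyTime f) (hg : PolyTime g) :
    PolyTime (fun a => f a * g a) := mul'.comp (hf.pair hg)

theorem div {f g : α → ℕ} (hf : PolyTime f) (hg : PolyTime g) :
    PolyTime (fun a => f a / g a) := div'.comp (hf.pair hg)

theorem mod {f g : α → ℕ} (hf : PolyTime f) (hg : PolyTime g) :
    PolyTime (fun a => f a % g a) := by
  have := hf.sub (hg.mul (hf.div hg))
  convert this using 2
  rw [Nat.mod_eq_sub]

theorem dec_eq [DecidableEq β] {f g : α → β} (hf : PolyTime f) (hg : PolyTime g) :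
    Dec (fun a => f a = g a) := eq'.comp (hf.pair hg)

theorem Dec.and {p q : α → Prop} [DecidablePred p] [DecidablePred q] (hp : Dec p) (hq : Dec q) :
    Dec (fun a => p a ∧ q a) := by
  have := PolyTime.ite hp hq (const 0)
  unfold Dec
  convert this using 2 with a
  by_cases h : p a <;> simp [h]

theorem Dec.not {p : α → Prop} [DecidablePred p] (hp : Dec p) : Dec (fun a => ¬ p a) := by
  have := PolyTime.ite hp (const 0) (const 1)
  unfold Dec
  convert this using 2 with a
  by_cases h : p a <;> simp [h]

/-- Iteration along a list. Each round may enlarge the accumulator only by an amount bounded in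
terms of the parameter and of the current element; this keeps the accumulator polynomially
bounded throughout. -/
theorem foldl' {s : γ × β × α → β} (hs : PolyTime s) (b : Polynomial ℕ)
    (hb : ∀ c acc x, sz (s (c, acc, x)) ≤ sz acc + b.eval (sz c + sz x)) :
    PolyTime (fun x : γ × β × List α => x.2.2.foldl (fun acc a => s (x.1, acc, a)) x.2.1) := by
  obtain ⟨P, d, hP⟩ := hs
  -- the bound on the accumulator
  have hsz : ∀ (N : ℕ) (c : γ) (l : List α), sz c ≤ N → (∀ a ∈ l, sz a ≤ N) → ∀ acc : β,
      sz (l.foldl (fun acc a => s (c, acc, a)) acc) ≤ sz acc + l.length * b.eval (2 * N) := by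
    intro N c l hc
    induction l with
    | nil => intro _ acc; simp
    | cons a l ih =>
      intro hl acc
      have h₁ := ih (fun a ha => hl a (List.mem_cons_of_mem _ ha)) (s (c, acc, a))
      have h₂ := hb c acc a
      have h₃ := hl a List.mem_cons_self
      have h₄ := b.eval_mono_nat (show sz c + sz a ≤ 2 * N by omega)
      rw [List.foldl_cons, List.length_cons, add_mul]
      omega
  let body : Prog := .pair (.op .fst) (.pair
    (.seq (.pair (.op .fst) (.pair (.seq (.op .snd) (.op .fst))
      (.seq (.seq (.op .snd) (.op .snd)) (.op .fst)))) P)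
    (.seq (.seq (.op .snd) (.op .snd)) (.op .snd)))
  -- one run of the loop, for all states of size at most `M`
  have hloop : ∀ (O : Val → Val → Prop) (N M : ℕ) (c : γ) (l : List α), sz c ≤ N →
      (∀ a ∈ l, sz a ≤ N) → ∀ acc : β,
      sz c + (sz acc + l.length * b.eval (2 * N)) + sz l + 5 ≤ M →
      ∃ k ≤ (l.length + 1) * (100 * M + 100 + d.eval M),
        Run O (.loop (.seq (.op .snd) (.op .snd)) body) (enc (c, acc, l))
          (enc (c, l.foldl (fun acc a => s (c, acc, a)) acc, ([] : List α))) k := by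
    intro O N M c l hc
    induction l with
    | nil =>
      intro _ acc hM
      rw [sz_nil] at hM
      refine ⟨_, ?_, .loop_done (.seq (.op .snd _) (.op .snd _))⟩
      have h1 : (enc (c, acc, ([] : List α))).size = sz c + (sz acc + 1 + 1) + 1 := rfl
      have h2 : (Op.snd.apply (enc (c, acc, ([] : List α)))).size = sz acc + 1 + 1 := rfl
      have h3 : (Op.snd.apply (Op.snd.apply (enc (c, acc, ([] : List α))))).size = 1 := rfl
      rw [h1, h2, h3]
      simp only [List.length_nil] at hM ⊢
      omega
    | cons a l ih =>
      intro hl acc hM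
      have hb' := hb c acc a
      have ha := hl a List.mem_cons_self
      have hN := b.eval_mono_nat (show sz c + sz a ≤ 2 * N by omega)
      rw [List.length_cons, add_mul, sz_cons] at hM
      obtain ⟨k, hk, hr⟩ := ih (fun a ha => hl a (List.mem_cons_of_mem _ ha)) (s (c, acc, a))
        (by omega)
      obtain ⟨j, hj, hstep⟩ := (hP (c, acc, a)).2 O
      have hdM := d.eval_mono_nat (show sz (c, acc, a) ≤ M by rw [sz_pair, sz_pair]; omega)
      have hbody := Run.pair (.op (O := O) .fst (enc (c, acc, a :: l))) (.pair
        (.seq (.pair (.op .fst _) (.pair (.seq (.op .snd _) (.op .fst _))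
          (.seq (.seq (.op .snd _) (.op .snd _)) (.op .fst _)))) hstep)
        (.seq (.seq (.op .snd _) (.op .snd _)) (.op .snd _)))
      have hcond := Run.seq (.op (O := O) .snd (enc (c, acc, a :: l))) (.op .snd _)
      refine ⟨_, ?_, .loop_step hcond (fun h => ?_) hbody hr⟩
      · have e1 : (enc (c, acc, a :: l)).size = sz c + (sz acc + (sz a + sz l + 1) + 1) + 1 := rfl
        have e2 : (Op.snd.apply (enc (c, acc, a :: l))).size = sz acc + (sz a + sz l + 1) + 1 := rfl
        have e3 : (Op.snd.apply (Op.snd.apply (enc (c, acc, a :: l)))).size = sz a + sz l + 1 := rfl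
        have e4 : (Op.fst.apply (enc (c, acc, a :: l))).size = sz c := rfl
        have e5 : (Op.fst.apply (Op.snd.apply (enc (c, acc, a :: l)))).size = sz acc := rfl
        have e6 : (Op.fst.apply (Op.snd.apply (Op.snd.apply (enc (c, acc, a :: l))))).size
          = sz a := rfl
        have e7 : (Op.snd.apply (Op.snd.apply (Op.snd.apply (enc (c, acc, a :: l))))).size
          = sz l := rfl
        rw [e1, e2, e3, e4, e5, e6, e7, List.length_cons, add_mul _ 1 (_ + _ : ℕ)]
        omega
      · cases h
  refine ⟨.seq (.loop (.seq (.op .snd) (.op .snd)) body) (.seq (.op .snd) (.op .fst)),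
    (X + 1) * (100 * (2 * X + X * b.comp (2 * X) + 5) + 100
      + d.comp (2 * X + X * b.comp (2 * X) + 5)) + (10 * (2 * X + X * b.comp (2 * X) + 5) + 10),
    fun x => ?_⟩
  obtain ⟨c, acc, l⟩ := x
  set n := sz (c, acc, l) with hn
  rw [sz_pair, sz_pair] at hn
  have hlen := length_lt_sz l
  have hmem : ∀ a ∈ l, sz a ≤ n := fun a ha => by have := sz_lt_of_mem ha; omega
  have hmul : l.length * b.eval (2 * n) ≤ n * b.eval (2 * n) := by gcongr; omega
  have hacc := hsz n c l (by omega) hmem acc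
  simp only [eval_add, eval_mul, eval_comp, eval_X, eval_one, eval_ofNat]
  set M := 2 * n + n * b.eval (2 * n) + 5 with hM
  refine ⟨?_, fun O => ?_⟩
  · refine le_trans ?_ (Nat.le_add_left _ _)
    omega
  · obtain ⟨k, hk, hr⟩ := hloop O n M c l (by omega) hmem acc (by omega)
    refine ⟨_, ?_, .seq hr (.seq (.op .snd _) (.op .fst _))⟩
    set r := l.foldl (fun acc a => s (c, acc, a)) acc
    have e1 : (enc (c, r, ([] : List α))).size = sz c + (sz r + 1 + 1) + 1 := rfl
    have e2 : (Op.snd.apply (enc (c, r, ([] : List α)))).size = sz r + 1 + 1 := rfl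
    have e3 : (Op.fst.apply (Op.snd.apply (enc (c, r, ([] : List α))))).size = sz r := rfl
    rw [e1, e2, e3]
    have : (l.length + 1) * (100 * M + 100 + d.eval M) ≤ (n + 1) * (100 * M + 100 + d.eval M) := by
      gcongr; omega
    omega

theorem foldl {s : γ × β × α → β} (hs : PolyTime s) (b : Polynomial ℕ)
    (hb : ∀ c acc x, sz (s (c, acc, x)) ≤ sz acc + b.eval (sz c + sz x))
    {p : δ → γ} {i : δ → β} {l : δ → List α} (hp : PolyTime p) (hi : PolyTime i)
    (hl : PolyTime l) :
    PolyTime (fun x => (l x).foldl (fun acc a => s (p x, acc, a)) (i x)) :=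
  (foldl' hs b hb).comp (hp.pair (hi.pair hl))

end PolyTime

/-! ### Polynomial-time list processing -/

/-- Every entry of a list, paired with the entry before it; the first one is paired with `a`. -/
def List.withPrev {α : Type} (a : α) : List α → List (α × α)
  | [] => []
  | b :: l => (a, b) :: List.withPrev b l

/-- Values of a finite function on `ℕ`, given by its list of argument-value pairs. -/
def lookup : List (ℕ × ℕ) → ℕ → ℕ
  | [], _ => 0
  | e :: T, n => if n = e.1 then e.2 else lookup T n

namespace PolyTime

open Enc Polynomial

variable {α β γ δ : Type} [Enc α] [Enc β] [Enc γ] [Enc δ]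

theorem reverse {f : δ → List α} (hf : PolyTime f) : PolyTime (fun x => (f x).reverse) := by
  have h : PolyTime (fun x : ℕ × List α × α => x.2.2 :: x.2.1) := id.snd.snd.cons id.snd.fst
  have := foldl h (X + 1) (fun c acc x => by
    simp only [eval_add, eval_X, eval_one, sz_cons]; omega) (const 0) (const []) hf
  convert this using 2 with x
  simp

theorem append {f g : δ → List α} (hf : PolyTime f) (hg : PolyTime g) :
    PolyTime (fun x => f x ++ g x) := by
  have h : PolyTime (fun x : ℕ × List α × α => x.2.2 :: x.2.1) := id.snd.snd.cons id.snd.fst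
  have := foldl h (X + 1) (fun c acc x => by
    simp only [eval_add, eval_X, eval_one, sz_cons]; omega) (const 0) hg hf.reverse
  convert this using 2 with x
  simp

theorem flatMap {f : γ × α → List β} {p : δ → γ} {l : δ → List α} (hf : PolyTime f)
    (hp : PolyTime p) (hl : PolyTime l) :
    PolyTime (fun x => (l x).flatMap (fun a => f (p x, a))) := by
  have h : PolyTime (fun x : γ × List β × α => f (x.1, x.2.2) ++ x.2.1) :=
    (hf.comp (id.fst.pair id.snd.snd)).append id.snd.fst
  obtain ⟨P, b, hb⟩ := hf
  have := foldl h (b.comp (X + 1)) (fun c acc x => by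
    have h₁ := (hb (c, x)).1
    have h₂ := sz_append (f (c, x)) acc
    rw [sz_pair] at h₁
    simp only [eval_comp, eval_add, eval_X, eval_one]; omega) hp (const []) hl.reverse
  convert this using 2 with x
  induction l x with
  | nil => rfl
  | cons a l ih => rw [List.flatMap_cons, ih]; simp

theorem map {f : γ × α → β} {p : δ → γ} {l : δ → List α} (hf : PolyTime f)
    (hp : PolyTime p) (hl : PolyTime l) : PolyTime (fun x => (l x).map (fun a => f (p x, a))) := by
  have := flatMap (hf.cons (const [])) hp hl
  convert this using 2 with x
  rw [List.map_eq_flatMap]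

theorem filter {p : γ × α → Prop} [DecidablePred p] {c : δ → γ} {l : δ → List α} (hp : Dec p)
    (hc : PolyTime c) (hl : PolyTime l) :
    PolyTime (fun x => (l x).filter (fun a => p (c x, a))) := by
  have := flatMap (PolyTime.ite hp (id.snd.cons (const [])) (const [])) hc hl
  convert this using 2 with x
  induction l x with
  | nil => rfl
  | cons a l ih =>
    rw [List.flatMap_cons, List.filter_cons, ih]
    by_cases h : p (c x, a) <;> simp [h]

theorem headD {f : δ → List ℕ} (hf : PolyTime f) : PolyTime (fun x => (f x).headD 0) := by
  have : PolyTime (fun l : List ℕ => l.headD 0) :=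
    of_op .fst (X + 1) (fun l => by cases l <;> rfl) (fun l => by
      cases l with
      | nil => simp [sz_nat]
      | cons a l => simp only [List.headD_cons, eval_add, eval_X, eval_one, sz_cons]; omega)
  exact this.comp hf

theorem tail {f : δ → List α} (hf : PolyTime f) : PolyTime (fun x => (f x).tail) := by
  have : PolyTime (fun l : List α => l.tail) :=
    of_op .snd (X + 1) (fun l => by cases l <;> rfl) (fun l => by
      cases l with
      | nil => simp [sz_nil]
      | cons a l => simp only [List.tail_cons, eval_add, eval_X, eval_one, sz_cons]; omega)
  exact this.comp hf

theorem getD {f : δ → List ℕ} (hf : PolyTime f) (i : ℕ) : PolyTime (fun x => (f x).getD i 0) := by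
  induction i generalizing f with
  | zero => simpa [List.getD_eq_getElem?_getD, List.headD_eq_head?_getD,
      List.head?_eq_getElem?] using hf.headD
  | succ i ih => simpa [List.getD_eq_getElem?_getD] using ih hf.tail

theorem dec_mem [DecidableEq α] {f : δ → α} {l : δ → List α} (hf : PolyTime f) (hl : PolyTime l) :
    Dec (fun x => f x ∈ l x) := by
  have h : Dec (fun x : α × α => x.1 = x.2) := dec_eq id.fst id.snd
  have := (dec_eq (filter h hf hl) (const [])).not
  unfold Dec at this ⊢
  convert this using 3 with x
  simp

theorem dec_subset [DecidableEq α] {f l : δ → List α} (hf : PolyTime f) (hl : PolyTime l) :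
    Dec (fun x => ∀ a ∈ f x, a ∈ l x) := by
  have h : Dec (fun x : List α × α => ¬ x.2 ∈ x.1) := (dec_mem id.snd id.fst).not
  have := dec_eq (filter h hl hf) (const [])
  unfold Dec at this ⊢
  convert this using 3 with x
  simp

theorem dedup [DecidableEq α] {l : δ → List α} (hl : PolyTime l) :
    PolyTime (fun x => (l x).dedup) := by
  have h : PolyTime (fun x : ℕ × List α × α => if x.2.2 ∈ x.2.1 then x.2.1 else x.2.2 :: x.2.1) :=
    PolyTime.ite (dec_mem id.snd.snd id.snd.fst) id.snd.fst (id.snd.snd.cons id.snd.fst)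
  have := foldl h (X + 1) (fun c acc x => by
    simp only [eval_add, eval_X, eval_one]; split_ifs
    · omega
    · rw [sz_cons]; omega) (const 0) (const []) hl.reverse
  convert this using 2 with x
  rw [List.foldl_reverse]
  induction l x with
  | nil => rfl
  | cons a l ih =>
    rw [List.foldr_cons, ← ih]
    by_cases h : a ∈ l
    · rw [List.dedup_cons_of_mem h, if_pos (List.mem_dedup.2 h)]
    · rw [List.dedup_cons_of_notMem h, if_neg (fun h' => h (List.mem_dedup.1 h'))]

theorem length {l : δ → List α} (hl : PolyTime l) : PolyTime (fun x => (l x).length) := by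
  have h : PolyTime (fun x : ℕ × ℕ × α => x.2.1 + 1) := id.snd.fst.add (const 1)
  have := foldl h 2 (fun c acc x => by
    have : (2 : Polynomial ℕ) = C 2 := rfl
    have h' := Nat.size_add_le acc 1
    rw [Nat.size_one] at h'
    rw [this, eval_C, sz_nat, sz_nat]; dsimp only; omega) (const 0) (const 0) hl
  convert this using 2 with x
  simp

theorem zipIdx {l : δ → List α} (hl : PolyTime l) : PolyTime (fun x => (l x).zipIdx) := by
  -- the index is cut off at the parameter, which makes the growth of the accumulator visible
  have h : PolyTime (fun x : ℕ × (ℕ × List (α × ℕ)) × α =>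
      (x.2.1.1 + 1, (x.2.2, x.2.1.1 - (x.2.1.1 - x.1)) :: x.2.1.2)) :=
    (id.snd.fst.fst.add (const 1)).pair ((id.snd.snd.pair
      (id.snd.fst.fst.sub (id.snd.fst.fst.sub id.fst))).cons id.snd.fst.snd)
  have := (foldl h (X + 10) (fun c acc x => by
    obtain ⟨i, out⟩ := acc
    have h₁ := Nat.size_add_le i 1
    rw [Nat.size_one] at h₁
    have h₂ : Nat.size (i - (i - c)) ≤ Nat.size c := Nat.size_le_size (by omega)
    simp only [eval_add, eval_X, eval_ofNat, sz_pair, sz_cons, sz_nat]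
    omega) hl.length (const (0, [])) hl).snd.reverse
  convert this using 2 with x
  generalize hN : (l x).length = N
  have key : ∀ (l : List α) (i : ℕ) (out : List (α × ℕ)), i + l.length ≤ N →
      (l.foldl (fun acc a => (acc.1 + 1, (a, acc.1 - (acc.1 - N)) :: acc.2)) (i, out)).2
        = (l.zipIdx i).reverse ++ out := by
    intro l
    induction l with
    | nil => intro i out _; simp
    | cons a l ih =>
      intro i out h
      rw [List.length_cons] at h
      have : i - (i - N) = i := by omega
      rw [List.foldl_cons, ih _ _ (by omega), List.zipIdx_cons, this]
      simp
  rw [key _ _ _ (by omega)]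
  simp

theorem range_length {l : δ → List α} (hl : PolyTime l) :
    PolyTime (fun x => List.range (l x).length) := by
  have h : PolyTime (fun x : ℕ × (α × ℕ) => x.2.2) := id.snd.snd
  have := map h (const 0) hl.zipIdx
  convert this using 2 with x
  rw [List.range_eq_range', ← List.zipIdx_map_snd 0 (l x)]

theorem withPrev (a : α) {l : δ → List α} (hl : PolyTime l) :
    PolyTime (fun x => (l x).withPrev a) := by
  have h : PolyTime (fun x : ℕ × (α × List (α × α)) × α =>
      (x.2.2, (x.2.1.1, x.2.2) :: x.2.1.2)) :=
    id.snd.snd.pair ((id.snd.fst.fst.pair id.snd.snd).cons id.snd.fst.snd)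
  have := (foldl h (2 * X + 10) (fun c acc x => by
    obtain ⟨i, out⟩ := acc
    simp only [eval_add, eval_mul, eval_X, eval_ofNat, sz_pair, sz_cons]
    omega) (const 0) (const (a, [])) hl).snd.reverse
  convert this using 2 with x
  have key : ∀ (l : List α) (a : α) (out : List (α × α)),
      (l.foldl (fun acc b => (b, (acc.1, b) :: acc.2)) (a, out)).2
        = (l.withPrev a).reverse ++ out := by
    intro l
    induction l with
    | nil => intro a out; simp [List.withPrev]
    | cons b l ih => intro a out; rw [List.foldl_cons, ih, List.withPrev]; simp
  rw [key]
  simp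

theorem pow_length (b : ℕ) {l : δ → List α} (hl : PolyTime l) :
    PolyTime (fun x => b ^ (l x).length) := by
  have h : PolyTime (fun x : ℕ × ℕ × α => x.2.1 * b) := id.snd.fst.mul (const b)
  have := foldl h (C (Nat.size b)) (fun c acc x => by
    have h' := Nat.size_le_size_add_size_of_le_mul (le_refl (acc * b))
    rw [eval_C, sz_nat, sz_nat]; dsimp only; omega) (const 0) (const 1) hl
  convert this using 2 with x
  have key : ∀ (l : List α) (r : ℕ), l.foldl (fun acc _ => acc * b) r = r * b ^ l.length := by
    intro l
    induction l with
    | nil => intro r; simp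
    | cons a l ih => intro r; rw [List.foldl_cons, ih, List.length_cons, pow_succ]; ring
  rw [key, one_mul]

theorem replicate_flatten (k : ℕ) {l : δ → List α} (hl : PolyTime l) :
    PolyTime (fun x => (List.replicate k (l x)).flatten) := by
  induction k with
  | zero => exact const []
  | succ k ih => simpa [List.replicate_succ] using hl.append ih

theorem flatten {l : δ → List (List α)} (hl : PolyTime l) : PolyTime (fun x => (l x).flatten) := by
  have h : PolyTime (fun x : ℕ × List α => x.2) := id.snd
  simpa [List.flatMap_def] using flatMap h (const 0) hl

/-- A list of fixed length is computed entry by entry. -/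
theorem list_map {ι : Type*} (l : List ι) {f : δ → ι → α}
    (hf : ∀ i ∈ l, PolyTime (fun x => f x i)) :
    PolyTime (fun x => l.map (f x)) := by
  induction l with
  | nil => exact const []
  | cons i l ih =>
    exact (hf i List.mem_cons_self).cons (ih (fun j hj => hf j (List.mem_cons_of_mem _ hj)))

theorem list_flatMap {ι : Type*} (l : List ι) {f : δ → ι → List α}
    (hf : ∀ i ∈ l, PolyTime (fun x => f x i)) : PolyTime (fun x => l.flatMap (f x)) := by
  simpa [List.flatMap_def] using (list_map l hf).flatten

theorem lookup (T : List (ℕ × ℕ)) {f : δ → ℕ} (hf : PolyTime f) :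
    PolyTime (fun x => _root_.lookup T (f x)) := by
  induction T with
  | nil => exact const 0
  | cons e T ih => exact PolyTime.ite (dec_eq hf (const e.1)) (const e.2) ih

end PolyTime

/-! ### Gadgets and the functions they represent -/

/-- The symbols of the structure `H⁺` of a graph `H`: the edge relation, and one unary relation
for every list. -/
abbrev ListSymbol (V : Type*) := Unit ⊕ {L : Finset V // L.Nonempty}

/-- The arity of a symbol of `H⁺`. -/
abbrev symArity (V : Type*) : ListSymbol V → ℕ := RelStr.listArity (fun _ : Unit => 2) V

/-- A fact over the signature of `H⁺` about the elements of `U`. -/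
abbrev ListFact (V : Type*) (U : Type*) := (s : ListSymbol V) × (Fin (symArity V s) → U)

/-- The fact `E(a, b)`. -/
def edgeFact {V U : Type*} (a b : U) : ListFact V U := ⟨Sum.inl (), (![a, b] : Fin 2 → U)⟩

/-- The fact `L(a)`. -/
def listFact {V U : Type*} (a : U) (L : {L : Finset V // L.Nonempty}) : ListFact V U :=
  ⟨Sum.inr L, fun _ => a⟩

/-- A fact with its elements renamed. -/
def ListFact.map {V U U' : Type*} (φ : U → U') (f : ListFact V U) : ListFact V U' := ⟨f.1, φ ∘ f.2⟩

/-- The fact holds in `H⁺` if its elements are assigned vertices by `g`. -/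
def ListFact.Holds {V U : Type*} (H : SimpleGraph V) (g : U → V) (f : ListFact V U) : Prop :=
  (fun i => g (f.2 i)) ∈ (RelStr.ofGraph H).plus f.1

section Holds

variable {V U U' : Type*} (H : SimpleGraph V)

theorem ListFact.holds_map (φ : U → U') (g : U' → V) (f : ListFact V U) :
    (f.map φ).Holds H g ↔ f.Holds H (g ∘ φ) := Iff.rfl

theorem holds_edgeFact (g : U → V) (a b : U) : (edgeFact a b).Holds H g ↔ H.Adj (g a) (g b) :=
  Iff.rfl

theorem holds_listFact (g : U → V) (a : U) (L : {L : Finset V // L.Nonempty}) :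
    (listFact a L).Holds H g ↔ g a ∈ L.1 := Iff.rfl

end Holds

/-- A gadget with portals `ι` and internal variables `κ`: facts about the variables, and weights
`(a, Q)`, where `Q` has at most two elements. A weight `(a, Q)` stands for a large number `K` of
pendant vertices, each adjacent to `a` and with list `Q`. -/
structure Gadget (V : Type*) (ι κ : Type) where
  facts : List (ListFact V (ι ⊕ κ))
  wts : List ((ι ⊕ κ) × {L : Finset V // L.Nonempty})
  card_le : ∀ e ∈ wts, e.2.1.card ≤ 2

/-- The residue of `c ^ K` modulo `2 ^ K + 1`, for `c ≤ 2` and `K ≠ 0`. -/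
def residue : ℕ → ℤ
  | 0 => 0
  | 1 => 1
  | _ => -1

open Classical in
/-- The number of neighbours of `v` in `Q`. -/
noncomputable def nbrCount {V : Type*} (H : SimpleGraph V) (v : V) (Q : Finset V) : ℕ :=
  (Q.filter (H.Adj v)).card

namespace Gadget

variable {V : Type*} {ι κ ι' κ' : Type} (H : SimpleGraph V)

open Classical in
/-- The signed contribution of an assignment of vertices to the variables. -/
noncomputable def eval (D : Gadget V ι κ) (g : ι ⊕ κ → V) : ℤ :=
  if ∀ f ∈ D.facts, f.Holds H g then
    (D.wts.map fun e => residue (nbrCount H (g e.1) e.2.1)).prod else 0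

/-- Renaming the variables of a gadget. -/
def map (D : Gadget V ι κ) (φ : ι ⊕ κ → ι' ⊕ κ') : Gadget V ι' κ' where
  facts := D.facts.map (ListFact.map φ)
  wts := D.wts.map (fun e => (φ e.1, e.2))
  card_le := by
    intro e he
    obtain ⟨e', he', rfl⟩ := List.mem_map.1 he
    exact D.card_le e' he'

/-- Two gadgets on the same variables taken together. -/
def join (D D' : Gadget V ι κ) : Gadget V ι κ where
  facts := D.facts ++ D'.facts
  wts := D.wts ++ D'.wts
  card_le := by
    intro e he
    rcases List.mem_append.1 he with he | he
    · exact D.card_le e he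
    · exact D'.card_le e he

theorem eval_map (D : Gadget V ι κ) (φ : ι ⊕ κ → ι' ⊕ κ') (g : ι' ⊕ κ' → V) :
    (D.map φ).eval H g = D.eval H (g ∘ φ) := by
  have h : (∀ f ∈ (D.map φ).facts, f.Holds H g) ↔ ∀ f ∈ D.facts, f.Holds H (g ∘ φ) :=
    List.forall_mem_map
  have h' : (D.map φ).wts = D.wts.map (fun e => (φ e.1, e.2)) := rfl
  rw [eval, eval, h', List.map_map]
  by_cases h₁ : ∀ f ∈ D.facts, f.Holds H (g ∘ φ)
  · rw [if_pos (h.2 h₁), if_pos h₁]; rfl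
  · rw [if_neg (fun h₂ => h₁ (h.1 h₂)), if_neg h₁]

theorem eval_join (D D' : Gadget V ι κ) (g : ι ⊕ κ → V) :
    (D.join D').eval H g = D.eval H g * D'.eval H g := by
  have h : (∀ f ∈ (D.join D').facts, f.Holds H g) ↔
      (∀ f ∈ D.facts, f.Holds H g) ∧ ∀ f ∈ D'.facts, f.Holds H g := List.forall_mem_append
  have h' : (D.join D').wts = D.wts ++ D'.wts := rfl
  rw [eval, eval, eval, h', List.map_append, List.prod_append]
  by_cases h₁ : ∀ f ∈ D.facts, f.Holds H g
  · by_cases h₂ : ∀ f ∈ D'.facts, f.Holds H g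
    · rw [if_pos (h.2 ⟨h₁, h₂⟩), if_pos h₁, if_pos h₂]
    · rw [if_neg (fun h₃ => h₂ (h.1 h₃).2), if_neg h₂, mul_zero]
  · rw [if_neg (fun h₃ => h₁ (h.1 h₃).1), if_neg h₁, zero_mul]

/-- The signed number of extensions of an assignment of the portals. -/
noncomputable def val [Fintype V] [Fintype κ] [DecidableEq κ] (D : Gadget V ι κ) (x : ι → V) : ℤ :=
  ∑ g : κ → V, D.eval H (Sum.elim x g)

end Gadget

/-- `f` gives the signed numbers of extensions for some gadget. -/
def Expressible {V : Type*} [Fintype V] (H : SimpleGraph V) {ι : Type} (f : (ι → V) → ℤ) : Prop :=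
  ∃ (q : ℕ) (D : Gadget V ι (Fin q)), f = D.val H

namespace Expressible

variable {V : Type*} [Fintype V] {H : SimpleGraph V} {ι κ ι' : Type}

theorem of_gadget [Fintype κ] [DecidableEq κ] (D : Gadget V ι κ) : Expressible H (D.val H) := by
  let e := Fintype.equivFin κ
  refine ⟨Fintype.card κ, D.map (Sum.map id e), funext fun x => ?_⟩
  refine Fintype.sum_equiv (e.arrowCongr (Equiv.refl V)) _ _ fun g => ?_
  rw [Gadget.eval_map]
  congr 1
  ext a
  cases a <;> simp [Equiv.arrowCongr]

theorem mul {f g : (ι → V) → ℤ} (hf : Expressible H f) (hg : Expressible H g) :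
    Expressible H (fun x => f x * g x) := by
  obtain ⟨q, D, rfl⟩ := hf
  obtain ⟨r, D', rfl⟩ := hg
  convert of_gadget (κ := Fin q ⊕ Fin r)
    ((D.map (Sum.map id Sum.inl)).join (D'.map (Sum.map id Sum.inr))) using 2 with x
  rw [Gadget.val, Gadget.val, Gadget.val, Finset.sum_mul_sum, ← Fintype.sum_prod_type']
  refine Fintype.sum_equiv (Equiv.sumArrowEquivProdArrow _ _ _).symm _ _ fun g => ?_
  rw [Gadget.eval_join, Gadget.eval_map, Gadget.eval_map]
  congr 2 <;> ext a <;> cases a <;> rfl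

/-- Summation over the values of some of the variables. -/
theorem sum_pi {α : Type} [Fintype α] [DecidableEq α] {f : (ι → V) → (α → V) → ℤ}
    (hf : Expressible H (fun x : ι ⊕ α → V => f (x ∘ Sum.inl) (x ∘ Sum.inr))) :
    Expressible H (fun x => ∑ z : α → V, f x z) := by
  obtain ⟨q, D, hD⟩ := hf
  convert of_gadget (κ := α ⊕ Fin q) (D.map (Equiv.sumAssoc ι α (Fin q))) using 2 with x
  have : ∀ z : α → V, f x z = D.val H (Sum.elim x z) := fun z => by
    rw [← congrFun hD]; rfl
  simp only [this, Gadget.val]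
  rw [← Fintype.sum_prod_type']
  refine Fintype.sum_equiv (Equiv.sumArrowEquivProdArrow _ _ _).symm _ _ fun g => ?_
  rw [Gadget.eval_map]
  congr 1
  ext a
  rcases a with (a | a) | a <;> rfl

theorem reindex {f : (ι → V) → ℤ} (hf : Expressible H f) (ρ : ι → ι') :
    Expressible H (fun x : ι' → V => f (fun i => x (ρ i))) := by
  obtain ⟨q, D, rfl⟩ := hf
  refine ⟨q, D.map (Sum.map ρ id), funext fun x => Finset.sum_congr rfl fun g _ => ?_⟩
  rw [Gadget.eval_map]
  congr 1
  ext a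
  cases a <;> rfl

theorem sum {f : (ι → V) → V → ℤ}
    (hf : Expressible H (fun x : Option ι → V => f (fun i => x (some i)) (x none))) :
    Expressible H (fun x => ∑ z, f x z) := by
  have h := hf.reindex (fun o : Option ι => o.elim (Sum.inr ()) (Sum.inl : ι → ι ⊕ Unit))
  have := sum_pi (f := fun x (z : Unit → V) => f x (z ())) h
  convert this using 2 with x
  exact Fintype.sum_equiv (Equiv.funUnique Unit V).symm _ _ fun g => rfl

/-- The function of a gadget without internal variables. -/
theorem of_eval (D : Gadget V ι (Fin 0)) :
    Expressible H (fun x => D.eval H (Sum.elim x Fin.elim0)) := by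
  refine ⟨0, D, funext fun x => ?_⟩
  rw [Gadget.val, Fintype.sum_unique]
  congr 2

theorem one : Expressible H (fun _ : ι → V => 1) := by
  convert of_eval (H := H) (ι := ι) ⟨[], [], by simp⟩ using 2 with x
  simp [Gadget.eval]

theorem prod {α : Type*} (s : Finset α) {f : α → (ι → V) → ℤ} (hf : ∀ a ∈ s, Expressible H (f a)) :
    Expressible H (fun x => ∏ a ∈ s, f a x) := by
  classical
  induction s using Finset.induction_on with
  | empty => simpa using one
  | insert a s ha ih =>
    simp only [Finset.prod_insert ha]
    exact (hf a (Finset.mem_insert_self a s)).mul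
      (ih fun b hb => hf b (Finset.mem_insert_of_mem hb))

open Classical in
theorem adj (a b : ι) : Expressible H (fun x => if H.Adj (x a) (x b) then 1 else 0) := by
  convert of_eval (H := H) ⟨[edgeFact (Sum.inl a) (Sum.inl b)], [], by simp⟩ using 2 with x
  simp [Gadget.eval, holds_edgeFact]

open Classical in
theorem mem (a : ι) (L : Finset V) : Expressible H (fun x => if x a ∈ L then 1 else 0) := by
  rcases L.eq_empty_or_nonempty with rfl | hL
  · -- the empty list is not available, but there are no loops
    simpa using adj (H := H) a a
  · convert of_eval (H := H) ⟨[listFact (Sum.inl a) ⟨L, hL⟩], [], by simp⟩ using 2 with x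
    simp [Gadget.eval, holds_listFact]

theorem weight (a : ι) (Q : Finset V) (hQ : Q.Nonempty) (hQ₂ : Q.card ≤ 2) :
    Expressible H (fun x => residue (nbrCount H (x a) Q)) := by
  convert of_eval (H := H) ⟨[], [(Sum.inl a, ⟨Q, hQ⟩)], by simpa using hQ₂⟩ using 2 with x
  simp [Gadget.eval]

end Expressible

/-! ### Two-valued variables on an induced path with four vertices -/

/-- `u - w₀ - v - w` is a path without the chord `u - w`; in a bipartite graph, this is an induced
path. -/
structure InducedPath {V : Type*} (H : SimpleGraph V) (u w₀ v w : V) : Prop where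
  left : H.Adj u w₀
  mid : H.Adj v w₀
  right : H.Adj v w
  not_adj : ¬ H.Adj u w

/-- Variables with values `u` (read as `false`) and `v` (read as `true`): the function that is `C`
where all variables are two-valued, and `0` elsewhere. -/
noncomputable def twoValued {V : Type*} (u v : V) {ι : Type} (C : (ι → Bool) → ℤ) (x : ι → V) : ℤ :=
  open Classical in
  if ∀ i, x i = u ∨ x i = v then C (fun i => decide (x i = v)) else 0

/-- The vertex that stands for a truth value. -/
def truthVertex {V : Type*} (u v : V) (b : Bool) : V := if b then v else u

theorem truthVertex_eq_or {V : Type*} (u v : V) (b : Bool) :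
    truthVertex u v b = u ∨ truthVertex u v b = v := by
  cases b <;> simp [truthVertex]

section TwoValued

variable {V : Type*} {u v : V} {ι : Type}

theorem twoValued_truthVertex (huv : u ≠ v) (C : (ι → Bool) → ℤ) (β : ι → Bool) :
    twoValued u v C (fun i => truthVertex u v (β i)) = C β := by
  rw [twoValued, if_pos]
  · congr 1
    ext i
    cases β i <;> simp [truthVertex, huv]
  · exact fun i => truthVertex_eq_or u v (β i)

theorem exists_truthVertex {x : ι → V} (h : ∀ i, x i = u ∨ x i = v) :
    ∃ β : ι → Bool, x = fun i => truthVertex u v (β i) := by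
  classical
  refine ⟨fun i => decide (x i = v), funext fun i => ?_⟩
  rcases h i with h | h <;> by_cases huv : u = v <;> simp [truthVertex, h, huv]

/-- A function that vanishes outside the two-valued assignments is determined by its values on
them. -/
theorem eq_twoValued (huv : u ≠ v) {C : (ι → Bool) → ℤ} {f : (ι → V) → ℤ}
    (h₀ : ∀ x, (¬ ∀ i, x i = u ∨ x i = v) → f x = 0)
    (h₁ : ∀ β, f (fun i => truthVertex u v (β i)) = C β) : f = twoValued u v C := by
  ext x
  by_cases h : ∀ i, x i = u ∨ x i = v
  · obtain ⟨β, rfl⟩ := exists_truthVertex h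
    rw [h₁, twoValued_truthVertex huv]
  · rw [h₀ x h, twoValued, if_neg h]

theorem truthVertex_injective (huv : u ≠ v) : Function.Injective (truthVertex u v) := by
  intro a b
  cases a <;> cases b <;> simp [truthVertex, huv, huv.symm]

end TwoValued

namespace InducedPath

variable {V : Type*} {H : SimpleGraph V} {u w₀ v w : V} {ι ι' : Type}

theorem ne (h : InducedPath H u w₀ v w) : u ≠ v := fun e => h.not_adj (e ▸ h.right)

theorem ne' (h : InducedPath H u w₀ v w) : w₀ ≠ w := fun e => h.not_adj (e ▸ h.left)

/-- The path read from its other end. -/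
theorem symm (h : InducedPath H u w₀ v w) : InducedPath H w v w₀ u :=
  ⟨h.right.symm, h.mid.symm, h.left.symm, fun e => h.not_adj e.symm⟩

open Classical in
theorem nbrCount_left (h : InducedPath H u w₀ v w) : nbrCount H u {w₀, w} = 1 := by
  rw [nbrCount, Finset.filter_insert, Finset.filter_singleton, if_pos h.left, if_neg h.not_adj]
  rfl

open Classical in
theorem nbrCount_mid (h : InducedPath H u w₀ v w) : nbrCount H v {w₀, w} = 2 := by
  rw [nbrCount, Finset.filter_insert, Finset.filter_singleton, if_pos h.mid, if_pos h.right]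
  exact Finset.card_pair h.ne'

variable [Fintype V]

open Classical in
theorem expressible_mem_all [Fintype ι] (a b : V) :
    Expressible H (fun x : ι → V => if ∀ i, x i = a ∨ x i = b then 1 else 0) := by
  convert Expressible.prod (Finset.univ : Finset ι)
    (fun i _ => Expressible.mem (H := H) i {a, b}) using 2 with x
  rw [Finset.prod_boole]
  simp

theorem mul {C C' : (ι → Bool) → ℤ} (h : InducedPath H u w₀ v w)
    (hC : Expressible H (twoValued u v C)) (hC' : Expressible H (twoValued u v C')) :
    Expressible H (twoValued u v (fun β => C β * C' β)) := by
  rw [← eq_twoValued h.ne (f := fun x => twoValued u v C x * twoValued u v C' x)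
    (fun x hx => by rw [twoValued, if_neg hx, zero_mul])
    (fun β => by rw [twoValued_truthVertex h.ne, twoValued_truthVertex h.ne])]
  exact hC.mul hC'

theorem one [Fintype ι] (_ : InducedPath H u w₀ v w) :
    Expressible H (twoValued u v (fun _ : ι → Bool => 1)) := by
  classical
  have := expressible_mem_all (H := H) (ι := ι) u v
  convert this using 2 with x
  rw [twoValued]
  congr

theorem prod [Fintype ι] (h : InducedPath H u w₀ v w) {α : Type*} (s : Finset α)
    {C : α → (ι → Bool) → ℤ} (hC : ∀ a ∈ s, Expressible H (twoValued u v (C a))) :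
    Expressible H (twoValued u v (fun β => ∏ a ∈ s, C a β)) := by
  classical
  induction s using Finset.induction_on with
  | empty => simpa using h.one
  | insert a s ha ih =>
    simp only [Finset.prod_insert ha]
    exact h.mul (hC a (Finset.mem_insert_self a s))
      (ih fun b hb => hC b (Finset.mem_insert_of_mem hb))

theorem reindex [Fintype ι'] (h : InducedPath H u w₀ v w) {C : (ι → Bool) → ℤ}
    (hC : Expressible H (twoValued u v C)) (ρ : ι → ι') :
    Expressible H (twoValued u v (fun β : ι' → Bool => C (fun i => β (ρ i)))) := by
  classical
  rw [← eq_twoValued h.ne (f := fun x => (if ∀ i, x i = u ∨ x i = v then 1 else 0) *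
    twoValued u v C (fun i => x (ρ i))) (fun x hx => by rw [if_neg hx, zero_mul])
    (fun β => by
      rw [twoValued_truthVertex h.ne, if_pos, one_mul]
      exact fun i => truthVertex_eq_or u v (β i))]
  exact (expressible_mem_all u v).mul (hC.reindex ρ)

theorem sum_pi {α : Type} [Fintype α] [DecidableEq α] (h : InducedPath H u w₀ v w)
    {C : (ι → Bool) → (α → Bool) → ℤ}
    (hC : Expressible H (twoValued u v (fun β : ι ⊕ α → Bool => C (β ∘ Sum.inl) (β ∘ Sum.inr)))) :
    Expressible H (twoValued u v (fun β => ∑ τ, C β τ)) := by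
  rw [← eq_twoValued h.ne (f := fun x => ∑ z : α → V, twoValued u v
    (fun β : ι ⊕ α → Bool => C (β ∘ Sum.inl) (β ∘ Sum.inr)) (Sum.elim x z))]
  · refine Expressible.sum_pi (f := fun x z => twoValued u v _ (Sum.elim x z)) ?_
    convert hC using 3
    exact Sum.elim_comp_inl_inr _
  · intro x hx
    refine Finset.sum_eq_zero fun z _ => ?_
    rw [twoValued, if_neg]
    exact fun h' => hx fun i => h' (Sum.inl i)
  · intro β
    symm
    refine Fintype.sum_of_injective (fun (τ : α → Bool) i => truthVertex u v (τ i))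
      (fun τ τ' h' => funext fun i => truthVertex_injective h.ne (congrFun h' i)) _ _ ?_ ?_
    · intro z hz
      rw [twoValued, if_neg]
      intro h'
      obtain ⟨τ, rfl⟩ := exists_truthVertex (x := z) fun i => h' (Sum.inr i)
      exact hz ⟨τ, rfl⟩
    · intro τ
      have := twoValued_truthVertex h.ne
        (fun β : ι ⊕ α → Bool => C (β ∘ Sum.inl) (β ∘ Sum.inr)) (Sum.elim β τ)
      rw [Sum.elim_comp_inl, Sum.elim_comp_inr] at this
      rw [← this]
      congr 1
      ext i
      cases i <;> rfl

theorem sum [Fintype ι] (h : InducedPath H u w₀ v w) {C : (ι → Bool) → Bool → ℤ}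
    (hC : Expressible H (twoValued u v
      (fun β : Option ι → Bool => C (fun i => β (some i)) (β none)))) :
    Expressible H (twoValued u v (fun β => ∑ t, C β t)) := by
  have h₁ := h.reindex hC (fun o : Option ι => o.elim (Sum.inr ()) (Sum.inl : ι → ι ⊕ Unit))
  have h₂ := h.sum_pi (C := fun β (τ : Unit → Bool) => C β (τ ())) h₁
  convert h₂ using 3 with β
  exact Fintype.sum_equiv (Equiv.funUnique Unit Bool).symm _ _ fun g => rfl

open Classical in
/-- The sign of a two-valued variable is a weight with list `{w₀, w}`. -/
theorem sign [Fintype ι] (h : InducedPath H u w₀ v w) (a : ι) :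
    Expressible H (twoValued u v (fun β => if β a then -1 else 1)) := by
  rw [← eq_twoValued h.ne (f := fun x => (if ∀ i, x i = u ∨ x i = v then 1 else 0) *
    residue (nbrCount H (x a) {w₀, w})) (fun x hx => by rw [if_neg hx, zero_mul])]
  · exact (expressible_mem_all u v).mul
      (Expressible.weight a {w₀, w} ⟨w₀, by simp⟩ Finset.card_le_two)
  · intro β
    rw [if_pos, one_mul]
    · cases hb : β a <;> simp [truthVertex, hb, h.nbrCount_left, h.nbrCount_mid, residue]
    · exact fun i => truthVertex_eq_or u v (β i)

theorem sum_pair_eq {a b : V} (hab : a ≠ b) (F : V → ℤ) :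
    (open Classical in ∑ y, (if y ∈ ({a, b} : Finset V) then 1 else 0) * F y) = F a + F b := by
  classical
  simp only [ite_mul, one_mul, zero_mul]
  rw [← Finset.sum_filter, Finset.filter_mem_eq_inter, Finset.univ_inter, Finset.sum_pair hab]

open Classical in
/-- Two variables that are not both `true`: their common neighbour `y` in `{w₀, w}` contributes
`-1` if it is `w₀`, and `1` if it is `w`, which needs both of them to be `v`. -/
theorem nand [Fintype ι] (h : InducedPath H u w₀ v w) (a b : ι) :
    Expressible H (twoValued u v (fun β => if β a ∧ β b then 0 else 1)) := by
  have e₁ : Expressible H (fun x : ι → V => ∑ y, (if y ∈ ({w₀, w} : Finset V) then 1 else 0) *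
      ((if H.Adj (x a) y then 1 else 0) * (if H.Adj (x b) y then 1 else 0) *
        residue (nbrCount H y {u, v}))) :=
    Expressible.sum ((Expressible.mem none {w₀, w}).mul
      (((Expressible.adj (some a) none).mul (Expressible.adj (some b) none)).mul
        (Expressible.weight none {u, v} ⟨u, by simp⟩ Finset.card_le_two)))
  have e₂ : Expressible H (fun x : ι → V => ∑ y, (if y ∈ ({w₀} : Finset V) then 1 else 0) *
      residue (nbrCount H y {u, v})) :=
    Expressible.sum ((Expressible.mem none {w₀}).mul
        (Expressible.weight none {u, v} ⟨u, by simp⟩ Finset.card_le_two))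
  have n₁ := h.symm.nbrCount_left
  have n₂ := h.symm.nbrCount_mid
  rw [Finset.pair_comm] at n₁ n₂
  rw [← eq_twoValued h.ne (f := fun x => (if ∀ i, x i = u ∨ x i = v then 1 else 0) *
    ((∑ y, (if y ∈ ({w₀} : Finset V) then 1 else 0) * residue (nbrCount H y {u, v})) *
    (∑ y, (if y ∈ ({w₀, w} : Finset V) then 1 else 0) *
      ((if H.Adj (x a) y then 1 else 0) * (if H.Adj (x b) y then 1 else 0) *
        residue (nbrCount H y {u, v})))))
    (fun x hx => by rw [if_neg hx, zero_mul])]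
  · exact (expressible_mem_all u v).mul (e₂.mul e₁)
  · intro β
    rw [if_pos, one_mul, sum_pair_eq h.ne', n₁, n₂]
    · simp only [Finset.mem_singleton, ite_mul, one_mul, zero_mul, Finset.sum_ite_eq',
        Finset.mem_univ, if_true, n₂]
      cases ha : β a <;> cases hb : β b <;>
        simp [truthVertex, h.left, h.mid, h.right, h.not_adj, residue]
    · exact fun i => truthVertex_eq_or u v (β i)

theorem or [Fintype ι] (h : InducedPath H u w₀ v w) (a b : ι) :
    Expressible H (twoValued u v (fun β => if β a ∨ β b then 1 else 0)) := by
  have := h.sum (ι := ι) (C := fun β t => (if β a ∧ t then 0 else 1) * ((if t then -1 else 1) *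
    (if t ∧ β b then 0 else 1)))
    (h.mul (h.nand (some a) none) (h.mul (h.sign none) (h.nand none (some b))))
  convert this using 3 with β
  cases β a <;> cases β b <;> decide

/-- If the variable `none` is `true`, then `a` has the value `c`. -/
theorem imp [Fintype ι] (h : InducedPath H u w₀ v w) (a : ι) (c : Bool) :
    Expressible H (twoValued u v (fun β : Option ι → Bool =>
      if β none ∧ β (some a) ≠ c then 0 else 1)) := by
  cases c with
  | false => convert h.nand none (some a) using 6; simp
  | true =>
    -- the intermediate variable is the negation of `a`
    have := h.sum (ι := Option ι) (C := fun β t => (if β none ∧ t then 0 else 1) *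
      ((if t ∧ β (some a) then 0 else 1) * (if t ∨ β (some a) then 1 else 0)))
      (h.mul (h.nand (some none) none) (h.mul (h.nand none (some (some a)))
        (h.or none (some (some a)))))
    convert this using 3 with β
    cases β none <;> cases β (some a) <;> decide

/-- Every relation between two-valued variables is expressible: the function `1 - [β = c]` is a
signed sum over a variable whose value `true` forces `β = c`. -/
theorem rel [Fintype ι] (h : InducedPath H u w₀ v w) (R : (ι → Bool) → Prop) [DecidablePred R] :
    Expressible H (twoValued u v (fun β => if R β then 1 else 0)) := by
  classical
  have key : ∀ c : ι → Bool,
      Expressible H (twoValued u v (fun β => if β = c then (0 : ℤ) else 1)) := by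
    intro c
    have := h.sum (ι := ι) (C := fun β t => (if t then -1 else 1) *
      ∏ a, (if t ∧ β a ≠ c a then (0 : ℤ) else 1))
      (h.mul (h.sign none) (h.prod Finset.univ fun a _ => h.imp a (c a)))
    convert this using 3 with β
    rw [Fintype.sum_bool]
    by_cases hc : β = c
    · simp [hc]
    · obtain ⟨a, ha⟩ := Function.ne_iff.1 hc
      rw [Finset.prod_eq_zero (Finset.mem_univ a) (by simp [ha])]
      simp [hc]
  convert h.prod (Finset.univ.filter fun c => ¬ R c) (fun c _ => key c) using 3 with β
  by_cases hR : R β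
  · rw [if_pos hR, Finset.prod_eq_one]
    intro c hc
    rw [if_neg]
    rintro rfl
    simp [hR] at hc
  · rw [if_neg hR]
    symm
    exact Finset.prod_eq_zero (Finset.mem_filter.2 ⟨Finset.mem_univ β, hR⟩) (if_pos rfl)

/-- Every integer-valued function of two-valued variables is expressible: its absolute value
counts witnesses of a relation, and its sign is the sign of a two-valued variable. -/
theorem all [Fintype ι] (h : InducedPath H u w₀ v w) (C : (ι → Bool) → ℤ) :
    Expressible H (twoValued u v C) := by
  classical
  obtain ⟨N, hN⟩ : ∃ N, ∀ β, (C β).natAbs ≤ N :=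
    ⟨∑ β, (C β).natAbs, fun β => Finset.single_le_sum (f := fun β => (C β).natAbs)
      (fun _ _ => Nat.zero_le _) (Finset.mem_univ β)⟩
  have hT : ∀ β, ∃ T : Finset (Fin N → Bool), T.card = (C β).natAbs := fun β => by
    obtain ⟨T, -, hT⟩ := Finset.exists_subset_card_eq (s := (Finset.univ : Finset (Fin N → Bool)))
      (n := (C β).natAbs) (by
        rw [Finset.card_univ, Fintype.card_fun, Fintype.card_bool, Fintype.card_fin]
        exact (hN β).trans Nat.lt_two_pow_self.le)
    exact ⟨T, hT⟩
  choose T hT using hT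
  have h₁ := h.sum_pi (ι := ι) (C := fun β τ => if τ ∈ T β then 1 else 0)
    (h.rel fun β : ι ⊕ Fin N → Bool => β ∘ Sum.inr ∈ T (β ∘ Sum.inl))
  have h₂ := h.sum (ι := ι) (C := fun β t => (if t then -1 else 1) *
    (if t = decide (C β < 0) then 1 else 0)) (h.mul (h.sign none)
      (h.rel fun β : Option ι → Bool => β none = decide (C (fun i => β (some i)) < 0)))
  convert h.mul h₂ h₁ using 3 with β
  rw [Fintype.sum_bool, Finset.sum_boole]
  simp only [Finset.filter_mem_eq_inter, Finset.univ_inter, hT]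
  by_cases hC : C β < 0 <;> simp [hC]
  · rw [abs_of_neg hC, neg_neg]
  · rw [abs_of_nonneg (not_lt.1 hC)]

end InducedPath

/-! ### Walks in a connected bipartite graph -/

/-- `H` is connected and has an edge, and `X` is one of the two classes of its bipartition. -/
structure IsSide {V : Type*} (H : SimpleGraph V) (X : Set V) : Prop where
  adj : ∀ {a b}, H.Adj a b → (a ∈ X ↔ b ∉ X)
  connected : H.Connected
  exists_adj : ∀ x, ∃ y, H.Adj x y

theorem IsSide.even_length {V : Type*} {H : SimpleGraph V} {X : Set V} (hX : IsSide H X) {x y : V}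
    (p : H.Walk x y) : Even p.length ↔ (x ∈ X ↔ y ∈ X) := by
  induction p with
  | nil => simp
  | cons h p ih =>
    rw [SimpleGraph.Walk.length_cons, Nat.even_add_one, ih, hX.adj h]
    tauto

section Walks

variable {V : Type*} [Fintype V] [DecidableEq V] {H : SimpleGraph V} [DecidableRel H.Adj]

theorem adjMatrix_pow_pos {x y : V} (p : H.Walk x y) : 0 < (H.adjMatrix ℤ ^ p.length) x y := by
  rw [SimpleGraph.adjMatrix_pow_apply_eq_card_walk, Nat.cast_pos, Fintype.card_pos_iff]
  exact ⟨⟨p, rfl⟩⟩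

/-- Some even power of the adjacency matrix is positive within each class of the bipartition:
even walks can be prolonged by going back and forth along an edge. -/
theorem IsSide.exists_pow_pos {X : Set V} (hX : IsSide H X) :
    ∃ l, l ≠ 0 ∧ ∀ x y, (x ∈ X ↔ y ∈ X) → 0 < (H.adjMatrix ℤ ^ (l + l)) x y := by
  have hw : ∀ x y, ∃ n, (x ∈ X ↔ y ∈ X) → ∃ p : H.Walk x y, p.length = n + n := fun x y => by
    obtain ⟨p⟩ := hX.connected.preconnected x y
    by_cases h : x ∈ X ↔ y ∈ X
    · obtain ⟨n, hn⟩ := (hX.even_length p).2 h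
      exact ⟨n, fun _ => ⟨p, hn⟩⟩
    · exact ⟨0, fun h' => absurd h' h⟩
  choose n hn using hw
  have hpad : ∀ (x y : V) (k : ℕ), (∃ p : H.Walk x y, p.length = k + k) → ∀ d,
      ∃ p : H.Walk x y, p.length = (k + d) + (k + d) := by
    intro x y k hp d
    induction d with
    | zero => exact hp
    | succ d ih =>
      obtain ⟨p, hp⟩ := ih
      obtain ⟨z, hz⟩ := hX.exists_adj x
      exact ⟨.cons hz (.cons hz.symm p), by simp [hp]; omega⟩
  refine ⟨(∑ x, ∑ y, n x y) + 1, by omega, fun x y hxy => ?_⟩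
  have hle : n x y ≤ ∑ x, ∑ y, n x y :=
    (Finset.single_le_sum (f := fun y => n x y) (fun _ _ => Nat.zero_le _)
      (Finset.mem_univ y)).trans (Finset.single_le_sum (f := fun x => ∑ y, n x y)
        (fun _ _ => Nat.zero_le _) (Finset.mem_univ x))
  obtain ⟨p, hp⟩ := hpad x y (n x y) (hn x y hxy) ((∑ x, ∑ y, n x y) + 1 - n x y)
  have := adjMatrix_pow_pos p
  rwa [hp, show n x y + ((∑ x, ∑ y, n x y) + 1 - n x y) = (∑ x, ∑ y, n x y) + 1 by omega] at this

open Matrix in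
/-- A symmetric matrix and its powers have the same kernel. -/
theorem mulVec_eq_zero_of_pow_mulVec_eq_zero {A : Matrix V V ℤ} (hA : Aᵀ = A) (f : V → ℤ) (l : ℕ)
    (h : A ^ (l + 1) *ᵥ f = 0) : A *ᵥ f = 0 := by
  induction l with
  | zero => simpa using h
  | succ l ih =>
    apply ih
    rw [← dotProduct_self_eq_zero]
    have hT : (A ^ (l + 1))ᵀ = A ^ (l + 1) := by rw [transpose_pow, hA]
    calc (A ^ (l + 1) *ᵥ f) ⬝ᵥ (A ^ (l + 1) *ᵥ f)
        = (A ^ (l + 1 + 1) *ᵥ f) ⬝ᵥ (A ^ l *ᵥ f) := by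
          rw [dotProduct_mulVec, ← mulVec_transpose, hT, mulVec_mulVec, dotProduct_mulVec,
            ← mulVec_transpose, transpose_pow, hA, mulVec_mulVec, ← pow_add, ← pow_add]
          congr 3
          omega
      _ = 0 := by rw [h, zero_dotProduct]

open Matrix in
/-- The even powers of the adjacency matrix are Gram matrices; strictness of the Cauchy-Schwarz
inequality on two vertices that are not twins. -/
theorem gram_det_ne_zero {l : ℕ} (hl : l ≠ 0) {x x' : V}
    (hnbr : ∀ x, ∃ y, H.Adj x y) (hne : H.neighborSet x ≠ H.neighborSet x')
    (hpos : 0 < (H.adjMatrix ℤ ^ (l + l)) x x) :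
    (H.adjMatrix ℤ ^ (l + l)) x x * (H.adjMatrix ℤ ^ (l + l)) x' x' ≠
      (H.adjMatrix ℤ ^ (l + l)) x x' * (H.adjMatrix ℤ ^ (l + l)) x' x := by
  intro h0
  set A := H.adjMatrix ℤ with hA
  have hAT : Aᵀ = A := SimpleGraph.transpose_adjMatrix _
  set G := A ^ (l + l) with hG
  have hGT : Gᵀ = G := by rw [hG, transpose_pow, hAT]
  have hsymm : G x' x = G x x' := by conv_lhs => rw [← hGT, transpose_apply]
  set f : V → ℤ := G x x' • Pi.single x 1 - G x x • Pi.single x' 1 with hf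
  have hGf : (G *ᵥ f) = G x x' • G.col x - G x x • G.col x' := by
    rw [hf, mulVec_sub, mulVec_smul, mulVec_smul, mulVec_single_one, mulVec_single_one]
  have h1 : f ⬝ᵥ (G *ᵥ f) = 0 := by
    rw [hGf, hf]
    simp only [sub_dotProduct, smul_dotProduct, single_dotProduct, one_mul, Pi.sub_apply,
      Pi.smul_apply, smul_eq_mul, col_apply]
    rw [hsymm] at h0 ⊢
    linear_combination G x x * h0
  have h2 : A ^ l *ᵥ f = 0 := by
    rw [← dotProduct_self_eq_zero]
    rw [← h1, hG, pow_add, ← mulVec_mulVec, dotProduct_mulVec f, ← mulVec_transpose,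
      transpose_pow, hAT]
  obtain ⟨k, rfl⟩ := Nat.exists_eq_succ_of_ne_zero hl
  have h3 := mulVec_eq_zero_of_pow_mulVec_eq_zero hAT f k h2
  have h4 : ∀ y, G x x' * (if H.Adj y x then 1 else 0) = G x x * (if H.Adj y x' then 1 else 0) := by
    intro y
    have := congrFun h3 y
    rw [hf, mulVec_sub, mulVec_smul, mulVec_smul, mulVec_single_one, mulVec_single_one] at this
    simpa [hA, SimpleGraph.adjMatrix_apply, sub_eq_zero] using this
  obtain ⟨y₀, hy₀⟩ := hnbr x'
  have h5 := h4 y₀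
  rw [if_pos hy₀.symm, mul_one] at h5
  have hne0 : G x x' ≠ 0 := by
    intro h
    rw [h, zero_mul] at h5
    exact hpos.ne h5
  apply hne
  ext y
  have h6 := h4 y
  simp only [SimpleGraph.mem_neighborSet, H.adj_comm x y, H.adj_comm x' y]
  by_cases ha : H.Adj y x <;> by_cases hb : H.Adj y x' <;> simp [ha, hb] at h6 ⊢
  · exact hne0 h6
  · exact hpos.ne h6

end Walks

/-! ### Telling vertices apart -/

/-- A function of two variables is expressible. -/
def Expressible₂ {V : Type*} [Fintype V] (H : SimpleGraph V) (K : V → V → ℤ) : Prop :=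
  Expressible H (fun x : Fin 2 → V => K (x 0) (x 1))

namespace Expressible₂

variable {V : Type*} [Fintype V] {H : SimpleGraph V} {ι : Type}

theorem apply {K : V → V → ℤ} (hK : Expressible₂ H K) (a b : ι) :
    Expressible H (fun x : ι → V => K (x a) (x b)) :=
  hK.reindex ![a, b]

theorem adj [DecidableRel H.Adj] : Expressible₂ H (fun a b => if H.Adj a b then 1 else 0) := by
  unfold Expressible₂
  convert Expressible.adj (H := H) (0 : Fin 2) 1

theorem comp {K M : V → V → ℤ} (hK : Expressible₂ H K) (hM : Expressible₂ H M) :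
    Expressible₂ H (fun a b => ∑ y, K a y * M y b) :=
  Expressible.sum (f := fun (x : Fin 2 → V) y => K (x 0) y * M y (x 1))
    ((hK.apply (some 0) none).mul (hM.apply none (some 1)))

theorem comp_pair {K M : V → V → ℤ} (hK : Expressible₂ H K) (hM : Expressible₂ H M) {p q : V}
    (hpq : p ≠ q) : Expressible₂ H (fun a b => K a p * M p b + K a q * M q b) := by
  classical
  have := Expressible.sum (f := fun (x : Fin 2 → V) y =>
      (if y ∈ ({p, q} : Finset V) then 1 else 0) * (K (x 0) y * M y (x 1)))
    ((Expressible.mem none {p, q}).mul ((hK.apply (some 0) none).mul (hM.apply none (some 1))))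
  unfold Expressible₂
  convert this using 2 with x
  convert (InducedPath.sum_pair_eq hpq (fun y => K (x 0) y * M y (x 1))).symm

theorem adjMatrix_pow [DecidableEq V] [DecidableRel H.Adj] {l : ℕ} (hl : l ≠ 0) :
    Expressible₂ H (fun a b => (H.adjMatrix ℤ ^ l) a b) := by
  obtain ⟨k, rfl⟩ := Nat.exists_eq_succ_of_ne_zero hl
  clear hl
  induction k with
  | zero => simpa [SimpleGraph.adjMatrix_apply] using adj
  | succ k ih =>
    have := ih.comp adj
    convert this using 3 with a b
    rw [pow_succ, Matrix.mul_apply]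
    simp [SimpleGraph.adjMatrix_apply]

end Expressible₂

/-- Some expressible function `K` has linearly independent columns `K(·, x)` and `K(·, x')` on
`{u, v}`. -/
def Linked {V : Type*} [Fintype V] (H : SimpleGraph V) (u v x x' : V) : Prop :=
  ∃ K, Expressible₂ H K ∧ K u x * K v x' ≠ K u x' * K v x

namespace Linked

variable {V : Type*} [Fintype V] {H : SimpleGraph V} {u v x x' : V}

theorem symm (h : Linked H u v x x') : Linked H u v x' x := by
  obtain ⟨K, hK, hd⟩ := h
  exact ⟨K, hK, hd.symm⟩

/-- Two linked vertices pass their distinction on to neighbours that only one of them has. -/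
theorem step (h : Linked H u v x x') {y y' : V} (h₁ : H.Adj x y) (h₂ : ¬ H.Adj x y')
    (h₃ : H.Adj x' y') : Linked H u v y y' := by
  classical
  obtain ⟨K, hK, hd⟩ := h
  have hne : x ≠ x' := fun e => h₂ (e ▸ h₃)
  refine ⟨_, hK.comp_pair .adj hne, ?_⟩
  simp only [if_pos h₁, if_neg h₂, if_pos h₃, mul_one, mul_zero, zero_add]
  intro h
  apply hd
  linear_combination h

/-- From linked vertices one obtains, by prolonging with long walks, an expressible function that
still tells them apart and that vanishes nowhere on their class of the bipartition. -/
theorem exists_nonvanishing {X : Set V} (hX : IsSide H X) (h : Linked H u v x x')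
    (hne : H.neighborSet x ≠ H.neighborSet x') :
    ∃ M, Expressible₂ H M ∧ M u x * M v x' ≠ M u x' * M v x ∧
      (∀ t, (x ∈ X ↔ t ∈ X) → M u t ≠ 0 ∨ M v t ≠ 0) ∧
      ∀ z t t', H.neighborSet t = H.neighborSet t' → M z t = M z t' := by
  classical
  obtain ⟨K, hK, hd⟩ := h
  obtain ⟨l, hl, hpos⟩ := hX.exists_pow_pos
  have hxx' : x ≠ x' := fun e => hne (congrArg _ e)
  have hll : l + l ≠ 0 := by omega
  have hdet := gram_det_ne_zero hl hX.exists_adj hne (hpos x x Iff.rfl)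
  refine ⟨_, hK.comp_pair (.adjMatrix_pow hll) hxx', ?_, fun t ht => ?_, fun z t t' htt' => ?_⟩
  · intro h
    set G := H.adjMatrix ℤ ^ (l + l)
    have : (K u x * K v x' - K u x' * K v x) * (G x x * G x' x' - G x x' * G x' x) = 0 := by
      linear_combination h
    rcases mul_eq_zero.1 this with h' | h'
    · exact hd (sub_eq_zero.1 h')
    · exact hdet (sub_eq_zero.1 h')
  · by_contra! hc
    have hp := hpos x t ht
    set G := H.adjMatrix ℤ ^ (l + l)
    have : (K u x * K v x' - K u x' * K v x) * G x t = 0 := by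
      linear_combination K v x' * hc.1 - K u x' * hc.2
    rcases mul_eq_zero.1 this with h' | h'
    · exact hd (sub_eq_zero.1 h')
    · exact hp.ne' h'
  · have key : ∀ a, (H.adjMatrix ℤ ^ (l + l)) a t = (H.adjMatrix ℤ ^ (l + l)) a t' := by
      intro a
      obtain ⟨k, hk⟩ := Nat.exists_eq_succ_of_ne_zero hll
      rw [hk, pow_succ, Matrix.mul_apply, Matrix.mul_apply]
      refine Finset.sum_congr rfl fun y _ => ?_
      have : H.Adj y t ↔ H.Adj y t' := by
        rw [H.adj_comm y t, H.adj_comm y t', ← H.mem_neighborSet, htt', H.mem_neighborSet]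
      simp [SimpleGraph.adjMatrix_apply, this]
    simp only [key]

end Linked

/-- `x` and `x'` are linked and are not twins. -/
def Apart {V : Type*} [Fintype V] (H : SimpleGraph V) (u v x x' : V) : Prop :=
  H.neighborSet x ≠ H.neighborSet x' ∧ Linked H u v x x'

namespace Apart

variable {V : Type*} [Fintype V] {H : SimpleGraph V} {u v : V} {X : Set V}

theorem symm {x x' : V} (h : Apart H u v x x') : Apart H u v x' x := ⟨h.1.symm, h.2.symm⟩

/-- Within a class of the bipartition, not being apart is transitive. -/
theorem or_apart (hX : IsSide H X) {x x' : V} (h : Apart H u v x x') {t : V}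
    (ht : x ∈ X ↔ t ∈ X) : Apart H u v x t ∨ Apart H u v x' t := by
  obtain ⟨M, hM, hd, hz, htw⟩ := h.2.exists_nonvanishing hX h.1
  by_cases h₁ : M u x * M v t = M u t * M v x
  · refine Or.inr ⟨fun he => ?_, M, hM, fun h₂ => ?_⟩
    · rw [← htw u x' t he, ← htw v x' t he] at h₁
      exact hd h₁
    · have e₁ : M u t * (M u x * M v x' - M u x' * M v x) = 0 := by
        linear_combination M u x' * h₁ - M u x * h₂
      have e₂ : M v t * (M u x * M v x' - M u x' * M v x) = 0 := by
        linear_combination M v x' * h₁ - M v x * h₂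
      rcases hz t ht with h' | h'
      · exact hd (sub_eq_zero.1 ((mul_eq_zero.1 e₁).resolve_left h'))
      · exact hd (sub_eq_zero.1 ((mul_eq_zero.1 e₂).resolve_left h'))
  · refine Or.inl ⟨fun he => ?_, M, hM, h₁⟩
    rw [htw u x t he, htw v x t he] at h₁
    exact h₁ rfl

theorem not_trans (hX : IsSide H X) {x y z : V} (h₁ : ¬ Apart H u v x y)
    (h₂ : ¬ Apart H u v y z) (hxy : x ∈ X ↔ y ∈ X) : ¬ Apart H u v x z := fun h =>
  (or_apart hX h hxy).elim h₁ fun h' => h₂ h'.symm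

theorem not_apart_of_adj_aux (hX : IsSide H X) {y y' : V} (hside : y ∈ X ↔ y' ∈ X)
    (hlink : ¬ Linked H u v y y')
    {x₁ : V} (h₁ : H.Adj y x₁) (h₁' : ¬ H.Adj y' x₁) {a b : V} (ha : H.Adj y a ∨ H.Adj y' a)
    (hb : H.Adj y b ∨ H.Adj y' b) : ¬ Apart H u v a b := by
  have hs : ∀ c, H.Adj y c ∨ H.Adj y' c → (c ∈ X ↔ y ∉ X) := fun c hc => by
    rcases hc with hc | hc
    · exact hX.adj hc.symm
    · rw [hside]; exact hX.adj hc.symm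
  have key : ∀ e f, H.Adj y e → ¬ H.Adj y' e → H.Adj y' f → ¬ Apart H u v e f :=
    fun e f he he' hf h => hlink (h.2.step he.symm (fun h' => he' h'.symm) hf.symm)
  obtain ⟨f₀, hf₀⟩ := hX.exists_adj y'
  have key₂ : ∀ c, H.Adj y c ∨ H.Adj y' c → ¬ Apart H u v c x₁ := by
    intro c hc
    by_cases hc' : H.Adj y' c
    · exact fun h => key x₁ c h₁ h₁' hc' h.symm
    · have hc₁ := hc.resolve_right hc'
      exact not_trans hX (key c f₀ hc₁ hc' hf₀)
        (fun h => key x₁ f₀ h₁ h₁' hf₀ h.symm)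
        ((hs c hc).trans (hs f₀ (Or.inr hf₀)).symm)
  exact not_trans hX (key₂ a ha) (fun h => key₂ b hb h.symm)
    ((hs a ha).trans (hs x₁ (Or.inl h₁)).symm)

/-- If two vertices are not twins and not linked, then no two of their neighbours are apart. -/
theorem not_apart_of_adj (hX : IsSide H X) {y y' : V} (hside : y ∈ X ↔ y' ∈ X)
    (hne : H.neighborSet y ≠ H.neighborSet y') (hlink : ¬ Linked H u v y y') {a b : V}
    (ha : H.Adj y a ∨ H.Adj y' a) (hb : H.Adj y b ∨ H.Adj y' b) : ¬ Apart H u v a b := by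
  by_cases h : ∃ x₁, H.Adj y x₁ ∧ ¬ H.Adj y' x₁
  · obtain ⟨x₁, h₁, h₁'⟩ := h
    exact not_apart_of_adj_aux hX hside hlink h₁ h₁' ha hb
  · by_cases h' : ∃ x₁, H.Adj y' x₁ ∧ ¬ H.Adj y x₁
    · obtain ⟨x₁, h₁, h₁'⟩ := h'
      exact not_apart_of_adj_aux hX hside.symm (fun h => hlink h.symm) h₁ h₁'
        ha.symm hb.symm
    · push Not at h h'
      exact absurd (Set.ext fun c => ⟨h c, h' c⟩) hne

/-- If `a` is not linked to some vertex that is not its twin, and not apart from `x`, then no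
neighbour of `x` is apart from a neighbour of `a`. -/
theorem not_apart_of_adj_adj (hX : IsSide H X) {a a' x : V} (hside : a ∈ X ↔ a' ∈ X)
    (hne : H.neighborSet a ≠ H.neighborSet a') (hlink : ¬ Linked H u v a a')
    (hx : a ∈ X ↔ x ∈ X) (hax : ¬ Apart H u v a x) {y z : V} (hy : H.Adj x y)
    (hz : H.Adj a z) : ¬ Apart H u v y z := by
  by_cases h : H.neighborSet a = H.neighborSet x
  · have hne' : H.neighborSet a' ≠ H.neighborSet x := fun h' => hne (h.trans h'.symm)
    have hax' : ¬ Apart H u v a' x := not_trans hX (fun h => hlink h.symm.2) hax hside.symm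
    obtain ⟨c, hc⟩ := hX.exists_adj a'
    have h₁ := not_apart_of_adj hX (hside.symm.trans hx) hne'
      (fun h => hax' ⟨hne', h⟩) (Or.inr hy) (Or.inl hc)
    have h₂ := not_apart_of_adj hX hside hne hlink (Or.inr hc) (Or.inl hz)
    have e₁ := hX.adj hc
    have e₂ := hX.adj hz
    have e₃ := hX.adj hy
    exact not_trans hX h₁ h₂ (by tauto)
  · exact not_apart_of_adj hX hx h (fun h' => hax ⟨h, h'⟩) (Or.inr hy) (Or.inl hz)

end Apart

theorem iff_of_iff_not {p q r : Prop} (h : p ↔ ¬ q) (h' : ¬ (p ↔ r)) : q ↔ r := by tauto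

namespace InducedPath

variable {V : Type*} [Fintype V] {H : SimpleGraph V} {u w₀ v w : V} {X : Set V}

theorem linked (h : InducedPath H u w₀ v w) : Linked H u v u v := by
  classical
  set C : (Fin 2 → Bool) → ℤ := fun β => if β 0 = β 1 then 1 else 0 with hC
  have hK : ∀ b c : Bool, twoValued u v C ![truthVertex u v b, truthVertex u v c] =
      if b = c then 1 else 0 := fun b c => by
    have := twoValued_truthVertex h.ne C ![b, c]
    change _ = if b = c then 1 else 0 at this
    rw [← this]
    congr 1
    ext i
    fin_cases i <;> rfl
  refine ⟨fun a b => twoValued u v C ![a, b], ?_, ?_⟩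
  · unfold Expressible₂
    convert h.all C using 3 with x
    ext i
    fin_cases i <;> rfl
  · have h₁ := hK false false
    have h₂ := hK false true
    have h₃ := hK true false
    have h₄ := hK true true
    simp only [truthVertex, if_true, Bool.false_eq_true, if_false] at h₁ h₂ h₃ h₄
    dsimp only
    rw [h₁, h₂, h₃, h₄]
    decide

/-- In a connected bipartite graph, any two vertices of a class of the bipartition that are not
twins are linked to the ends `u`, `v` of an induced path. Otherwise the vertices not apart from
one of the two, together with those not apart from one of its neighbours, would be closed under
adjacency; but `u` and `v` are apart. -/
theorem linked_of_ne (h : InducedPath H u w₀ v w) (hX : IsSide H X) {b b' : V}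
    (hside : b ∈ X ↔ b' ∈ X)
    (hne : H.neighborSet b ≠ H.neighborSet b') : Linked H u v b b' := by
  wlog hw : ∃ w₁, H.Adj b w₁ ∧ ¬ H.Adj b' w₁ generalizing b b'
  · refine (this hside.symm hne.symm ?_).symm
    by_contra h'
    push Not at hw h'
    exact hne (Set.ext fun c => ⟨hw c, h' c⟩)
  obtain ⟨w₁, hw₁, hw₁'⟩ := hw
  obtain ⟨y₁, hy₁⟩ := hX.exists_adj b'
  by_contra hlink
  have e₁ := hX.adj hw₁
  have e₂ := hX.adj hy₁
  have hne' : H.neighborSet w₁ ≠ H.neighborSet y₁ := fun he =>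
    hw₁' ((show b' ∈ H.neighborSet w₁ from he ▸ hy₁.symm) : H.Adj w₁ b').symm
  have hlink' : ¬ Linked H u v w₁ y₁ := fun hl =>
    Apart.not_apart_of_adj hX hside hne hlink (Or.inl hw₁) (Or.inr hy₁) ⟨hne', hl⟩
  have hside' : w₁ ∈ X ↔ y₁ ∈ X :=
    ((hX.adj hw₁.symm).trans (not_congr hside)).trans (hX.adj hy₁.symm).symm
  have hT : ∀ x, ((b ∈ X ↔ x ∈ X) → ¬ Apart H u v b x) ∧
      (¬ (b ∈ X ↔ x ∈ X) → ¬ Apart H u v w₁ x) := by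
    have hstep : ∀ x y, H.Adj x y → (((b ∈ X ↔ x ∈ X) → ¬ Apart H u v b x) ∧
        (¬ (b ∈ X ↔ x ∈ X) → ¬ Apart H u v w₁ x)) → (((b ∈ X ↔ y ∈ X) → ¬ Apart H u v b y) ∧
        (¬ (b ∈ X ↔ y ∈ X) → ¬ Apart H u v w₁ y)) := by
      intro x y hxy hx
      have e₃ := hX.adj hxy
      constructor
      · intro hby ha
        exact Apart.not_apart_of_adj_adj hX hside' hne' hlink' (x := x) (by tauto)
          (hx.2 (by tauto)) hxy hw₁.symm ha.symm
      · intro hby ha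
        exact Apart.not_apart_of_adj_adj hX hside hne hlink (x := x) (by tauto)
          (hx.1 (by tauto)) hxy hw₁ ha.symm
    have hwalk : ∀ x y, H.Walk x y → (((b ∈ X ↔ x ∈ X) → ¬ Apart H u v b x) ∧
        (¬ (b ∈ X ↔ x ∈ X) → ¬ Apart H u v w₁ x)) → (((b ∈ X ↔ y ∈ X) → ¬ Apart H u v b y) ∧
        (¬ (b ∈ X ↔ y ∈ X) → ¬ Apart H u v w₁ y)) := by
      intro x y p
      induction p with
      | nil => exact fun h => h
      | cons hadj p ih => exact fun h => ih (hstep _ _ hadj h)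
    intro x
    obtain ⟨p⟩ := hX.connected.preconnected b x
    exact hwalk b x p ⟨fun _ ha => ha.1 rfl, fun hb => absurd Iff.rfl hb⟩
  have huv : Apart H u v u v := ⟨fun he => h.not_adj
    (show w ∈ H.neighborSet u from he ▸ h.right), h.linked⟩
  have e₃ := hX.adj h.left
  have e₄ := hX.adj h.mid
  have e₅ : u ∈ X ↔ v ∈ X := e₃.trans e₄.symm
  by_cases hb : b ∈ X ↔ u ∈ X
  · exact Apart.not_trans hX (fun ha => (hT u).1 hb ha.symm)
      ((hT v).1 (hb.trans e₅)) hb.symm huv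
  · exact Apart.not_trans hX (fun ha => (hT u).2 hb ha.symm)
      ((hT v).2 (fun h' => hb (h'.trans e₅.symm))) (iff_of_iff_not e₁ hb).symm huv

end InducedPath

/-! ### A gadget for an arbitrary relation -/

section Existence

variable {V : Type*} {H : SimpleGraph V}

theorem exists_adj_of_connected (hconn : H.Connected) {b b' : V} (hne : b ≠ b') (x : V) :
    ∃ y, H.Adj x y := by
  obtain ⟨z, hz⟩ : ∃ z, z ≠ x := by
    by_cases h : b = x
    · exact ⟨b', fun h' => hne (h.trans h'.symm)⟩
    · exact ⟨b, h⟩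
  obtain ⟨p⟩ := hconn.preconnected x z
  cases p with
  | nil => exact absurd rfl hz
  | cons h p => exact ⟨_, h⟩

theorem IsSide.of_isBipartiteWith {X : Set V} (hconn : H.Connected) {b b' : V} (hne : b ≠ b')
    (hX : H.IsBipartiteWith X Xᶜ) : IsSide H X where
  adj := fun h => by
    rcases hX.mem_of_adj h with ⟨h₁, h₂⟩ | ⟨h₁, h₂⟩
    · exact iff_of_true h₁ h₂
    · exact iff_of_false h₁ (fun h' => h' h₂)
  connected := hconn
  exists_adj := exists_adj_of_connected hconn hne

theorem exists_ne_of_two_le_irr [Fintype V] (h : 2 ≤ irr H) :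
    ∃ X : Set V, H.IsBipartiteWith X Xᶜ ∧ ∃ b ∈ X, ∃ b' ∈ X, b ≠ b' ∧
      H.neighborSet b ≠ H.neighborSet b' := by
  have hbdd : BddAbove {k | ∃ S : Finset V, OneSided H (S : Set V) ∧ Irredundant H (S : Set V) ∧
      S.card = k} := ⟨Fintype.card V, by rintro k ⟨S, -, -, rfl⟩; exact S.card_le_univ⟩
  have hne : {k | ∃ S : Finset V, OneSided H (S : Set V) ∧ Irredundant H (S : Set V) ∧
      S.card = k}.Nonempty := by
    by_contra hc
    rw [Set.not_nonempty_iff_eq_empty] at hc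
    rw [irr, hc, csSup_empty] at h
    exact absurd h (by decide)
  obtain ⟨S, ⟨X, hX, hSX⟩, hirr, hcard⟩ := Nat.sSup_mem hne hbdd
  obtain ⟨b, hb, b', hb', hbb'⟩ := Finset.one_lt_card.1 (by rw [hcard]; exact h)
  exact ⟨X, hX, b, hSX hb, b', hSX hb', hbb', hirr b hb b' hb' hbb'⟩

/-- Without induced paths on four vertices, the neighbours of a vertex `w` together with their
neighbours are closed under adjacency. -/
theorem IsSide.exists_inducedPath {X : Set V} (hX : IsSide H X) {b b' : V}
    (hside : b ∈ X ↔ b' ∈ X) (hne : H.neighborSet b ≠ H.neighborSet b') :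
    ∃ u w₀ v w, InducedPath H u w₀ v w := by
  wlog hw : ∃ w, H.Adj b w ∧ ¬ H.Adj b' w generalizing b b'
  · refine this hside.symm hne.symm ?_
    by_contra h'
    push Not at hw h'
    exact hne (Set.ext fun c => ⟨hw c, h' c⟩)
  obtain ⟨w, hw, hw'⟩ := hw
  by_contra! hc
  have hwalk : ∀ x y, H.Walk x y → (H.Adj x w ∨ ∃ v, H.Adj v w ∧ H.Adj v x) →
      (H.Adj y w ∨ ∃ v, H.Adj v w ∧ H.Adj v y) := by
    intro x y p
    induction p with
    | nil => exact fun h => h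
    | @cons x z y hadj p ih =>
      refine fun h => ih ?_
      rcases h with h | ⟨v, hv, hvx⟩
      · exact Or.inr ⟨x, h, hadj⟩
      · by_contra hz
        push Not at hz
        exact hc z x v w ⟨hadj.symm, hvx, hv, hz.1⟩
  obtain ⟨p⟩ := hX.connected.preconnected w b'
  rcases hwalk w b' p (Or.inr ⟨b, hw, hw⟩) with h | ⟨v, hv, hvb⟩
  · exact hw' h
  · have h₁ := hX.adj hw
    have h₂ := hX.adj hv
    have h₃ := hX.adj hvb
    tauto

end Existence

section Tensor

variable {V : Type*} [Fintype V] {H : SimpleGraph V} {u w₀ v w : V}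

/-- Sums of products of linear forms in the pairs `(M(u, x), M(v, x))` are expressible, as the
coefficients are a function of two-valued variables. -/
theorem InducedPath.expressible_sum_prod (h : InducedPath H u w₀ v w) {p N : ℕ}
    {M : Fin N → V → V → ℤ} (hM : ∀ j, Expressible₂ H (M j)) {α : Type*} (T : Finset α)
    (r : α → ℤ) (c : α → Fin p → Fin N → Bool → ℤ) :
    Expressible H (fun x : Fin p → V => ∑ a ∈ T, r a * ∏ i, ∏ j,
      ∑ b, c a i j b * M j (truthVertex u v b) (x i)) := by
  classical
  set C : (Fin p × Fin N → Bool) → ℤ := fun β => ∑ a ∈ T, r a * ∏ k, c a k.1 k.2 (β k) with hC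
  have h₁ : Expressible H (fun x : Fin p → V => ∑ z : Fin p × Fin N → V, twoValued u v C z *
      ∏ k, M k.2 (z k) (x k.1)) :=
    Expressible.sum_pi (((h.all C).reindex Sum.inr).mul (Expressible.prod _ fun k _ =>
      (hM k.2).apply (Sum.inr k) (Sum.inl k.1)))
  convert h₁ using 2 with x
  have h₂ : ∑ z : Fin p × Fin N → V, twoValued u v C z * ∏ k, M k.2 (z k) (x k.1) =
      ∑ β : Fin p × Fin N → Bool, C β * ∏ k, M k.2 (truthVertex u v (β k)) (x k.1) := by
    symm
    refine Fintype.sum_of_injective (fun (β : Fin p × Fin N → Bool) k => truthVertex u v (β k))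
      (fun τ τ' h' => funext fun i => truthVertex_injective h.ne (congrFun h' i)) _ _ ?_ ?_
    · intro z hz
      rw [twoValued, if_neg, zero_mul]
      intro h'
      obtain ⟨τ, rfl⟩ := exists_truthVertex h'
      exact hz ⟨τ, rfl⟩
    · intro β
      dsimp only
      rw [twoValued_truthVertex h.ne]
  rw [h₂]
  simp only [hC, Finset.sum_mul, mul_assoc]
  rw [Finset.sum_comm]
  refine Finset.sum_congr rfl fun a _ => ?_
  rw [← Finset.mul_sum]
  congr 1
  rw [← Fintype.prod_prod_type' (f := fun i j => ∑ b, c a i j b * M j (truthVertex u v b) (x i)),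
    Finset.prod_univ_sum, Fintype.piFinset_univ]
  refine Finset.sum_congr rfl fun β _ => ?_
  rw [← Finset.prod_mul_distrib]

end Tensor

/-- A positive multiple of the indicator function of any relation over an irredundant set `S` is
expressible. For `b ≠ b'` in `S` some linear form in `(M(u, x), M(v, x))` vanishes at `x = b'`
but not at `x = b`; products of such forms single out a tuple. -/
theorem InducedPath.exists_expressible_indicator {V : Type*} [Fintype V] {H : SimpleGraph V}
    {u w₀ v w : V} (h : InducedPath H u w₀ v w) {X : Set V} (hX : IsSide H X) {S : Set V}
    (hSX : S ⊆ X) (hS : Irredundant H S) {p : ℕ} {R : Set (Fin p → V)} [DecidablePred (· ∈ R)]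
    (hR : ∀ f ∈ R, ∀ i, f i ∈ S) :
    ∃ d : ℕ, 0 < d ∧ Expressible H (fun x : Fin p → V => if x ∈ R then (d : ℤ) else 0) := by
  classical
  let e := Fintype.equivFin {q : V × V // q.1 ∈ S ∧ q.2 ∈ S ∧ q.1 ≠ q.2}
  set N := Fintype.card {q : V × V // q.1 ∈ S ∧ q.2 ∈ S ∧ q.1 ≠ q.2} with hN
  let pr : Fin N → V × V := fun j => (e.symm j).1
  have hpr : ∀ j, (pr j).1 ∈ S ∧ (pr j).2 ∈ S ∧ (pr j).1 ≠ (pr j).2 := fun j => (e.symm j).2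
  have hsurj : ∀ b ∈ S, ∀ b' ∈ S, b ≠ b' → ∃ j, pr j = (b, b') := fun b hb b' hb' hne =>
    ⟨e ⟨(b, b'), hb, hb', hne⟩, by simp [pr]⟩
  have hM : ∀ j, ∃ M, Expressible₂ H M ∧
      M u (pr j).1 * M v (pr j).2 ≠ M u (pr j).2 * M v (pr j).1 ∧
      ∀ t ∈ S, M u t ≠ 0 ∨ M v t ≠ 0 := fun j => by
    obtain ⟨h₁, h₂, h₃⟩ := hpr j
    have hside : (pr j).1 ∈ X ↔ (pr j).2 ∈ X := iff_of_true (hSX h₁) (hSX h₂)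
    have hne := hS _ h₁ _ h₂ h₃
    obtain ⟨M, hM, hd, hz, -⟩ := (h.linked_of_ne hX hside hne).exists_nonvanishing hX hne
    exact ⟨M, hM, hd, fun t ht => hz t (iff_of_true (hSX h₁) (hSX ht))⟩
  choose M hME hMd hMz using hM
  -- the coefficients of the form belonging to the pair `j` that does not vanish at `a`
  let c : V → Fin N → Bool → ℤ := fun a j b =>
    if (pr j).1 = a then (if b then - M j u (pr j).2 else M j v (pr j).2)
    else if M j u a ≠ 0 then (if b then 0 else 1) else (if b then 1 else 0)
  let L : V → Fin N → V → ℤ := fun a j t => ∑ b, c a j b * M j (truthVertex u v b) t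
  have hL : ∀ a j t, L a j t = c a j true * M j v t + c a j false * M j u t := fun a j t => by
    simp [L, truthVertex]
  have hL₁ : ∀ a ∈ S, ∀ j, L a j a ≠ 0 := by
    intro a ha j
    rw [hL]
    by_cases h₁ : (pr j).1 = a
    · simp only [c, if_pos h₁]
      intro h₂
      apply hMd j
      rw [h₁]
      simp at h₂
      linear_combination h₂
    · by_cases h₂ : M j u a ≠ 0
      · simp [c, if_neg h₁, h₂]
      · have := (hMz j a ha).resolve_left h₂
        rw [not_not] at h₂
        simpa [c, if_neg h₁, h₂] using this
  have hL₂ : ∀ a ∈ S, ∀ t ∈ S, a ≠ t → ∃ j, L a j t = 0 := by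
    intro a ha t ht hat
    obtain ⟨j, hj⟩ := hsurj a ha t ht hat
    refine ⟨j, ?_⟩
    rw [hL]
    simp [c, hj]
    ring
  let W : (Fin p → V) → (Fin p → V) → ℤ := fun a x => ∏ i, ∏ j, L (a i) j (x i)
  have hW₁ : ∀ a, (∀ i, a i ∈ S) → W a a ≠ 0 := fun a ha =>
    Finset.prod_ne_zero_iff.2 fun i _ => Finset.prod_ne_zero_iff.2 fun j _ => hL₁ _ (ha i) j
  have hW₂ : ∀ a x, (∀ i, a i ∈ S) → (∀ i, x i ∈ S) → a ≠ x → W a x = 0 := by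
    intro a x ha hx hax
    obtain ⟨i, hi⟩ := Function.ne_iff.1 hax
    obtain ⟨j, hj⟩ := hL₂ _ (ha i) _ (hx i) hi
    exact Finset.prod_eq_zero (Finset.mem_univ i) (Finset.prod_eq_zero (Finset.mem_univ j) hj)
  let T : Finset (Fin p → V) := Finset.univ.filter (· ∈ R)
  have hT : ∀ a, a ∈ T ↔ a ∈ R := fun a => by simp [T]
  set F : (Fin p → V) → ℤ := fun x => ∑ a ∈ T, (∏ a' ∈ T.erase a, W a' a') * W a x with hF
  have hFE : Expressible H F := h.expressible_sum_prod hME T _ fun a i j b => c (a i) j b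
  set d : ℤ := ∏ a ∈ T, W a a with hd
  have hF₁ : ∀ x, (∀ i, x i ∈ S) → F x = if x ∈ R then d else 0 := by
    intro x hx
    by_cases hxR : x ∈ R
    · rw [if_pos hxR, hF]
      dsimp only
      rw [Finset.sum_eq_single_of_mem x ((hT x).2 hxR), Finset.prod_erase_mul _ _ ((hT x).2 hxR)]
      intro a ha hax
      rw [hW₂ a x (hR a ((hT a).1 ha)) hx hax, mul_zero]
    · rw [if_neg hxR]
      refine Finset.sum_eq_zero fun a ha => ?_
      rw [hW₂ a x (hR a ((hT a).1 ha)) hx, mul_zero]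
      rintro rfl
      exact hxR ((hT a).1 ha)
  have hd₀ : d ≠ 0 := Finset.prod_ne_zero_iff.2 fun a ha => hW₁ a (hR a ((hT a).1 ha))
  refine ⟨(d * d).natAbs, by simpa [Int.natAbs_pos] using hd₀, ?_⟩
  have hlists := Expressible.prod (H := H) (Finset.univ : Finset (Fin p)) fun i _ =>
    Expressible.mem (H := H) i S.toFinset
  convert hlists.mul (hFE.mul hFE) using 2 with x
  rw [Int.natCast_natAbs, abs_mul_self, Finset.prod_boole]
  have hl : (∀ i ∈ Finset.univ, x i ∈ S.toFinset) ↔ ∀ i, x i ∈ S := by simp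
  by_cases hx : ∀ i, x i ∈ S
  · rw [if_pos (hl.2 hx), hF₁ x hx]
    split_ifs <;> simp
  · rw [if_neg (fun h' => hx (hl.1 h')), zero_mul, if_neg (fun h' => hx (hR x h'))]

/-! ### Replacing facts by gadgets -/

theorem sum_subtype_eq_sum_ite {α M : Type*} [Fintype α] [AddCommMonoid M] (p : α → Prop)
    [DecidablePred p] [Fintype {a // p a}] (f : α → M) :
    ∑ x : {a // p a}, f x = ∑ a, if p a then f a else 0 := by
  rw [← Finset.sum_filter, Finset.sum_subtype (p := p) (Finset.univ.filter p) (by simp)]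

theorem natCard_subtype_eq_sum_ite {α : Type*} [Fintype α] (p : α → Prop) [DecidablePred p] :
    Nat.card {a // p a} = ∑ a, if p a then 1 else 0 := by
  rw [Nat.card_eq_fintype_card, Fintype.card_subtype, Finset.card_filter]

namespace Gadget

variable {V : Type*} {p q : ℕ}

/-- The variables added by one copy of a gadget whose weights are realized by `K` pendants each:
the internal variables and the pendants. -/
abbrev Fresh (D : Gadget V (Fin p) (Fin q)) (K : ℕ) : Type :=
  Fin q ⊕ (Fin D.wts.length × Fin K)

/-- The universe after adding `m` copies of the gadget to `n` elements. -/
abbrev Univ (D : Gadget V (Fin p) (Fin q)) (n m K : ℕ) : Type := Fin n ⊕ (Fin m × D.Fresh K)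

variable (D : Gadget V (Fin p) (Fin q)) {n m K : ℕ} (t : Fin m → Fin p → Fin n)

/-- The place of a variable of the gadget in its copy with number `j`, which is attached to the
elements of the tuple `t j`. -/
def place (K : ℕ) (j : Fin m) : Fin p ⊕ Fin q → D.Univ n m K :=
  Sum.elim (fun i => Sum.inl (t j i)) (fun a => Sum.inr (j, Sum.inl a))

/-- The pendant with number `k` for the weight with number `b`. -/
def pendant (n : ℕ) (j : Fin m) (b : Fin D.wts.length) (k : Fin K) : D.Univ n m K :=
  Sum.inr (j, Sum.inr (b, k))

/-- The facts about a pendant. -/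
def pendantFacts (j : Fin m) (b : Fin D.wts.length) (k : Fin K) :
    List (ListFact V (D.Univ n m K)) :=
  [edgeFact (D.place t K j (D.wts.get b).1) (D.pendant n j b k),
    listFact (D.pendant n j b k) (D.wts.get b).2]

/-- The facts of one copy of the gadget. -/
def copyFacts (K : ℕ) (j : Fin m) : List (ListFact V (D.Univ n m K)) :=
  D.facts.map (ListFact.map (D.place t K j)) ++ (List.finRange K).flatMap fun k =>
    (List.finRange D.wts.length).flatMap fun b => D.pendantFacts t j b k

/-- All facts, after adding the copies of the gadget to a list of facts. -/
def expandFacts (K : ℕ) (base : List (ListFact V (Fin n))) : List (ListFact V (D.Univ n m K)) :=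
  base.map (ListFact.map Sum.inl) ++ (List.finRange m).flatMap (D.copyFacts t K)

variable (H : SimpleGraph V)

/-- An assignment of the fresh variables that extends the assignment `x` of the portals. -/
def Extends (K : ℕ) (x : Fin p → V) (e : D.Fresh K → V) : Prop :=
  (∀ f ∈ D.facts, f.Holds H (Sum.elim x (e ∘ Sum.inl))) ∧
    ∀ b k, H.Adj (Sum.elim x (e ∘ Sum.inl) (D.wts.get b).1) (e (Sum.inr (b, k))) ∧
      e (Sum.inr (b, k)) ∈ (D.wts.get b).2.1

theorem holds_copyFacts (K : ℕ) (j : Fin m) (g : D.Univ n m K → V) :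
    (∀ f ∈ D.copyFacts t K j, f.Holds H g) ↔
      D.Extends H K (fun i => g (Sum.inl (t j i))) (fun c => g (Sum.inr (j, c))) := by
  have hplace : g ∘ D.place t K j = Sum.elim (fun i => g (Sum.inl (t j i)))
      ((fun c : D.Fresh K => g (Sum.inr (j, c))) ∘ Sum.inl) := by
    ext a
    cases a <;> rfl
  have hplace' : ∀ a, g (D.place t K j a) = Sum.elim (fun i => g (Sum.inl (t j i)))
      ((fun c : D.Fresh K => g (Sum.inr (j, c))) ∘ Sum.inl) a := congrFun hplace
  rw [copyFacts, List.forall_mem_append, List.forall_mem_map, Extends]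
  simp only [ListFact.holds_map, hplace]
  refine and_congr_right fun _ => ?_
  simp only [List.mem_flatMap, List.mem_finRange, true_and, pendantFacts, List.mem_cons,
    List.not_mem_nil, or_false]
  constructor
  · intro h b k
    have h₁ := h _ ⟨k, b, Or.inl rfl⟩
    have h₂ := h _ ⟨k, b, Or.inr rfl⟩
    rw [holds_edgeFact, hplace'] at h₁
    rw [holds_listFact] at h₂
    exact ⟨h₁, h₂⟩
  · rintro h f ⟨k, b, rfl | rfl⟩
    · rw [holds_edgeFact, hplace']
      exact (h b k).1
    · rw [holds_listFact]
      exact (h b k).2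

theorem holds_expandFacts (base : List (ListFact V (Fin n))) (g : D.Univ n m K → V) :
    (∀ f ∈ D.expandFacts t K base, f.Holds H g) ↔ (∀ f ∈ base, f.Holds H (g ∘ Sum.inl)) ∧
      ∀ j, D.Extends H K (fun i => g (Sum.inl (t j i))) (fun c => g (Sum.inr (j, c))) := by
  rw [expandFacts, List.forall_mem_append, List.forall_mem_map]
  simp only [ListFact.holds_map, ← D.holds_copyFacts t H]
  refine and_congr_right fun _ => ?_
  simp only [List.mem_flatMap, List.mem_finRange, true_and]
  exact ⟨fun h j f hf => h f ⟨j, hf⟩, fun h f ⟨j, hf⟩ => h j f hf⟩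

variable [Fintype V]

open Classical in
theorem card_expandFacts (base : List (ListFact V (Fin n))) :
    Nat.card {g : D.Univ n m K → V // ∀ f ∈ D.expandFacts t K base, f.Holds H g} =
      ∑ h : Fin n → V, if ∀ f ∈ base, f.Holds H h then
        ∏ j, Nat.card {e : D.Fresh K → V // D.Extends H K (fun i => h (t j i)) e} else 0 := by
  have e : {g : D.Univ n m K → V // ∀ f ∈ D.expandFacts t K base, f.Holds H g} ≃
      Σ h : {h : Fin n → V // ∀ f ∈ base, f.Holds H h},
        (j : Fin m) → {e : D.Fresh K → V // D.Extends H K (fun i => h.1 (t j i)) e} :=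
    { toFun := fun g => ⟨⟨g.1 ∘ Sum.inl, ((D.holds_expandFacts t H base g.1).1 g.2).1⟩,
        fun j => ⟨fun c => g.1 (Sum.inr (j, c)), ((D.holds_expandFacts t H base g.1).1 g.2).2 j⟩⟩
      invFun := fun y => ⟨Sum.elim y.1.1 (fun c => (y.2 c.1).1 c.2),
        (D.holds_expandFacts t H base _).2 ⟨y.1.2, fun j => (y.2 j).2⟩⟩
      left_inv := fun g => by
        ext c
        rcases c with c | c <;> rfl
      right_inv := fun y => rfl }
  rw [Nat.card_congr e, Nat.card_sigma]
  simp only [Nat.card_pi]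
  exact sum_subtype_eq_sum_ite (fun h : Fin n → V => ∀ f ∈ base, f.Holds H h)
    (fun h => ∏ j, Nat.card {e : D.Fresh K → V // D.Extends H K (fun i => h (t j i)) e})

open Classical in
theorem card_extends (K : ℕ) (x : Fin p → V) :
    Nat.card {e : D.Fresh K → V // D.Extends H K x e} =
      ∑ i : Fin q → V, if ∀ f ∈ D.facts, f.Holds H (Sum.elim x i) then
        (D.wts.map fun e => nbrCount H (Sum.elim x i e.1) e.2.1 ^ K).prod else 0 := by
  have e : {e : D.Fresh K → V // D.Extends H K x e} ≃
      Σ i : {i : Fin q → V // ∀ f ∈ D.facts, f.Holds H (Sum.elim x i)},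
        (c : Fin D.wts.length × Fin K) → {y : V // H.Adj (Sum.elim x i.1 (D.wts.get c.1).1) y ∧
          y ∈ (D.wts.get c.1).2.1} :=
    { toFun := fun e => ⟨⟨e.1 ∘ Sum.inl, e.2.1⟩, fun c => ⟨e.1 (Sum.inr c), e.2.2 c.1 c.2⟩⟩
      invFun := fun y => ⟨Sum.elim y.1.1 (fun c => (y.2 c).1),
        y.1.2, fun b k => (y.2 (b, k)).2⟩
      left_inv := fun g => by
        ext c
        rcases c with c | c <;> rfl
      right_inv := fun y => rfl }
  have hcard : ∀ v (Q : Finset V), Nat.card {y : V // H.Adj v y ∧ y ∈ Q} = nbrCount H v Q := by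
    intro v Q
    rw [nbrCount, Nat.card_eq_fintype_card, Fintype.card_subtype]
    congr 1
    ext y
    simp [and_comm]
  rw [Nat.card_congr e, Nat.card_sigma]
  simp only [Nat.card_pi, hcard]
  rw [← sum_subtype_eq_sum_ite (fun i : Fin q → V => ∀ f ∈ D.facts, f.Holds H (Sum.elim x i))
    (fun i => (D.wts.map fun e => nbrCount H (Sum.elim x i e.1) e.2.1 ^ K).prod)]
  refine Finset.sum_congr rfl fun i _ => ?_
  rw [Fintype.prod_prod_type, ← Fin.prod_univ_fun_getElem]
  refine Finset.prod_congr rfl fun b _ => ?_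
  simp

theorem pow_modEq_residue {c K : ℕ} (hc : c ≤ 2) (hK : K ≠ 0) :
    (c : ℤ) ^ K ≡ residue c [ZMOD 2 ^ K + 1] := by
  interval_cases c
  · simp [residue, hK]
  · simp [residue]
  · refine (Int.modEq_iff_dvd.2 ?_)
    exact ⟨-1, by simp [residue]; ring⟩

/-- Modulo `2 ^ K + 1`, the number of extensions is the signed number of extensions. -/
theorem card_extends_modEq (hK : K ≠ 0) (x : Fin p → V) :
    (Nat.card {e : D.Fresh K → V // D.Extends H K x e} : ℤ) ≡ D.val H x [ZMOD 2 ^ K + 1] := by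
  classical
  have hprod : ∀ (l : List ((Fin p ⊕ Fin q) × {L : Finset V // L.Nonempty})),
      (∀ e ∈ l, e.2.1.card ≤ 2) → ∀ g : Fin p ⊕ Fin q → V,
      (((l.map fun e => nbrCount H (g e.1) e.2.1 ^ K).prod : ℕ) : ℤ) ≡
        (l.map fun e => residue (nbrCount H (g e.1) e.2.1)).prod [ZMOD 2 ^ K + 1] := by
    intro l hl g
    induction l with
    | nil => exact Int.ModEq.refl _
    | cons e l ih =>
      rw [List.map_cons, List.prod_cons, List.map_cons, List.prod_cons, Nat.cast_mul, Nat.cast_pow]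
      refine (pow_modEq_residue ?_ hK).mul (ih fun e he => hl e (List.mem_cons_of_mem _ he))
      exact (Finset.card_filter_le _ _).trans (hl e List.mem_cons_self)
  rw [card_extends, val, Nat.cast_sum]
  refine Int.ModEq.sum fun i _ => ?_
  rw [eval]
  by_cases h : ∀ f ∈ D.facts, f.Holds H (Sum.elim x i)
  · rw [if_pos h, if_pos h]
    exact hprod _ D.card_le _
  · rw [if_neg h, if_neg h]
    exact Int.ModEq.refl _

/-- If the gadget expresses a multiple of the indicator function of `R`, then the number of
homomorphisms after adding the gadgets determines, modulo `2 ^ K + 1`, the number of those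
homomorphisms before that map the tuples `t j` into `R`. -/
theorem card_expandFacts_modEq (hK : K ≠ 0) {R : Set (Fin p → V)} [DecidablePred (· ∈ R)] {d : ℕ}
    (hD : ∀ x, D.val H x = if x ∈ R then (d : ℤ) else 0) (base : List (ListFact V (Fin n))) :
    Nat.card {g : D.Univ n m K → V // ∀ f ∈ D.expandFacts t K base, f.Holds H g} ≡
      d ^ m * Nat.card {h : Fin n → V // (∀ f ∈ base, f.Holds H h) ∧ ∀ j, (fun i => h (t j i)) ∈ R}
      [MOD 2 ^ K + 1] := by
  classical
  have hcard : Nat.card {h : Fin n → V // (∀ f ∈ base, f.Holds H h) ∧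
      ∀ j, (fun i => h (t j i)) ∈ R} = ∑ h : Fin n → V, if (∀ f ∈ base, f.Holds H h) ∧
      ∀ j, (fun i => h (t j i)) ∈ R then 1 else 0 := natCard_subtype_eq_sum_ite _
  rw [← Int.natCast_modEq_iff, card_expandFacts, hcard, Finset.mul_sum]
  push_cast
  refine Int.ModEq.sum fun h _ => ?_
  by_cases hb : ∀ f ∈ base, f.Holds H h
  · rw [if_pos hb]
    have h₁ := Int.ModEq.prod (s := (Finset.univ : Finset (Fin m)))
      fun j _ => D.card_extends_modEq H hK (fun i => h (t j i))
    refine h₁.trans (congrArg (· % (2 ^ K + 1 : ℤ)) ?_)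
    simp only [hD]
    by_cases hR : ∀ j, (fun i => h (t j i)) ∈ R
    · rw [if_pos ⟨hb, hR⟩, mul_one]
      simp [hR]
    · obtain ⟨j, hj⟩ := not_forall.1 hR
      rw [Finset.prod_eq_zero (Finset.mem_univ j) (if_neg hj), if_neg (fun h' => hR h'.2), mul_zero]
  · rw [if_neg hb, if_neg (fun h' => hb h'.1)]
    simp

end Gadget

/-! ### Lists in which a property holds on a segment -/

/-- The entries of `l` with the property `P` are consecutive. -/
def Consec {α : Type*} (P : α → Prop) (l : List α) : Prop :=
  ∃ l₁ l₂ l₃, l = l₁ ++ l₂ ++ l₃ ∧ (∀ a ∈ l₁, ¬ P a) ∧ (∀ a ∈ l₂, P a) ∧ ∀ a ∈ l₃, ¬ P a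

namespace Consec

variable {α β : Type*} {P : α → Prop} {Q : β → Prop} {l : List α}

theorem get (h : Consec P l) (i j k : Fin l.length) (hij : i ≤ j) (hjk : j ≤ k)
    (hi : P (l.get i)) (hk : P (l.get k)) : P (l.get j) := by
  obtain ⟨l₁, l₂, l₃, rfl, h₁, h₂, h₃⟩ := h
  obtain ⟨i, hi'⟩ := i
  obtain ⟨j, hj'⟩ := j
  obtain ⟨k, hk'⟩ := k
  simp only [Fin.mk_le_mk, List.get_eq_getElem] at *
  have hi₁ : l₁.length ≤ i := by
    by_contra hc
    rw [List.getElem_append_left (by simp; omega), List.getElem_append_left (by omega)] at hi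
    exact h₁ _ (List.getElem_mem _) hi
  have hk₁ : k < (l₁ ++ l₂).length := by
    by_contra hc
    rw [List.getElem_append_right (by omega)] at hk
    exact h₃ _ (List.getElem_mem _) hk
  rw [List.getElem_append_left (by omega), List.getElem_append_right (by omega)]
  exact h₂ _ (List.getElem_mem _)

theorem of_get (h : ∀ i j k : Fin l.length, i ≤ j → j ≤ k → P (l.get i) → P (l.get k) →
    P (l.get j)) : Consec P l := by
  induction l with
  | nil => exact ⟨[], [], [], rfl, by simp, by simp, by simp⟩
  | cons a l ih =>
    obtain ⟨l₁, l₂, l₃, rfl, h₁, h₂, h₃⟩ := ih fun i j k hij hjk =>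
      h i.succ j.succ k.succ (Fin.succ_le_succ_iff.2 hij) (Fin.succ_le_succ_iff.2 hjk)
    by_cases ha : P a
    · cases l₁ with
      | nil => exact ⟨[], a :: l₂, l₃, rfl, by simp, by simpa [ha] using h₂, h₃⟩
      | cons b l₁ =>
        cases l₂ with
        | nil =>
          refine ⟨[], [a], b :: l₁ ++ [] ++ l₃, rfl, by simp, by simpa using ha, ?_⟩
          intro c hc
          rw [List.append_nil] at hc
          rcases List.mem_append.1 hc with hc | hc
          · exact h₁ c hc
          · exact h₃ c hc
        | cons c l₂ =>
          exfalso
          refine h₁ b List.mem_cons_self (h ⟨0, by simp⟩ ⟨1, by simp⟩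
            ⟨l₁.length + 2, by simp⟩ (Fin.mk_le_mk.2 (by omega)) (Fin.mk_le_mk.2 (by omega)) ha ?_)
          have : (a :: (b :: l₁ ++ c :: l₂ ++ l₃)).get ⟨l₁.length + 2, by simp⟩ = c := by
            simp
          rw [this]
          exact h₂ c List.mem_cons_self
    · exact ⟨a :: l₁, l₂, l₃, rfl, by simpa [ha] using h₁, h₂, h₃⟩

theorem of_forall (h : ∀ a ∈ l, P a) : Consec P l :=
  ⟨[], l, [], by simp, by simp, h, by simp⟩

theorem append (h : Consec P l) {l₀ l₄ : List α} (h₀ : ∀ a ∈ l₀, ¬ P a) (h₄ : ∀ a ∈ l₄, ¬ P a) :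
    Consec P (l₀ ++ l ++ l₄) := by
  obtain ⟨l₁, l₂, l₃, rfl, h₁, h₂, h₃⟩ := h
  refine ⟨l₀ ++ l₁, l₂, l₃ ++ l₄, by simp, ?_, h₂, ?_⟩
  · exact List.forall_mem_append.2 ⟨h₀, h₁⟩
  · exact List.forall_mem_append.2 ⟨h₃, h₄⟩

theorem cons (h : Consec P l) {a : α} (ha : ¬ P a) : Consec P (a :: l) := by
  simpa using h.append (l₀ := [a]) (l₄ := []) (by simpa using ha) (by simp)

theorem of_map {f : α → β} (h : Consec Q (l.map f)) : Consec (fun a => Q (f a)) l := by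
  obtain ⟨l₁, l₂, l₃, he, h₁, h₂, h₃⟩ := h
  obtain ⟨m, m₃, rfl, hm, rfl⟩ := List.map_eq_append_iff.1 he
  obtain ⟨m₁, m₂, rfl, rfl, rfl⟩ := List.map_eq_append_iff.1 hm
  exact ⟨m₁, m₂, m₃, rfl, fun a ha => h₁ _ (List.mem_map_of_mem ha),
    fun a ha => h₂ _ (List.mem_map_of_mem ha), fun a ha => h₃ _ (List.mem_map_of_mem ha)⟩

theorem map {f : α → β} (h : Consec (fun a => Q (f a)) l) : Consec Q (l.map f) := by
  obtain ⟨l₁, l₂, l₃, rfl, h₁, h₂, h₃⟩ := h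
  exact ⟨l₁.map f, l₂.map f, l₃.map f, by simp, List.forall_mem_map.2 h₁,
    List.forall_mem_map.2 h₂, List.forall_mem_map.2 h₃⟩

/-- Replacing the entries with the property `P` by lists of entries with the property `Q`, and the
others by lists of entries without it. -/
theorem flatMap (h : Consec P l) {g : α → List β} (h₁ : ∀ a, P a → ∀ b ∈ g a, Q b)
    (h₂ : ∀ a, ¬ P a → ∀ b ∈ g a, ¬ Q b) : Consec Q (l.flatMap g) := by
  obtain ⟨l₁, l₂, l₃, rfl, k₁, k₂, k₃⟩ := h
  refine ⟨l₁.flatMap g, l₂.flatMap g, l₃.flatMap g, by simp, ?_, ?_, ?_⟩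
  · intro b hb
    obtain ⟨a, ha, hab⟩ := List.mem_flatMap.1 hb
    exact h₂ a (k₁ a ha) b hab
  · intro b hb
    obtain ⟨a, ha, hab⟩ := List.mem_flatMap.1 hb
    exact h₁ a (k₂ a ha) b hab
  · intro b hb
    obtain ⟨a, ha, hab⟩ := List.mem_flatMap.1 hb
    exact h₂ a (k₃ a ha) b hab

/-- Only one entry is replaced by a list in which `Q` occurs. -/
theorem flatMap_of_unique {g : α → List β} {l₁ l₃ : List α} {a : α} (h : Consec Q (g a))
    (h₁ : ∀ c ∈ l₁ ++ l₃, ∀ b ∈ g c, ¬ Q b) : Consec Q ((l₁ ++ a :: l₃).flatMap g) := by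
  have := h.append (l₀ := l₁.flatMap g) (l₄ := l₃.flatMap g)
    (fun b hb => by
      obtain ⟨c, hc, hcb⟩ := List.mem_flatMap.1 hb
      exact h₁ c (List.mem_append_left _ hc) b hcb)
    (fun b hb => by
      obtain ⟨c, hc, hcb⟩ := List.mem_flatMap.1 hb
      exact h₁ c (List.mem_append_right _ hc) b hcb)
  simpa using this

theorem flatMap_finRange {m : ℕ} {g : Fin m → List β} (j : Fin m) (h : Consec Q (g j))
    (h₁ : ∀ i, i ≠ j → ∀ b ∈ g i, ¬ Q b) : Consec Q ((List.finRange m).flatMap g) := by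
  obtain ⟨l₁, l₃, hl⟩ := List.append_of_mem (List.mem_finRange j)
  rw [hl]
  refine h.flatMap_of_unique fun c hc => h₁ c ?_
  have hnd := List.nodup_finRange m
  rw [hl] at hnd
  rintro rfl
  rw [List.nodup_middle, List.nodup_cons] at hnd
  exact hnd.1 hc

end Consec

theorem List.map_snd_withPrev {α : Type} (a : α) (l : List α) :
    (l.withPrev a).map Prod.snd = l := by
  induction l generalizing a with
  | nil => rfl
  | cons b l ih => rw [List.withPrev, List.map_cons, ih]

/-- A segment is entered exactly once. -/
theorem Consec.exists_withPrev {α : Type} {P : α → Prop} {l : List α} (h : Consec P l)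
    (hne : ∃ a ∈ l, P a) {a₀ : α} (ha₀ : ¬ P a₀) :
    ∃ l₁ x l₃, l.withPrev a₀ = l₁ ++ x :: l₃ ∧ (P x.2 ∧ ¬ P x.1) ∧
      ∀ y ∈ l₁ ++ l₃, ¬ (P y.2 ∧ ¬ P y.1) := by
  obtain ⟨l₁, l₂, l₃, rfl, h₁, h₂, h₃⟩ := h
  have hl₂ : l₂ ≠ [] := by
    rintro rfl
    obtain ⟨a, ha, hPa⟩ := hne
    rw [List.append_nil] at ha
    rcases List.mem_append.1 ha with ha | ha
    · exact h₁ a ha hPa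
    · exact h₃ a ha hPa
  clear hne
  -- no entry into the segment after its first element
  have key : ∀ (l₂ : List α) (c : α), P c → (∀ a ∈ l₂, P a) →
      ∀ y ∈ (l₂ ++ l₃).withPrev c, ¬ (P y.2 ∧ ¬ P y.1) := by
    intro l₂
    induction l₂ with
    | nil =>
      intro c _ _ y hy hP
      have hy₂ : y.2 ∈ (l₃.withPrev c).map Prod.snd := List.mem_map_of_mem hy
      rw [List.map_snd_withPrev] at hy₂
      exact h₃ _ hy₂ hP.1
    | cons b l₂ ih =>
      intro c hc hl y hy hP
      rcases List.mem_cons.1 hy with rfl | hy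
      · exact hP.2 hc
      · exact ih b (hl b List.mem_cons_self) (fun a ha => hl a (List.mem_cons_of_mem _ ha)) y hy hP
  induction l₁ generalizing a₀ with
  | nil =>
    cases l₂ with
    | nil => exact absurd rfl hl₂
    | cons c l₂ =>
      exact ⟨[], (a₀, c), (l₂ ++ l₃).withPrev c, rfl, ⟨h₂ c List.mem_cons_self, ha₀⟩,
        key l₂ c (h₂ c List.mem_cons_self) fun a ha => h₂ a (List.mem_cons_of_mem _ ha)⟩
  | cons b l₁ ih =>
    have hb := h₁ b List.mem_cons_self
    obtain ⟨k₁, x, k₃, hk, hx, hk'⟩ := ih hb fun a ha => h₁ a (List.mem_cons_of_mem _ ha)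
    refine ⟨(a₀, b) :: k₁, x, k₃, ?_, hx, ?_⟩
    · rw [List.cons_append, List.cons_append, List.withPrev, hk, List.cons_append]
    · intro y hy
      rcases List.mem_cons.1 hy with rfl | hy
      · exact fun hP => hb hP.1
      · exact hk' y hy

/-- Helly's theorem for the segments of a path decomposition: a tuple of a relation lies within
one bag. -/
theorem PathInstance.exists_bag {σ : Type*} {ar : σ → ℕ} (I : PathInstance ar) (s : σ)
    {x : Fin (ar s) → Fin I.n} (hx : x ∈ I.str s) (hs : 0 < ar s) :
    ∃ B ∈ I.bags, ∀ i, x i ∈ B := by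
  classical
  have hpd := I.isPathDecomposition
  have hex : ∀ u, ∃ a : ℕ, ∃ h : a < I.bags.length, u ∈ I.bags[a] := fun u => by
    obtain ⟨B, hB, hu⟩ := hpd.vertex u
    obtain ⟨a, ha, rfl⟩ := List.mem_iff_getElem.1 hB
    exact ⟨a, ha, hu⟩
  -- the last one of the first bags of the entries
  have : Nonempty (Fin (ar s)) := ⟨⟨0, hs⟩⟩
  obtain ⟨i₀, hi₀⟩ := Finite.exists_max (fun i => Nat.find (hex (x i)))
  obtain ⟨hlt, hmem⟩ := Nat.find_spec (hex (x i₀))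
  refine ⟨_, List.getElem_mem hlt, fun i => ?_⟩
  obtain ⟨hlt', hmem'⟩ := Nat.find_spec (hex (x i))
  obtain ⟨b, hb, hbi, hbi₀⟩ : ∃ b, ∃ h : b < I.bags.length, x i ∈ I.bags[b] ∧
      x i₀ ∈ I.bags[b] := by
    by_cases he : x i = x i₀
    · exact ⟨_, hlt', hmem', he ▸ hmem'⟩
    · obtain ⟨B, hB, h₁, h₂⟩ := hpd.edge (x i) (x i₀) ⟨he, s, x, hx, ⟨i, rfl⟩, ⟨i₀, rfl⟩⟩
      obtain ⟨a, ha, rfl⟩ := List.mem_iff_getElem.1 hB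
      exact ⟨a, ha, h₁, h₂⟩
  have hle := Nat.find_min' (hex (x i₀)) ⟨hb, hbi₀⟩
  exact hpd.consecutive ⟨_, hlt'⟩ ⟨_, hlt⟩ ⟨b, hb⟩ (hi₀ i) hle _ hmem' hbi

/-! ### The path decomposition after replacing facts by gadgets -/

open Classical in
/-- An instance given by lists of facts and bags over any type `U` with `n` elements. -/
noncomputable def PathInstance.ofLists {V : Type*} {U : Type} {n : ℕ} (e : U ≃ Fin n)
    (facts : List (ListFact V U)) (bags : List (List U)) (hv : ∀ u, ∃ B ∈ bags, u ∈ B)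
    (hf : ∀ f ∈ facts, ∃ B ∈ bags, ∀ i, f.2 i ∈ B) (hc : ∀ u, Consec (fun B => u ∈ B) bags) :
    PathInstance (symArity V) where
  n := n
  str := fun s => {x | ⟨s, x⟩ ∈ facts.map (ListFact.map e)}
  bags := (bags.map (List.map e)).map List.toFinset
  isPathDecomposition := by
    have hmem : ∀ (u : U) (B : List U), e u ∈ (B.map e).toFinset ↔ u ∈ B := fun u B => by simp
    refine ⟨fun v => ?_, fun u v huv => ?_, fun i j k hij hjk v hi hk => ?_⟩
    · obtain ⟨u, rfl⟩ := e.surjective v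
      obtain ⟨B, hB, hu⟩ := hv u
      exact ⟨_, List.mem_map_of_mem (List.mem_map_of_mem hB), (hmem u B).2 hu⟩
    · obtain ⟨-, s, x, hx, ⟨i, rfl⟩, ⟨j, rfl⟩⟩ := huv
      obtain ⟨f, hf', hfx⟩ := List.mem_map.1 hx
      obtain ⟨B, hB, hB'⟩ := hf f hf'
      obtain ⟨s', y⟩ := f
      obtain ⟨rfl, hxy⟩ := Sigma.mk.inj_iff.1 hfx
      obtain rfl := eq_of_heq hxy
      exact ⟨_, List.mem_map_of_mem (List.mem_map_of_mem hB), (hmem _ B).2 (hB' i),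
        (hmem _ B).2 (hB' j)⟩
    · obtain ⟨u, rfl⟩ := e.surjective v
      have h₁ : Consec (fun B : Finset (Fin n) => e u ∈ B)
          ((bags.map (List.map e)).map List.toFinset) := by
        refine Consec.map (Consec.map ?_)
        simpa only [hmem] using hc u
      exact h₁.get i j k hij hjk hi hk

namespace PathInstance

variable {V : Type*} {U : Type} {n : ℕ} (e : U ≃ Fin n) {facts : List (ListFact V U)}
  {bags : List (List U)} (hv : ∀ u, ∃ B ∈ bags, u ∈ B)
  (hf : ∀ f ∈ facts, ∃ B ∈ bags, ∀ i, f.2 i ∈ B) (hc : ∀ u, Consec (fun B => u ∈ B) bags)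

theorem homCount_ofLists (H : SimpleGraph V) :
    (ofLists e facts bags hv hf hc).str.homCount (RelStr.ofGraph H).plus =
      Nat.card {g : U → V // ∀ f ∈ facts, f.Holds H g} := by
  refine Nat.card_congr ((e.arrowCongr (Equiv.refl V)).subtypeEquiv fun g => ?_).symm
  constructor
  · rintro h s x hx
    obtain ⟨f, hf, hfx⟩ := List.mem_map.1 hx
    obtain ⟨s', y⟩ := f
    obtain ⟨rfl, hxy⟩ := Sigma.mk.inj_iff.1 hfx
    obtain rfl := eq_of_heq hxy
    have := h _ hf
    simpa [ListFact.Holds, Equiv.arrowCongr] using this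
  · intro h f hf
    have := h f.1 (e ∘ f.2) (List.mem_map.2 ⟨f, hf, rfl⟩)
    change (fun i => g (e.symm (e (f.2 i)))) ∈ _ at this
    simpa only [ListFact.Holds, Equiv.symm_apply_apply] using this

theorem encodes_ofLists [Fintype (ListSymbol V)] :
    (ofLists e facts bags hv hf hc).Encodes (Val.pair (Val.nat n)
      (Val.pair (Val.ofList ((facts.map (ListFact.map e)).map encodeFact))
        (Val.ofList ((bags.map (List.map e)).map encodeBag)))) := by
  classical
  refine ⟨facts.map (ListFact.map e), bags.map (List.map e), fun s x => Iff.rfl, ?_, rfl⟩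
  change (bags.map (List.map e)).map List.toFinset = _
  congr 1

theorem widthLE_ofLists [DecidableEq U] {w : ℕ} (h : ∀ B ∈ bags, B.toFinset.card ≤ w + 1) :
    (ofLists e facts bags hv hf hc).WidthLE w := by
  intro B hB
  obtain ⟨C, hC, rfl⟩ := List.mem_map.1 hB
  obtain ⟨B', hB', rfl⟩ := List.mem_map.1 hC
  refine le_trans ?_ (h B' hB')
  rw [← Finset.card_image_of_injective B'.toFinset e.injective]
  refine (Finset.card_le_card fun u hu => ?_)
  obtain ⟨x, hx, rfl⟩ := List.mem_map.1 ((@List.mem_toFinset (Fin n) (_) _ _).1 hu)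
  exact Finset.mem_image_of_mem _ (List.mem_toFinset.2 hx)

end PathInstance

namespace Gadget

variable {V : Type*} {p q : ℕ} (D : Gadget V (Fin p) (Fin q)) {n m K : ℕ}
  (t : Fin m → Fin p → Fin n)

/-- A bag together with the internal variables of the copy with number `j`. -/
def attach (K : ℕ) (j : Fin m) (B : List (Fin n)) : List (D.Univ n m K) :=
  (List.finRange q).map (fun a => Sum.inr (j, Sum.inl a)) ++ B.map Sum.inl

/-- The bags for the copy with number `j`, to be inserted after a bag `B` that contains the tuple
`t j`: first one with all internal variables, then one for each pendant. -/
def copyBags (K : ℕ) (j : Fin m) (B : List (Fin n)) : List (List (D.Univ n m K)) :=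
  D.attach K j B :: (List.finRange K).flatMap fun k =>
    (List.finRange D.wts.length).flatMap fun b => [D.pendant n j b k :: D.attach K j B]

/-- The new bags following the bag `y.2`, where `y.1` is the bag before it: the bags of a copy are
inserted after the first bag that contains its tuple. -/
def expandBag (K : ℕ) (y : List (Fin n) × List (Fin n)) : List (List (D.Univ n m K)) :=
  y.2.map Sum.inl :: (List.finRange m).flatMap fun j =>
    if (∀ i, t j i ∈ y.2) ∧ ¬ ∀ i, t j i ∈ y.1 then D.copyBags K j y.2 else []

/-- The path decomposition after adding the copies of the gadget. -/
def expandBags (K : ℕ) (bags : List (List (Fin n))) : List (List (D.Univ n m K)) :=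
  (bags.withPrev []).flatMap (D.expandBag t K)

theorem inl_mem_attach {j : Fin m} {B : List (Fin n)} {u : Fin n} :
    (Sum.inl u : D.Univ n m K) ∈ D.attach K j B ↔ u ∈ B := by
  simp [attach]

theorem inr_inl_mem_attach {i j : Fin m} {B : List (Fin n)} {a : Fin q} :
    (Sum.inr (i, Sum.inl a) : D.Univ n m K) ∈ D.attach K j B ↔ i = j := by
  simp [attach, eq_comm]

theorem inr_inr_notMem_attach {i j : Fin m} {B : List (Fin n)} {c} :
    (Sum.inr (i, Sum.inr c) : D.Univ n m K) ∉ D.attach K j B := by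
  simp [attach]

theorem mem_copyBags {j : Fin m} {B : List (Fin n)} {C : List (D.Univ n m K)} :
    C ∈ D.copyBags K j B ↔ C = D.attach K j B ∨ ∃ k b, C = D.pendant n j b k :: D.attach K j B := by
  simp [copyBags]

theorem inl_mem_of_mem_expandBag {y : List (Fin n) × List (Fin n)} {C : List (D.Univ n m K)}
    (hC : C ∈ D.expandBag t K y) (u : Fin n) : Sum.inl u ∈ C ↔ u ∈ y.2 := by
  rcases List.mem_cons.1 hC with rfl | hC
  · simp
  · obtain ⟨j, -, hj⟩ := List.mem_flatMap.1 hC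
    split_ifs at hj with h
    · rcases D.mem_copyBags.1 hj with rfl | ⟨k, b, rfl⟩
      · exact D.inl_mem_attach
      · rw [List.mem_cons, D.inl_mem_attach]
        simp [pendant]
    · simp at hj

/-- The fresh elements of a copy occur only in the bags of this copy. -/
theorem inr_notMem_copyBags {i j : Fin m} (hij : i ≠ j) {B : List (Fin n)}
    {C : List (D.Univ n m K)} (hC : C ∈ D.copyBags K j B) (c : D.Fresh K) : Sum.inr (i, c) ∉ C := by
  have h : (Sum.inr (i, c) : D.Univ n m K) ∉ D.attach K j B := by
    rcases c with a | c
    · rw [D.inr_inl_mem_attach]; exact hij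
    · exact D.inr_inr_notMem_attach
  rcases D.mem_copyBags.1 hC with rfl | ⟨k, b, rfl⟩
  · exact h
  · rw [List.mem_cons, not_or]
    refine ⟨fun h' => hij ?_, h⟩
    simp only [pendant, Sum.inr.injEq, Prod.mk.injEq] at h'
    exact h'.1

theorem consec_copyBags (j : Fin m) (B : List (Fin n)) (c : D.Fresh K) :
    Consec (fun C => Sum.inr (j, c) ∈ C) (D.copyBags K j B) := by
  rcases c with a | ⟨b, k⟩
  · refine Consec.of_forall fun C hC => ?_
    rcases D.mem_copyBags.1 hC with rfl | ⟨k, b, rfl⟩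
    · exact D.inr_inl_mem_attach.2 rfl
    · exact List.mem_cons_of_mem _ (D.inr_inl_mem_attach.2 rfl)
  · refine Consec.cons (Consec.flatMap_finRange k (Consec.flatMap_finRange b ?_ ?_) ?_)
      D.inr_inr_notMem_attach
    · exact Consec.of_forall (by simp [pendant])
    · intro b' hb' C hC
      rw [List.mem_singleton] at hC
      rw [hC, List.mem_cons, not_or]
      refine ⟨fun h' => hb' ?_, D.inr_inr_notMem_attach⟩
      simp only [pendant, Sum.inr.injEq, Prod.mk.injEq, true_and, and_true] at h'
      exact h'.symm
    · intro k' hk' C hC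
      obtain ⟨b', -, hC⟩ := List.mem_flatMap.1 hC
      rw [List.mem_singleton] at hC
      rw [hC, List.mem_cons, not_or]
      refine ⟨fun h' => hk' ?_, D.inr_inr_notMem_attach⟩
      simp only [pendant, Sum.inr.injEq, Prod.mk.injEq, true_and] at h'
      exact h'.2.symm

variable {bags : List (List (Fin n))}

theorem map_inl_mem_expandBags {B : List (Fin n)} (hB : B ∈ bags) :
    B.map Sum.inl ∈ D.expandBags t K bags := by
  rw [← List.map_snd_withPrev [] bags] at hB
  obtain ⟨y, hy, rfl⟩ := List.mem_map.1 hB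
  exact List.mem_flatMap.2 ⟨y, hy, List.mem_cons_self⟩

/-- The tuple of a copy determines the place where its bags are inserted. -/
theorem exists_place (hc : ∀ u, Consec (fun B => u ∈ B) bags) (hp : 0 < p) {j : Fin m}
    (ht : ∃ B ∈ bags, ∀ i, t j i ∈ B) :
    ∃ l₁ y l₃, bags.withPrev [] = l₁ ++ y :: l₃ ∧
      ((∀ i, t j i ∈ y.2) ∧ ¬ ∀ i, t j i ∈ y.1) ∧
      ∀ z ∈ l₁ ++ l₃, ¬ ((∀ i, t j i ∈ z.2) ∧ ¬ ∀ i, t j i ∈ z.1) :=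
  Consec.exists_withPrev (P := fun B => ∀ i, t j i ∈ B)
    (Consec.of_get fun a b c hab hbc ha hc' i => (hc (t j i)).get a b c hab hbc (ha i) (hc' i)) ht
    (fun h => by simpa using h ⟨0, hp⟩)

theorem exists_copyBags_subset (hc : ∀ u, Consec (fun B => u ∈ B) bags) (hp : 0 < p) {j : Fin m}
    (ht : ∃ B ∈ bags, ∀ i, t j i ∈ B) :
    ∃ B, (∀ i, t j i ∈ B) ∧ ∀ C ∈ D.copyBags K j B, C ∈ D.expandBags t K bags := by
  obtain ⟨l₁, y, l₃, hl, hy, -⟩ := exists_place t hc hp ht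
  refine ⟨y.2, hy.1, fun C hC => List.mem_flatMap.2 ⟨y, by simp [hl], ?_⟩⟩
  refine List.mem_cons_of_mem _ (List.mem_flatMap.2 ⟨j, List.mem_finRange j, ?_⟩)
  rwa [if_pos hy]

theorem consec_expandBags (hc : ∀ u, Consec (fun B => u ∈ B) bags) (hp : 0 < p)
    (ht : ∀ j, ∃ B ∈ bags, ∀ i, t j i ∈ B)
    (u : D.Univ n m K) : Consec (fun C => u ∈ C) (D.expandBags t K bags) := by
  rcases u with u | ⟨j, c⟩
  · have h₁ : Consec (fun y : List (Fin n) × List (Fin n) => u ∈ y.2) (bags.withPrev []) :=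
      Consec.of_map (f := Prod.snd) (by rw [List.map_snd_withPrev]; exact hc u)
    exact h₁.flatMap (fun y hy C hC => (D.inl_mem_of_mem_expandBag t hC u).2 hy)
      (fun y hy C hC h => hy ((D.inl_mem_of_mem_expandBag t hC u).1 h))
  · obtain ⟨l₁, y, l₃, hl, hy, hy'⟩ := exists_place t hc hp (ht j)
    have hmap : ∀ B : List (Fin n), (Sum.inr (j, c) : D.Univ n m K) ∉ B.map Sum.inl := by simp
    rw [expandBags, hl]
    refine Consec.flatMap_of_unique (Consec.cons (Consec.flatMap_finRange j ?_ ?_) (hmap _)) ?_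
    · rw [if_pos hy]
      exact D.consec_copyBags j y.2 c
    · intro i hi C hC
      split_ifs at hC
      · exact D.inr_notMem_copyBags hi.symm hC c
      · simp at hC
    · intro z hz C hC
      rcases List.mem_cons.1 hC with rfl | hC
      · exact hmap _
      · obtain ⟨i, -, hC⟩ := List.mem_flatMap.1 hC
        split_ifs at hC with hif
        · refine D.inr_notMem_copyBags ?_ hC c
          rintro rfl
          exact hy' z hz hif
        · simp at hC

theorem exists_mem_expandBags (hc : ∀ u, Consec (fun B => u ∈ B) bags) (hp : 0 < p)
    (ht : ∀ j, ∃ B ∈ bags, ∀ i, t j i ∈ B)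
    (hv : ∀ u, ∃ B ∈ bags, u ∈ B) (u : D.Univ n m K) : ∃ C ∈ D.expandBags t K bags, u ∈ C := by
  rcases u with u | ⟨j, a | ⟨b, k⟩⟩
  · obtain ⟨B, hB, hu⟩ := hv u
    exact ⟨_, D.map_inl_mem_expandBags t hB, List.mem_map_of_mem hu⟩
  · obtain ⟨B, -, h⟩ := D.exists_copyBags_subset (K := K) t hc hp (ht j)
    exact ⟨_, h _ (D.mem_copyBags.2 (Or.inl rfl)), D.inr_inl_mem_attach.2 rfl⟩
  · obtain ⟨B, -, h⟩ := D.exists_copyBags_subset (K := K) t hc hp (ht j)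
    exact ⟨_, h _ (D.mem_copyBags.2 (Or.inr ⟨k, b, rfl⟩)), List.mem_cons_self⟩

theorem exists_facts_subset (hc : ∀ u, Consec (fun B => u ∈ B) bags) (hp : 0 < p)
    (ht : ∀ j, ∃ B ∈ bags, ∀ i, t j i ∈ B)
    {base : List (ListFact V (Fin n))} (hb : ∀ f ∈ base, ∃ B ∈ bags, ∀ i, f.2 i ∈ B) :
    ∀ f ∈ D.expandFacts t K base, ∃ C ∈ D.expandBags t K bags, ∀ i, f.2 i ∈ C := by
  intro f hf
  rcases List.mem_append.1 hf with hf | hf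
  · obtain ⟨f', hf', rfl⟩ := List.mem_map.1 hf
    obtain ⟨B, hB, hfB⟩ := hb f' hf'
    exact ⟨_, D.map_inl_mem_expandBags t hB, fun i => List.mem_map_of_mem (hfB i)⟩
  · obtain ⟨j, -, hf⟩ := List.mem_flatMap.1 hf
    obtain ⟨B, hB, h⟩ := D.exists_copyBags_subset (K := K) t hc hp (ht j)
    have hplace : ∀ a, D.place t K j a ∈ D.attach K j B := by
      rintro (a | a)
      · exact D.inl_mem_attach.2 (hB a)
      · exact D.inr_inl_mem_attach.2 rfl
    rcases List.mem_append.1 hf with hf | hf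
    · obtain ⟨f', hf', rfl⟩ := List.mem_map.1 hf
      exact ⟨_, h _ (D.mem_copyBags.2 (Or.inl rfl)), fun i => hplace _⟩
    · obtain ⟨k, -, hf⟩ := List.mem_flatMap.1 hf
      obtain ⟨b, -, hf⟩ := List.mem_flatMap.1 hf
      refine ⟨_, h _ (D.mem_copyBags.2 (Or.inr ⟨k, b, rfl⟩)), ?_⟩
      rcases List.mem_cons.1 hf with rfl | hf
      · intro (i : Fin 2)
        fin_cases i
        · exact List.mem_cons_of_mem _ (hplace _)
        · exact List.mem_cons_self
      · rw [List.mem_singleton] at hf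
        subst hf
        exact fun i => List.mem_cons_self

theorem card_le_of_mem_expandBags {w : ℕ} (hw : ∀ B ∈ bags, B.toFinset.card ≤ w + 1)
    {C : List (D.Univ n m K)} (hC : C ∈ D.expandBags t K bags) :
    C.toFinset.card ≤ w + (q + 1) + 1 := by
  obtain ⟨y, hy, hC⟩ := List.mem_flatMap.1 hC
  have hy₂ : y.2 ∈ bags := by
    rw [← List.map_snd_withPrev [] bags]
    exact List.mem_map_of_mem hy
  have h₁ : ((y.2.map Sum.inl).toFinset : Finset (D.Univ n m K)).card ≤ w + 1 := by
    refine le_trans ?_ (hw _ hy₂)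
    refine (Finset.card_le_card (t := y.2.toFinset.image Sum.inl) fun u hu => ?_).trans
      Finset.card_image_le
    simpa using hu
  have h₂ : ∀ j : Fin m, (D.attach K j y.2).toFinset.card ≤ w + 1 + q := fun j => by
    rw [attach, List.toFinset_append]
    refine (Finset.card_union_le _ _).trans ?_
    have := List.toFinset_card_le ((List.finRange q).map
      (fun a => (Sum.inr (j, Sum.inl a) : D.Univ n m K)))
    rw [List.length_map, List.length_finRange] at this
    omega
  rcases List.mem_cons.1 hC with rfl | hC
  · omega
  · obtain ⟨j, -, hC⟩ := List.mem_flatMap.1 hC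
    split_ifs at hC
    · rcases D.mem_copyBags.1 hC with rfl | ⟨k, b, rfl⟩
      · have := h₂ j
        omega
      · have := h₂ j
        have := Finset.card_insert_le (D.pendant n j b k) (D.attach K j y.2).toFinset
        rw [List.toFinset_cons]
        omega
    · simp at hC

end Gadget

/-! ### Computing the oracle query -/

/-- The numeric form of an instance: the number of elements, the facts, and the bags. -/
abbrev RawInstance : Type := ℕ × List (ℕ × List ℕ) × List (List ℕ)

namespace RawInstance

open PolyTime

variable (r : ℕ)

/-- The distinct tuples of the relation with symbol number `r`. -/
def tuples (I : RawInstance) : List (List ℕ) :=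
  (I.2.1.flatMap fun f => if f.1 = r then [f.2] else []).dedup

/-- The facts about all other relations, with the numbers of the symbols translated by `T`. -/
def others (T : List (ℕ × ℕ)) (I : RawInstance) : List (ℕ × List ℕ) :=
  I.2.1.flatMap fun f => if f.1 = r then [] else [(lookup T f.1, f.2)]

/-- The elements that occur in a bag. -/
def elements (I : RawInstance) : List ℕ := I.2.2.flatten.dedup

/-- A list of length `v * n + d * m + 1`, for `n` elements and `m` tuples. -/
def unary (v d : ℕ) (I : RawInstance) : List ℕ :=
  (List.replicate v I.elements).flatten ++
    ((List.replicate d ((I.tuples r).map fun _ => 0)).flatten ++ [0])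

theorem length_unary (v d : ℕ) (I : RawInstance) :
    (I.unary r v d).length = v * I.elements.length + d * (I.tuples r).length + 1 := by
  simp [unary, add_assoc]

theorem polyTime_tuples : PolyTime (tuples r) := by
  have h : PolyTime (fun x : ℕ × (ℕ × List ℕ) => if x.2.1 = r then [x.2.2] else []) :=
    PolyTime.ite (dec_eq id.snd.fst (const r)) (id.snd.snd.cons (const [])) (const [])
  have hl : PolyTime (fun I : RawInstance => I.2.1) := id.snd.fst
  exact (flatMap h (const 0) hl).dedup

theorem polyTime_others (T : List (ℕ × ℕ)) : PolyTime (others r T) := by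
  have h : PolyTime (fun x : ℕ × (ℕ × List ℕ) =>
      if x.2.1 = r then [] else [(lookup T x.2.1, x.2.2)]) :=
    PolyTime.ite (dec_eq id.snd.fst (const r)) (const [])
      (((lookup T id.snd.fst).pair id.snd.snd).cons (const []))
  have hl : PolyTime (fun I : RawInstance => I.2.1) := id.snd.fst
  exact flatMap h (const 0) hl

theorem polyTime_elements : PolyTime elements := by
  have hl : PolyTime (fun I : RawInstance => I.2.2) := id.snd.snd
  exact hl.flatten.dedup

theorem polyTime_unary (v d : ℕ) : PolyTime (unary r v d) := by
  have h : PolyTime (fun _ : ℕ × List ℕ => 0) := const 0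
  exact (replicate_flatten v polyTime_elements).append
    ((replicate_flatten d (map h (const 0) (polyTime_tuples r))).append (const [0]))

end RawInstance

namespace Gadget

open PolyTime

variable {V : Type*} {p q : ℕ} (D : Gadget V (Fin p) (Fin q))

/-- The number of variables in one copy of the gadget. -/
def stride (K : ℕ) : ℕ := q + D.wts.length * K

/-- The numbering of the universe after adding `m` copies of the gadget to `n` elements: the old
elements keep their numbers, and the copies follow one after the other. -/
def number (n m K : ℕ) : D.Univ n m K ≃ Fin (n + m * D.stride K) :=
  (Equiv.sumCongr (Equiv.refl _) ((Equiv.prodCongr (Equiv.refl _)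
    ((Equiv.sumCongr (Equiv.refl _) finProdFinEquiv).trans finSumFinEquiv)).trans
      finProdFinEquiv)).trans finSumFinEquiv

/-- The number of an internal variable of the copy with number `j`. -/
def rawInternal (n K j : ℕ) (a : Fin q) : ℕ := n + (a + D.stride K * j)

/-- The number of a pendant of the copy with number `j`. -/
def rawPendant (n K j : ℕ) (b : Fin D.wts.length) (k : ℕ) : ℕ :=
  n + ((q + (k + K * b)) + D.stride K * j)

/-- The number of the place of a variable in the copy with number `y.2`, which is attached to the
tuple `y.1`. -/
def rawPlace (n K : ℕ) (y : List ℕ × ℕ) : Fin p ⊕ Fin q → ℕ :=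
  Sum.elim (fun i => y.1.getD i 0) (D.rawInternal n K y.2)

/-- Numeric form of `Gadget.copyFacts`; the symbol `s` has the number `c s`. -/
def rawCopyFacts (c : ListSymbol V → ℕ) (n K : ℕ) (l : List ℕ) (y : List ℕ × ℕ) :
    List (ℕ × List ℕ) :=
  D.facts.map (fun f => (c f.1, (List.finRange _).map fun i => D.rawPlace n K y (f.2 i))) ++
    l.flatMap fun k => (List.finRange D.wts.length).flatMap fun b =>
      [(c (Sum.inl ()), [D.rawPlace n K y (D.wts.get b).1, D.rawPendant n K y.2 b k]),
        (c (Sum.inr (D.wts.get b).2), [D.rawPendant n K y.2 b k])]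

/-- Numeric form of `Gadget.attach`. -/
def rawAttach (n K j : ℕ) (B : List ℕ) : List ℕ :=
  (List.finRange q).map (D.rawInternal n K j) ++ B

/-- Numeric form of `Gadget.copyBags`. -/
def rawCopyBags (n K : ℕ) (l : List ℕ) (j : ℕ) (B : List ℕ) : List (List ℕ) :=
  D.rawAttach n K j B :: l.flatMap fun k =>
    (List.finRange D.wts.length).flatMap fun b => [D.rawPendant n K j b k :: D.rawAttach n K j B]

/-- Numeric form of `Gadget.expandBag`. -/
def rawExpandBag (n K : ℕ) (l : List ℕ) (ts : List (List ℕ × ℕ)) (y : List ℕ × List ℕ) :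
    List (List ℕ) :=
  y.2 :: ts.flatMap fun x =>
    if (∀ a ∈ x.1, a ∈ y.2) ∧ ¬ ∀ a ∈ x.1, a ∈ y.1 then D.rawCopyBags n K l x.2 y.2 else []

section PolyTime

variable {δ : Type} [Enc δ] {n K j : δ → ℕ} {l : δ → List ℕ}

theorem polyTime_stride (hK : PolyTime K) : PolyTime (fun x => D.stride (K x)) :=
  (const q).add ((const _).mul hK)

theorem polyTime_rawInternal (hn : PolyTime n) (hK : PolyTime K) (hj : PolyTime j) (a : Fin q) :
    PolyTime (fun x => D.rawInternal (n x) (K x) (j x) a) :=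
  hn.add ((const _).add ((D.polyTime_stride hK).mul hj))

theorem polyTime_rawPendant {k : δ → ℕ} (hn : PolyTime n) (hK : PolyTime K) (hj : PolyTime j)
    (b : Fin D.wts.length) (hk : PolyTime k) :
    PolyTime (fun x => D.rawPendant (n x) (K x) (j x) b (k x)) :=
  hn.add (((const q).add (hk.add (hK.mul (const _)))).add ((D.polyTime_stride hK).mul hj))

theorem polyTime_rawPlace {y : δ → List ℕ × ℕ} (hn : PolyTime n) (hK : PolyTime K)
    (hy : PolyTime y) (a : Fin p ⊕ Fin q) :
    PolyTime (fun x => D.rawPlace (n x) (K x) (y x) a) := by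
  rcases a with i | a
  · exact hy.fst.getD i
  · exact D.polyTime_rawInternal hn hK hy.snd a

theorem polyTime_rawCopyFacts (c : ListSymbol V → ℕ) {y : δ → List ℕ × ℕ} (hn : PolyTime n)
    (hK : PolyTime K) (hl : PolyTime l) (hy : PolyTime y) :
    PolyTime (fun x => D.rawCopyFacts c (n x) (K x) (l x) (y x)) := by
  refine append (list_map _ fun f _ => (const _).pair (list_map _ fun i _ =>
    D.polyTime_rawPlace hn hK hy (f.2 i))) ?_
  refine flatMap (p := fun x => x) (f := fun x : δ × ℕ =>
    (List.finRange D.wts.length).flatMap fun b =>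
      [(c (Sum.inl ()), [D.rawPlace (n x.1) (K x.1) (y x.1) (D.wts.get b).1,
          D.rawPendant (n x.1) (K x.1) (y x.1).2 b x.2]),
        (c (Sum.inr (D.wts.get b).2), [D.rawPendant (n x.1) (K x.1) (y x.1).2 b x.2])]) ?_ id hl
  have hn' := hn.comp (fst' (α := δ) (β := ℕ))
  have hK' := hK.comp (fst' (α := δ) (β := ℕ))
  have hy' := hy.comp (fst' (α := δ) (β := ℕ))
  refine list_flatMap _ fun b _ => ?_
  have hb := D.polyTime_rawPendant hn' hK' hy'.snd b snd'
  exact ((const _).pair ((D.polyTime_rawPlace hn' hK' hy' _).cons (hb.cons (const [])))).cons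
    (((const _).pair (hb.cons (const []))).cons (const []))

theorem polyTime_rawAttach {B : δ → List ℕ} (hn : PolyTime n) (hK : PolyTime K) (hj : PolyTime j)
    (hB : PolyTime B) : PolyTime (fun x => D.rawAttach (n x) (K x) (j x) (B x)) :=
  append (list_map _ fun a _ => D.polyTime_rawInternal hn hK hj a) hB

theorem polyTime_rawCopyBags {B : δ → List ℕ} (hn : PolyTime n) (hK : PolyTime K)
    (hl : PolyTime l) (hj : PolyTime j) (hB : PolyTime B) :
    PolyTime (fun x => D.rawCopyBags (n x) (K x) (l x) (j x) (B x)) := by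
  refine (D.polyTime_rawAttach hn hK hj hB).cons ?_
  refine flatMap (p := fun x => x) (f := fun x : δ × ℕ =>
    (List.finRange D.wts.length).flatMap fun b =>
      [D.rawPendant (n x.1) (K x.1) (j x.1) b x.2 ::
        D.rawAttach (n x.1) (K x.1) (j x.1) (B x.1)]) ?_ id hl
  have hn' := hn.comp (fst' (α := δ) (β := ℕ))
  have hK' := hK.comp (fst' (α := δ) (β := ℕ))
  have hj' := hj.comp (fst' (α := δ) (β := ℕ))
  have hB' := hB.comp (fst' (α := δ) (β := ℕ))
  exact list_flatMap _ fun b _ => ((D.polyTime_rawPendant hn' hK' hj' b snd').cons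
    (D.polyTime_rawAttach hn' hK' hj' hB')).cons (const [])

theorem polyTime_rawExpandBag {ts : δ → List (List ℕ × ℕ)} {y : δ → List ℕ × List ℕ}
    (hn : PolyTime n) (hK : PolyTime K) (hl : PolyTime l) (hts : PolyTime ts) (hy : PolyTime y) :
    PolyTime (fun x => D.rawExpandBag (n x) (K x) (l x) (ts x) (y x)) := by
  refine hy.snd.cons ?_
  refine flatMap (p := fun x => x) (f := fun x : δ × (List ℕ × ℕ) =>
    if (∀ a ∈ x.2.1, a ∈ (y x.1).2) ∧ ¬ ∀ a ∈ x.2.1, a ∈ (y x.1).1 then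
      D.rawCopyBags (n x.1) (K x.1) (l x.1) x.2.2 (y x.1).2 else []) ?_ id hts
  have hn' := hn.comp (fst' (α := δ) (β := List ℕ × ℕ))
  have hK' := hK.comp (fst' (α := δ) (β := List ℕ × ℕ))
  have hl' := hl.comp (fst' (α := δ) (β := List ℕ × ℕ))
  have hy' := hy.comp (fst' (α := δ) (β := List ℕ × ℕ))
  have hx : PolyTime (fun x : δ × (List ℕ × ℕ) => x.2.1) := id.snd.fst
  exact PolyTime.ite ((dec_subset hx hy'.snd).and (dec_subset hx hy'.fst).not)
    (D.polyTime_rawCopyBags hn' hK' hl' snd'.snd hy'.snd) (const [])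

end PolyTime

/-- The query for an instance, in numeric form: every tuple of the relation with symbol number `r`
is replaced by a copy of the gadget, with the weights realized by `I.unary r v d` many
pendants. -/
def rawQuery (c : ListSymbol V → ℕ) (r v d : ℕ) (T : List (ℕ × ℕ)) (I : RawInstance) :
    RawInstance :=
  (I.1 + (I.tuples r).length * D.stride (I.unary r v d).length,
    I.others r T ++ (I.tuples r).zipIdx.flatMap (D.rawCopyFacts c I.1 (I.unary r v d).length
      (List.range (I.unary r v d).length)),
    (I.2.2.withPrev []).flatMap (D.rawExpandBag I.1 (I.unary r v d).length
      (List.range (I.unary r v d).length) (I.tuples r).zipIdx))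

theorem polyTime_rawQuery (c : ListSymbol V → ℕ) (r v d : ℕ) (T : List (ℕ × ℕ)) :
    PolyTime (D.rawQuery c r v d T) := by
  have hn : PolyTime (fun I : RawInstance => I.1) := fst'
  have hB : PolyTime (fun I : RawInstance => I.2.2) := id.snd.snd
  have ht := RawInstance.polyTime_tuples r
  have hu := RawInstance.polyTime_unary r v d
  refine (hn.add (ht.length.mul (D.polyTime_stride hu.length))).pair
    (((RawInstance.polyTime_others r T).append ?_).pair ?_)
  · refine flatMap (p := fun I => I) (f := fun x : RawInstance × (List ℕ × ℕ) =>
      D.rawCopyFacts c x.1.1 (x.1.unary r v d).length (List.range (x.1.unary r v d).length) x.2)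
      ?_ id ht.zipIdx
    have hu' := hu.comp (fst' (α := RawInstance) (β := List ℕ × ℕ))
    exact D.polyTime_rawCopyFacts c fst'.fst hu'.length hu'.range_length snd'
  · refine flatMap (p := fun I => I) (f := fun x : RawInstance × (List ℕ × List ℕ) =>
      D.rawExpandBag x.1.1 (x.1.unary r v d).length (List.range (x.1.unary r v d).length)
        (x.1.tuples r).zipIdx x.2) ?_ id (hB.withPrev [])
    have hu' := hu.comp (fst' (α := RawInstance) (β := List ℕ × List ℕ))
    have ht' := ht.comp (fst' (α := RawInstance) (β := List ℕ × List ℕ))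
    exact D.polyTime_rawExpandBag fst'.fst hu'.length hu'.range_length ht'.zipIdx snd'

end Gadget

/-- The count is recovered from the answer of the oracle by a division with remainder. -/
def RawInstance.decode (r v d : ℕ) (x : RawInstance × ℕ) : ℕ :=
  x.2 % (2 ^ (x.1.unary r v d).length + 1) / d ^ (x.1.tuples r).length

theorem RawInstance.polyTime_decode (r v d : ℕ) : PolyTime (RawInstance.decode r v d) := by
  have ht := (RawInstance.polyTime_tuples r).comp (PolyTime.fst' (α := RawInstance) (β := ℕ))
  have hu := (RawInstance.polyTime_unary r v d).comp (PolyTime.fst' (α := RawInstance) (β := ℕ))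
  exact (PolyTime.snd'.mod ((PolyTime.pow_length 2 hu).add (.const 1))).div
    (PolyTime.pow_length d ht)

/-! ### The numeric query encodes the instance with gadgets -/

/-- The numeric form of a fact, for given numbers of symbols and elements. -/
def rawFact {σ U : Type*} {ar : σ → ℕ} (c : σ → ℕ) (φ : U → ℕ) (f : (s : σ) × (Fin (ar s) → U)) :
    ℕ × List ℕ :=
  (c f.1, (List.finRange _).map fun i => φ (f.2 i))

/-- The numeric form of a tuple. -/
def rawTuple {p n : ℕ} (x : Fin p → Fin n) : List ℕ := (List.finRange p).map fun i => (x i : ℕ)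

theorem rawTuple_injective {p n : ℕ} : Function.Injective (rawTuple (p := p) (n := n)) := by
  intro x y h
  ext i
  exact List.map_inj_left.1 h i (List.mem_finRange i)

theorem List.withPrev_map {α β : Type} (f : α → β) (a : α) (l : List α) :
    (l.map f).withPrev (f a) = (l.withPrev a).map (Prod.map f f) := by
  induction l generalizing a with
  | nil => rfl
  | cons b l ih => rw [List.map_cons, List.withPrev, List.withPrev, List.map_cons, ih b]; rfl

theorem List.zipIdx_eq_map_finRange {α : Type*} (l : List α) :
    l.zipIdx = (List.finRange l.length).map fun j => (l.get j, (j : ℕ)) := by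
  refine List.ext_getElem (by simp) fun i h₁ h₂ => by simp

namespace Gadget

variable {V : Type*} {p q : ℕ} (D : Gadget V (Fin p) (Fin q)) {n m K : ℕ}
  (t : Fin m → Fin p → Fin n)

theorem number_inl (u : Fin n) : (D.number n m K (Sum.inl u) : ℕ) = u := rfl

theorem number_pendant (j : Fin m) (b : Fin D.wts.length) (k : Fin K) :
    (D.number n m K (D.pendant n j b k) : ℕ) = D.rawPendant n K j b k := rfl

theorem number_place (j : Fin m) (a : Fin p ⊕ Fin q) :
    (D.number n m K (D.place t K j a) : ℕ) = D.rawPlace n K (rawTuple (t j), j) a := by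
  rcases a with i | a
  · simp [place, rawPlace, rawTuple, number_inl]
  · rfl

theorem map_rawFact_copyFacts (c : ListSymbol V → ℕ) (j : Fin m) :
    (D.copyFacts t K j).map (rawFact c fun u => (D.number n m K u : ℕ)) =
      D.rawCopyFacts c n K (List.range K) (rawTuple (t j), j) := by
  rw [copyFacts, rawCopyFacts, List.map_append, List.map_map, List.map_flatMap,
    ← List.map_coe_finRange_eq_range, List.flatMap_map]
  congr 1
  · refine List.map_congr_left fun f _ => ?_
    simp only [rawFact, Function.comp_apply, ListFact.map, number_place]
  · refine List.flatMap_congr fun k _ => ?_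
    rw [List.map_flatMap]
    refine List.flatMap_congr fun b _ => ?_
    rw [← number_pendant, ← number_place]
    rfl

theorem map_number_attach (j : Fin m) (B : List (Fin n)) :
    (D.attach K j B).map (fun u => (D.number n m K u : ℕ)) =
      D.rawAttach n K j (B.map Fin.val) := by
  rw [attach, rawAttach, List.map_append, List.map_map, List.map_map]
  rfl

theorem map_number_copyBags (j : Fin m) (B : List (Fin n)) :
    (D.copyBags K j B).map (List.map fun u => (D.number n m K u : ℕ)) =
      D.rawCopyBags n K (List.range K) j (B.map Fin.val) := by
  rw [copyBags, rawCopyBags, List.map_cons, map_number_attach, List.map_flatMap,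
    ← List.map_coe_finRange_eq_range, List.flatMap_map]
  congr 1
  refine List.flatMap_congr fun k _ => ?_
  rw [List.map_flatMap]
  refine List.flatMap_congr fun b _ => ?_
  rw [List.map_singleton, List.map_cons, map_number_attach, number_pendant]

theorem forall_mem_rawTuple (x : Fin p → Fin n) (B : List (Fin n)) :
    (∀ a ∈ rawTuple x, a ∈ B.map Fin.val) ↔ ∀ i, x i ∈ B := by
  simp only [rawTuple, List.mem_map, List.mem_finRange, true_and, forall_exists_index,
    forall_apply_eq_imp_iff]
  refine forall_congr' fun i => ⟨?_, fun h => ⟨_, h, rfl⟩⟩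
  rintro ⟨u, hu, h⟩
  rwa [← Fin.ext h]

theorem map_number_expandBag (y : List (Fin n) × List (Fin n)) :
    (D.expandBag t K y).map (List.map fun u => (D.number n m K u : ℕ)) =
      D.rawExpandBag n K (List.range K) ((List.finRange m).map fun j => (rawTuple (t j), (j : ℕ)))
        (Prod.map (List.map Fin.val) (List.map Fin.val) y) := by
  rw [expandBag, rawExpandBag, List.map_cons, List.map_flatMap, List.flatMap_map, List.map_map]
  congr 1
  refine List.flatMap_congr fun j _ => ?_
  simp only [Prod.map_fst, Prod.map_snd, forall_mem_rawTuple]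
  split_ifs
  · exact D.map_number_copyBags j y.2
  · rfl

theorem map_number_expandBags (bags : List (List (Fin n))) :
    (D.expandBags t K bags).map (List.map fun u => (D.number n m K u : ℕ)) =
      ((bags.map (List.map Fin.val)).withPrev []).flatMap (D.rawExpandBag n K (List.range K)
        ((List.finRange m).map fun j => (rawTuple (t j), (j : ℕ)))) := by
  have := List.withPrev_map (List.map Fin.val) ([] : List (Fin n)) bags
  rw [List.map_nil] at this
  rw [this, List.flatMap_map, expandBags, List.map_flatMap]
  exact List.flatMap_congr fun y _ => D.map_number_expandBag t y

theorem map_rawFact_expandFacts (c : ListSymbol V → ℕ) (base : List (ListFact V (Fin n))) :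
    (D.expandFacts t K base).map (rawFact c fun u => (D.number n m K u : ℕ)) =
      base.map (rawFact c Fin.val) ++
        ((List.finRange m).map fun j => (rawTuple (t j), (j : ℕ))).flatMap
          (D.rawCopyFacts c n K (List.range K)) := by
  rw [expandFacts, List.map_append, List.map_map, List.map_flatMap, List.flatMap_map]
  congr 1
  exact List.flatMap_congr fun j _ => D.map_rawFact_copyFacts t c j

end Gadget

/-! ### Separating the facts of the realized relation -/

/-- The symbols of the structure `(V, {E, R})⁺`. -/
abbrev RelSymbol (V : Type*) := Option Unit ⊕ {L : Finset V // L.Nonempty}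

/-- The arity of a symbol of `(V, {E, R})⁺`, where `R` has arity `p`. -/
abbrev relArity (V : Type*) (p : ℕ) : RelSymbol V → ℕ :=
  RelStr.listArity (RelStr.addArity (fun _ : Unit => 2) p) V

/-- A fact over the signature of `(V, {E, R})⁺`. -/
abbrev RelFact (V : Type*) (p : ℕ) (U : Type*) := (s : RelSymbol V) × (Fin (relArity V p s) → U)

namespace RelFact

variable {V U : Type*} {p : ℕ}

/-- The tuple of the fact, if its symbol is `R`. -/
def tuple : RelFact V p U → List (Fin p → U)
  | ⟨Sum.inl none, x⟩ => [x]
  | ⟨Sum.inl (some _), _⟩ => []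
  | ⟨Sum.inr _, _⟩ => []

/-- The fact itself, if its symbol is not `R`. -/
def other : RelFact V p U → List (ListFact V U)
  | ⟨Sum.inl none, _⟩ => []
  | ⟨Sum.inl (some _), x⟩ => [⟨Sum.inl (), x⟩]
  | ⟨Sum.inr L, x⟩ => [⟨Sum.inr L, x⟩]

theorem holds_iff (H : SimpleGraph V) (R : Set (Fin p → V)) (h : U → V) (f : RelFact V p U) :
    (fun i => h (f.2 i)) ∈ ((RelStr.ofGraph H).addRel R).plus f.1 ↔
      (∀ g ∈ f.other, g.Holds H h) ∧ ∀ x ∈ f.tuple, (fun i => h (x i)) ∈ R := by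
  rcases f with ⟨((_ | _) | L), x⟩
  · refine ⟨fun hx => ⟨by simp [other], fun y hy => ?_⟩, fun h => h.2 x List.mem_cons_self⟩
    obtain rfl := List.mem_singleton.1 hy
    exact hx
  · simp only [other, tuple, List.mem_singleton, forall_eq, List.not_mem_nil, false_implies,
      implies_true, and_true]
    rfl
  · simp only [other, tuple, List.mem_singleton, forall_eq, List.not_mem_nil, false_implies,
      implies_true, and_true]
    rfl

theorem isHom_iff {A : RelStr (relArity V p) U} {facts : List (RelFact V p U)}
    (hA : ∀ s x, ⟨s, x⟩ ∈ facts ↔ x ∈ A s) (H : SimpleGraph V) (R : Set (Fin p → V)) (h : U → V) :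
    A.IsHom ((RelStr.ofGraph H).addRel R).plus h ↔
      (∀ g ∈ facts.flatMap other, g.Holds H h) ∧
        ∀ x ∈ facts.flatMap tuple, (fun i => h (x i)) ∈ R := by
  have h₁ : A.IsHom ((RelStr.ofGraph H).addRel R).plus h ↔
      ∀ f ∈ facts, (fun i => h (f.2 i)) ∈ ((RelStr.ofGraph H).addRel R).plus f.1 :=
    ⟨fun hh f hf => hh f.1 f.2 ((hA _ _).1 hf), fun hh s x hx => hh ⟨s, x⟩ ((hA s x).2 hx)⟩
  simp only [h₁, holds_iff, List.mem_flatMap]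
  exact ⟨fun h => ⟨fun g ⟨f, hf, hg⟩ => (h f hf).1 g hg, fun x ⟨f, hf, hx⟩ => (h f hf).2 x hx⟩,
    fun h f hf => ⟨fun g hg => h.1 g ⟨f, hf, hg⟩, fun x hx => h.2 x ⟨f, hf, hx⟩⟩⟩

variable {n : ℕ} {c : RelSymbol V → ℕ}

theorem map_tuple (hc : Function.Injective c) (f : RelFact V p (Fin n)) :
    f.tuple.map rawTuple =
      if (rawFact c Fin.val f).1 = c (Sum.inl none) then [(rawFact c Fin.val f).2] else [] := by
  rcases f with ⟨((_ | _) | L), x⟩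
  · exact (if_pos rfl).symm
  · rw [if_neg (fun h => by simpa using hc h)]; rfl
  · rw [if_neg (fun h => by simpa using hc h)]; rfl

theorem map_other (hc : Function.Injective c) {c' : ListSymbol V → ℕ} {T : List (ℕ × ℕ)}
    (h₁ : lookup T (c (Sum.inl (some ()))) = c' (Sum.inl ()))
    (h₂ : ∀ L, lookup T (c (Sum.inr L)) = c' (Sum.inr L)) (f : RelFact V p (Fin n)) :
    f.other.map (rawFact c' Fin.val) =
      if (rawFact c Fin.val f).1 = c (Sum.inl none) then []
      else [(lookup T (rawFact c Fin.val f).1, (rawFact c Fin.val f).2)] := by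
  rcases f with ⟨((_ | _) | L), x⟩
  · exact (if_pos rfl).symm
  · rw [if_neg (fun h => by simpa using hc h)]
    simp only [rawFact, h₁]
    rfl
  · rw [if_neg (fun h => by simpa using hc h)]
    simp only [rawFact, h₂]
    rfl

end RelFact

/-- Every function on an initial segment of `ℕ` is given by a table. -/
theorem exists_lookup_eq (f : ℕ → ℕ) (N : ℕ) : ∃ T, ∀ i < N, lookup T i = f i := by
  induction N with
  | zero => exact ⟨[], by simp⟩
  | succ N ih =>
    obtain ⟨T, hT⟩ := ih
    refine ⟨(N, f N) :: T, fun i hi => ?_⟩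
    rw [lookup]
    split_ifs with h
    · rw [h]
    · exact hT i (by omega)

theorem exists_lookup_comp_eq {α : Type*} [Finite α] {c : α → ℕ} (hc : Function.Injective c)
    (f : α → ℕ) : ∃ T, ∀ a, lookup T (c a) = f a := by
  obtain ⟨N, hN⟩ := (Set.finite_range c).bddAbove
  obtain ⟨T, hT⟩ := exists_lookup_eq (Function.extend c f 0) (N + 1)
  refine ⟨T, fun a => ?_⟩
  rw [hT _ (Nat.lt_succ_of_le (hN ⟨a, rfl⟩)), hc.extend_apply]

/-! ### Correctness of the reduction -/

/-- The numeric form of lists of facts and bags over `n` elements; the symbol `s` has the number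
`c s`. -/
def rawInstance {σ : Type*} {ar : σ → ℕ} (c : σ → ℕ) {n : ℕ}
    (facts : List ((s : σ) × (Fin (ar s) → Fin n))) (bags : List (List (Fin n))) : RawInstance :=
  (n, facts.map (rawFact c Fin.val), bags.map (List.map Fin.val))

/-- The number of a symbol in the enumeration of the signature. -/
noncomputable def symbolNumber (σ : Type*) [Fintype σ] (s : σ) : ℕ := Fintype.equivFin σ s

theorem symbolNumber_injective (σ : Type*) [Fintype σ] : Function.Injective (symbolNumber σ) :=
  Fin.val_injective.comp (Fintype.equivFin σ).injective

theorem enc_rawInstance {σ : Type*} [Fintype σ] {ar : σ → ℕ} {n : ℕ}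
    (facts : List ((s : σ) × (Fin (ar s) → Fin n))) (bags : List (List (Fin n))) :
    Enc.enc (rawInstance (symbolNumber σ) facts bags) = Val.pair (Val.nat n)
      (Val.pair (Val.ofList (facts.map PathInstance.encodeFact))
        (Val.ofList (bags.map PathInstance.encodeBag))) := by
  have h₁ : ∀ f : (s : σ) × (Fin (ar s) → Fin n),
      Enc.enc (rawFact (symbolNumber σ) Fin.val f) = PathInstance.encodeFact f := fun f => by
    rw [PathInstance.encodeFact, List.ofFn_eq_map]
    change Val.pair _ (Val.ofList (((List.finRange _).map _).map _)) = _
    rw [List.map_map]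
    rfl
  have h₂ : ∀ B : List (Fin n), Enc.enc (B.map Fin.val) = PathInstance.encodeBag B := fun B => by
    change Val.ofList ((B.map _).map _) = _
    rw [List.map_map]
    rfl
  change Val.pair _ (Val.pair (Val.ofList ((facts.map _).map _))
    (Val.ofList ((bags.map _).map _))) = _
  rw [List.map_map, List.map_map]
  simp only [Function.comp_def, h₁, h₂]
  rfl

/-- A bound for the size of a structure with `x` elements. -/
noncomputable def normBound {σ : Type*} [Fintype σ] (ar : σ → ℕ) : Polynomial ℕ :=
  Polynomial.C (Fintype.card σ) + Polynomial.X +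
    ∑ s : σ, Polynomial.X ^ ar s * Polynomial.C (ar s)

theorem RelStr.norm_le {σ : Type*} [Fintype σ] {ar : σ → ℕ} {n : ℕ} (G : RelStr ar (Fin n)) :
    G.norm ≤ (normBound ar).eval n := by
  simp only [norm, normBound, Polynomial.eval_add, Polynomial.eval_C, Polynomial.eval_X,
    Polynomial.eval_finsetSum, Polynomial.eval_mul, Polynomial.eval_pow, Fintype.card_fin]
  gcongr with s
  refine (Set.ncard_le_card (G s)).trans ?_
  simp

theorem PathInstance.homCount_le {σ V : Type*} [Fintype V] {ar : σ → ℕ} (I : PathInstance ar)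
    (A : RelStr ar V) : I.str.homCount A ≤ Fintype.card V ^ I.n := by
  classical
  rw [RelStr.homCount, Nat.card_eq_fintype_card]
  exact (Fintype.card_subtype_le _).trans (by simp)

theorem PathInstance.consec_bags {σ : Type*} {ar : σ → ℕ} (I : PathInstance ar)
    {bags : List (List (Fin I.n))} (hb : I.bags = bags.map List.toFinset) (u : Fin I.n) :
    Consec (fun B => u ∈ B) bags := by
  have h : Consec (fun B : Finset (Fin I.n) => u ∈ B) I.bags :=
    Consec.of_get fun i j k hij hjk => I.isPathDecomposition.consecutive i j k hij hjk u
  rw [hb] at h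
  simpa only [List.mem_toFinset] using h.of_map

namespace RelFact

variable {V : Type*} {p n : ℕ} {c : RelSymbol V → ℕ} (facts : List (RelFact V p (Fin n)))
  (bags : List (List (Fin n)))

theorem tuples_rawInstance (hc : Function.Injective c) :
    (rawInstance c facts bags).tuples (c (Sum.inl none)) =
      (facts.flatMap tuple).dedup.map rawTuple := by
  rw [← List.dedup_map_of_injective rawTuple_injective, List.map_flatMap, RawInstance.tuples,
    rawInstance, List.flatMap_map]
  congr 1
  exact List.flatMap_congr fun f _ => (map_tuple hc f).symm

theorem others_rawInstance (hc : Function.Injective c) {c' : ListSymbol V → ℕ}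
    {T : List (ℕ × ℕ)} (h₁ : lookup T (c (Sum.inl (some ()))) = c' (Sum.inl ()))
    (h₂ : ∀ L, lookup T (c (Sum.inr L)) = c' (Sum.inr L)) :
    (rawInstance c facts bags).others (c (Sum.inl none)) T =
      (facts.flatMap other).map (rawFact c' Fin.val) := by
  rw [List.map_flatMap, RawInstance.others, rawInstance, List.flatMap_map]
  exact List.flatMap_congr fun f _ => (map_other hc h₁ h₂ f).symm

theorem length_tuples_le : (facts.flatMap tuple).dedup.length ≤ n ^ p := by
  refine (List.Nodup.length_le_card (List.nodup_dedup _)).trans ?_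
  simp

end RelFact

theorem length_elements_rawInstance {σ : Type*} {ar : σ → ℕ} (c : σ → ℕ) {n : ℕ}
    (facts : List ((s : σ) × (Fin (ar s) → Fin n))) {bags : List (List (Fin n))}
    (hv : ∀ u, ∃ B ∈ bags, u ∈ B) : (rawInstance c facts bags).elements.length = n := by
  have h : (rawInstance c facts bags).elements = bags.flatten.dedup.map Fin.val := by
    rw [← List.dedup_map_of_injective Fin.val_injective, List.map_flatten]
    rfl
  rw [h, List.length_map, ← List.card_toFinset]
  have : bags.flatten.toFinset = Finset.univ := by
    ext u
    simpa using hv u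
  rw [this, Finset.card_univ, Fintype.card_fin]

namespace Gadget

variable {V : Type*} [Fintype V] {p q : ℕ} (D : Gadget V (Fin p) (Fin q))

/-- A bound for the number of elements of the query for an instance with `x` elements. -/
noncomputable def queryBound (d : ℕ) : Polynomial ℕ :=
  Polynomial.X + Polynomial.X ^ p * (Polynomial.C q + Polynomial.C D.wts.length *
    (Polynomial.C (Fintype.card V) * Polynomial.X + Polynomial.C d * Polynomial.X ^ p + 1))

theorem decode_eq {H : SimpleGraph V} {R : Set (Fin p → V)} [DecidablePred (· ∈ R)] {d : ℕ}
    (hd : 0 < d) (hD : ∀ x, D.val H x = if x ∈ R then (d : ℤ) else 0) {n m : ℕ}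
    (t : Fin m → Fin p → Fin n) (base : List (ListFact V (Fin n))) :
    Nat.card {g : D.Univ n m (Fintype.card V * n + d * m + 1) → V //
        ∀ f ∈ D.expandFacts t (Fintype.card V * n + d * m + 1) base, f.Holds H g} %
      (2 ^ (Fintype.card V * n + d * m + 1) + 1) / d ^ m =
      Nat.card {h : Fin n → V // (∀ f ∈ base, f.Holds H h) ∧ ∀ j, (fun i => h (t j i)) ∈ R} := by
  classical
  set K := Fintype.card V * n + d * m + 1 with hK
  set N := Nat.card {h : Fin n → V // (∀ f ∈ base, f.Holds H h) ∧ ∀ j, (fun i => h (t j i)) ∈ R}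
    with hN
  have hN' : N ≤ 2 ^ (Fintype.card V * n) := by
    rw [hN, pow_mul]
    refine (Finite.card_subtype_le _).trans ?_
    rw [Nat.card_eq_fintype_card, Fintype.card_fun, Fintype.card_fin]
    exact Nat.pow_le_pow_left Nat.lt_two_pow_self.le n
  have hdm : d ^ m ≤ 2 ^ (d * m) := by
    rw [pow_mul]
    exact Nat.pow_le_pow_left Nat.lt_two_pow_self.le m
  have hlt : d ^ m * N < 2 ^ K + 1 := by
    refine Nat.lt_succ_of_le ((Nat.mul_le_mul hdm hN').trans ?_)
    rw [← pow_add]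
    exact Nat.pow_le_pow_right (by norm_num) (by omega)
  have h : _ % _ = _ % _ := D.card_expandFacts_modEq t H (K := K) (by omega) hD base
  rw [h, Nat.mod_eq_of_lt hlt, Nat.mul_div_cancel_left _ (pow_pos hd m)]

/-- The numeric query encodes an instance whose number of homomorphisms determines the number of
homomorphisms of the given instance. -/
theorem exists_encodes_rawQuery [Fintype (RelSymbol V)] [Fintype (ListSymbol V)]
    {H : SimpleGraph V} {R : Set (Fin p → V)} [DecidablePred (· ∈ R)] {d : ℕ} (hp : 0 < p)
    (hd : 0 < d) (hD : ∀ x, D.val H x = if x ∈ R then (d : ℤ) else 0) {T : List (ℕ × ℕ)}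
    (h₁ : lookup T (symbolNumber (RelSymbol V) (Sum.inl (some ()))) =
      symbolNumber (ListSymbol V) (Sum.inl ()))
    (h₂ : ∀ L, lookup T (symbolNumber (RelSymbol V) (Sum.inr L)) =
      symbolNumber (ListSymbol V) (Sum.inr L))
    (I : PathInstance (relArity V p)) {facts : List (RelFact V p (Fin I.n))}
    {bags : List (List (Fin I.n))} (hfacts : ∀ s x, ⟨s, x⟩ ∈ facts ↔ x ∈ I.str s)
    (hbags : I.bags = bags.map List.toFinset) :
    ∃ J : PathInstance (symArity V),
      J.Encodes (Enc.enc (D.rawQuery (symbolNumber (ListSymbol V))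
        (symbolNumber (RelSymbol V) (Sum.inl none)) (Fintype.card V) d T
        (rawInstance (symbolNumber (RelSymbol V)) facts bags))) ∧
      (∀ w, I.WidthLE w → J.WidthLE (w + (q + 1))) ∧ J.n ≤ (D.queryBound d).eval I.n ∧
      RawInstance.decode (symbolNumber (RelSymbol V) (Sum.inl none)) (Fintype.card V) d
        (rawInstance (symbolNumber (RelSymbol V)) facts bags,
          J.str.homCount (RelStr.ofGraph H).plus) =
        I.str.homCount ((RelStr.ofGraph H).addRel R).plus := by
  classical
  set c := symbolNumber (RelSymbol V) with hc
  have hcinj : Function.Injective c := symbolNumber_injective _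
  set c' := symbolNumber (ListSymbol V) with hc'
  set ts := (facts.flatMap RelFact.tuple).dedup with hts
  set base := facts.flatMap RelFact.other with hbase
  set m := ts.length with hm
  set K := Fintype.card V * I.n + d * m + 1 with hK
  let t : Fin m → Fin p → Fin I.n := ts.get
  have hcons := I.consec_bags hbags
  have hv : ∀ u, ∃ B ∈ bags, u ∈ B := fun u => by
    obtain ⟨B, hB, hu⟩ := I.isPathDecomposition.vertex u
    rw [hbags] at hB
    obtain ⟨B', hB', rfl⟩ := List.mem_map.1 hB
    exact ⟨B', hB', List.mem_toFinset.1 hu⟩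
  -- every fact lies within one bag
  have hbag : ∀ f ∈ facts, ∃ B ∈ bags, ∀ i, f.2 i ∈ B := fun f hf => by
    have har : 0 < relArity V p f.1 := by
      rcases f with ⟨((_ | _) | L), x⟩
      · exact hp
      · exact Nat.two_pos
      · exact Nat.one_pos
    obtain ⟨B, hB, hfB⟩ := I.exists_bag f.1 ((hfacts _ _).1 hf) har
    rw [hbags] at hB
    obtain ⟨B', hB', rfl⟩ := List.mem_map.1 hB
    exact ⟨B', hB', fun i => List.mem_toFinset.1 (hfB i)⟩
  have hb : ∀ f ∈ base, ∃ B ∈ bags, ∀ i, f.2 i ∈ B := fun f hf => by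
    obtain ⟨g, hg, hfg⟩ := List.mem_flatMap.1 hf
    obtain ⟨B, hB, h⟩ := hbag g hg
    refine ⟨B, hB, ?_⟩
    rcases g with ⟨((_ | _) | L), x⟩
    · exact absurd hfg List.not_mem_nil
    · obtain rfl := List.mem_singleton.1 hfg
      exact h
    · obtain rfl := List.mem_singleton.1 hfg
      exact h
  have ht : ∀ j, ∃ B ∈ bags, ∀ i, t j i ∈ B := fun j => by
    obtain ⟨g, hg, hfg⟩ := List.mem_flatMap.1 (List.mem_dedup.1 (List.get_mem ts j))
    obtain ⟨B, hB, h⟩ := hbag g hg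
    refine ⟨B, hB, ?_⟩
    rcases g with ⟨((_ | _) | L), x⟩
    · have : t j = x := List.mem_singleton.1 hfg
      rw [this]
      exact h
    · exact absurd hfg List.not_mem_nil
    · exact absurd hfg List.not_mem_nil
  have hlen : ((rawInstance c facts bags).tuples (c (Sum.inl none))).length = m := by
    rw [RelFact.tuples_rawInstance facts bags hcinj, List.length_map]
  have hunary : ((rawInstance c facts bags).unary (c (Sum.inl none)) (Fintype.card V) d).length
      = K := by
    rw [RawInstance.length_unary, hlen, length_elements_rawInstance c facts hv]
  have hzip : ((rawInstance c facts bags).tuples (c (Sum.inl none))).zipIdx =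
      (List.finRange m).map fun j => (rawTuple (t j), (j : ℕ)) := by
    rw [RelFact.tuples_rawInstance facts bags hcinj, List.zipIdx_map, List.zipIdx_eq_map_finRange,
      List.map_map]
    rfl
  let e := D.number I.n m K
  let J := PathInstance.ofLists e (D.expandFacts t K base) (D.expandBags t K bags)
    (D.exists_mem_expandBags t hcons hp ht hv) (D.exists_facts_subset t hcons hp ht hb)
    (D.consec_expandBags t hcons hp ht)
  refine ⟨J, ?_, ?_, ?_, ?_⟩
  · have hq : D.rawQuery c' (c (Sum.inl none)) (Fintype.card V) d T (rawInstance c facts bags) =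
        rawInstance c' ((D.expandFacts t K base).map (ListFact.map e))
          ((D.expandBags t K bags).map (List.map e)) := by
      have hF := D.map_rawFact_expandFacts (K := K) t c' base
      have hB := D.map_number_expandBags (K := K) t bags
      rw [rawQuery, hunary, hlen, hzip, RelFact.others_rawInstance facts bags hcinj h₁ h₂]
      refine Prod.ext rfl (Prod.ext ?_ ?_)
      · refine hF.symm.trans ?_
        change _ = List.map _ (List.map _ _)
        rw [List.map_map]
        rfl
      · refine hB.symm.trans ?_
        change _ = List.map _ (List.map _ _)
        rw [List.map_map]
        refine List.map_congr_left fun B _ => ?_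
        rw [Function.comp_apply, List.map_map]
        rfl
    rw [hq, enc_rawInstance]
    exact PathInstance.encodes_ofLists e _ _ _
  · intro w hw
    refine PathInstance.widthLE_ofLists e _ _ _ fun C hC =>
      D.card_le_of_mem_expandBags t (fun B hB => hw _ ?_) hC
    rw [hbags]
    exact List.mem_map_of_mem hB
  · change I.n + m * D.stride K ≤ _
    have hm' : m ≤ I.n ^ p := RelFact.length_tuples_le facts
    simp only [queryBound, stride, Polynomial.eval_add, Polynomial.eval_mul, Polynomial.eval_pow,
      Polynomial.eval_X, Polynomial.eval_C, Polynomial.eval_one, hK]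
    gcongr
  · rw [RawInstance.decode]
    dsimp only
    rw [hunary, hlen, PathInstance.homCount_ofLists, D.decode_eq hd hD t base, RelStr.homCount]
    refine Nat.card_congr (Equiv.subtypeEquivRight fun h => ?_)
    rw [RelFact.isHom_iff hfacts]
    refine and_congr_right fun _ => ⟨fun h' x hx => ?_, fun h' j => ?_⟩
    · obtain ⟨j, rfl⟩ := List.get_of_mem (List.mem_dedup.2 hx)
      exact h' j
    · exact h' _ (List.mem_dedup.1 (List.get_mem ts j))

/-- A gadget that expresses a positive multiple of the indicator function of `R` yields a
reduction with a single call of the oracle. -/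
theorem pathwidthReduces [Fintype (RelSymbol V)] [Fintype (ListSymbol V)] {H : SimpleGraph V}
    {R : Set (Fin p → V)} [DecidablePred (· ∈ R)] {d : ℕ} (hp : 0 < p) (hd : 0 < d)
    (hD : ∀ x, D.val H x = if x ∈ R then (d : ℤ) else 0) :
    PathwidthReduces ((RelStr.ofGraph H).addRel R).plus (RelStr.ofGraph H).plus := by
  obtain ⟨T, hT⟩ := exists_lookup_comp_eq (symbolNumber_injective (RelSymbol V))
    (fun s => symbolNumber (ListSymbol V) (s.map (fun _ => ()) _root_.id))
  set r := symbolNumber (RelSymbol V) (Sum.inl none) with hr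
  obtain ⟨P, b, hP⟩ := D.polyTime_rawQuery (symbolNumber (ListSymbol V)) r (Fintype.card V) d T
  obtain ⟨P', b', hP'⟩ := RawInstance.polyTime_decode r (Fintype.card V) d
  obtain ⟨_, b₀, hb₀⟩ := RawInstance.polyTime_elements
  let ans : Polynomial ℕ := Polynomial.C (Fintype.card V) * (D.queryBound d).comp b₀ + 2
  refine ⟨.seq (.pair (.op .id) (.seq P .query)) P',
    2 * Polynomial.X + 2 * b + ans + b'.comp (Polynomial.X + ans + 1) + 10,
    (normBound (symArity V)).comp (D.queryBound d), q + 1, ?_⟩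
  rintro I w hw v ⟨facts, bags, hfacts, hbags, rfl⟩
  obtain ⟨J, hJ, hJw, hJn, hdec⟩ := D.exists_encodes_rawQuery hp hd hD (hT (Sum.inl (some ())))
    (fun L => hT (Sum.inr L)) I hfacts hbags
  rw [← hr] at hJ hdec
  rw [← enc_rawInstance]
  set x := rawInstance (symbolNumber (RelSymbol V)) facts bags with hx
  set y := D.rawQuery (symbolNumber (ListSymbol V)) r (Fintype.card V) d T x with hy
  set Z := J.str.homCount (RelStr.ofGraph H).plus with hZ
  have hn : I.n ≤ b₀.eval (Enc.sz x) := by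
    have h₁ := (hb₀ x).1
    have h₂ := Enc.length_lt_sz x.elements
    have h₃ : x.elements.length = I.n := length_elements_rawInstance _ facts fun u => by
      obtain ⟨B, hB, hu⟩ := I.isPathDecomposition.vertex u
      rw [hbags] at hB
      obtain ⟨B', hB', rfl⟩ := List.mem_map.1 hB
      exact ⟨B', hB', List.mem_toFinset.1 hu⟩
    omega
  have hZ' : Enc.sz Z ≤ ans.eval (Enc.sz x) := by
    have h₁ : Z < 2 ^ (Fintype.card V * J.n + 1) := by
      refine (J.homCount_le _).trans_lt ?_
      rw [pow_succ, pow_mul]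
      have h := Nat.pow_le_pow_left (Nat.lt_two_pow_self (n := Fintype.card V)).le J.n
      have h' : 0 < (2 ^ Fintype.card V) ^ J.n := by positivity
      omega
    have h₂ := Nat.size_le.2 h₁
    have h₃ : Fintype.card V * J.n ≤
        Fintype.card V * (D.queryBound d).eval (b₀.eval (Enc.sz x)) := by
      gcongr
      exact hJn.trans (Polynomial.eval_mono_nat _ hn)
    simp only [ans, Polynomial.eval_add, Polynomial.eval_mul, Polynomial.eval_C,
      Polynomial.eval_comp, Polynomial.eval_ofNat, Enc.sz_nat]
    omega
  obtain ⟨k, hk, hrun⟩ := (hP x).2 (homOracle (RelStr.ofGraph H).plus (w + (q + 1))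
    (((normBound (symArity V)).comp (D.queryBound d)).eval I.str.norm))
  obtain ⟨k', hk', hrun'⟩ := (hP' (x, Z)).2 (homOracle (RelStr.ofGraph H).plus (w + (q + 1))
    (((normBound (symArity V)).comp (D.queryBound d)).eval I.str.norm))
  have hnorm : J.str.norm ≤
      ((normBound (symArity V)).comp (D.queryBound d)).eval I.str.norm := by
    refine J.str.norm_le.trans ?_
    rw [Polynomial.eval_comp]
    refine Polynomial.eval_mono_nat _ (hJn.trans (Polynomial.eval_mono_nat _ ?_))
    rw [RelStr.norm, Fintype.card_fin]
    omega
  have horacle : homOracle (RelStr.ofGraph H).plus (w + (q + 1))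
      (((normBound (symArity V)).comp (D.queryBound d)).eval I.str.norm) (Enc.enc y) (Enc.enc Z) :=
    ⟨J, hJ, hJw w hw, hnorm, rfl⟩
  rw [hdec] at hrun'
  refine ⟨_, ?_, .seq (.pair (.op .id _) (.seq hrun (.query horacle))) hrun'⟩
  have hy' : (Enc.enc y).size ≤ b.eval (Enc.sz x) := (hP x).1
  have hk'' := hk'.trans (b'.eval_mono_nat
    (show Enc.sz (x, Z) ≤ Enc.sz x + ans.eval (Enc.sz x) + 1 by rw [Enc.sz_pair]; omega))
  change 1 + Enc.sz x + Enc.sz x + (k + (1 + (Enc.enc y).size + Enc.sz Z) + 1) + 1 + k' + 1 ≤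
    Polynomial.eval (Enc.sz x) _
  simp only [Polynomial.eval_add, Polynomial.eval_mul, Polynomial.eval_comp, Polynomial.eval_X,
    Polynomial.eval_one, Polynomial.eval_ofNat]
  omega

end Gadget

theorem mainTheorem3 {V : Type*} [Fintype V] (H : SimpleGraph V)
    (hconn : H.Connected) (hbip : H.IsBipartite) (hirr : 2 ≤ irr H)
    (S : Set V) (hside : OneSided H S) (hS : Irredundant H S)
    (p : ℕ) (hp : 1 ≤ p) (R : Set (Fin p → V)) (hR : ∀ f ∈ R, ∀ i, f i ∈ S) :
    Realizable (RelStr.ofGraph H) R := by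
  classical
  obtain ⟨Y, hY, b, hb, b', hb', hne, hnbr⟩ := exists_ne_of_two_le_irr hirr
  obtain ⟨u, w₀, v, w, hpath⟩ := (IsSide.of_isBipartiteWith hconn hne hY).exists_inducedPath
    (iff_of_true hb hb') hnbr
  obtain ⟨X, hX, hSX⟩ := hside
  obtain ⟨d, hd, q, D, hD⟩ := hpath.exists_expressible_indicator
    (IsSide.of_isBipartiteWith hconn hne hX) hSX hS hR
  exact D.pathwidthReduces hp hd fun x => (congrFun hD x).symm
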